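/- Let $p_0,\dots,p_{n-1}$ be processes arranged on a ring (indices modulo $n$), to be placed on $\ell$ servers of capacity $k\ge 2$, where $n\le \ell k$. At the start a placement with at most $k$ processes on every server is given. Requests $\sigma_t=\{p_j,p_{j+1}\}$ arrive one by one. Serving a request costs $1$ if its two processes are currently on different servers and $0$ otherwise; after serving it, an online algorithm, which does not know the future requests, may migrate processes between servers at cost $1$ per migrated process. For a request sequence $\sigma$, let $\mathrm{OPT}(\sigma)$ be the minimum cost of a static algorithm, i.e. the minimum, over all placements with at most $k$ processes on every server, of the number of processes that have to be migrated to reach this placement from the initial one plus the number of requests of $\sigma$ whose two processes it puts on different servers. There is an absolute constant $C>0$ such that for all $n$, $\ell$, $k\ge 2$, every $\epsilon>0$ and every initial placement as above there is a randomized online algorithm that starts with the initial placement, at all times has at most $(3+\epsilon)k$ processes on every server, and whose expected total (communication plus migration) cost on every request sequence $\sigma$ is at most $$\frac{C}{\min\{\epsilon,1\}^2}\,\log^2 k\cdot \mathrm{OPT}(\sigma),$$ with no additive term. -/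

import Mathlib

open MeasureTheory

namespace RingPartitioning

/-- A placement of the processes `p_0, …, p_{n-1}` on `ℓ` servers. -/
abbrev Placement (n ℓ : ℕ) : Type := Fin n → Fin ℓ

/-- The successor of a process on the ring: `p_{i+1}`, with indices taken modulo `n`. -/
def next {n : ℕ} (i : Fin n) : Fin n := ⟨(i.val + 1) % n, Nat.mod_lt _ i.pos⟩

/-- A communication request; `i` stands for the request `{p_i, p_{i+1}}`. -/
abbrev Request (n : ℕ) : Type := Fin n

/-- The number of processes located on server `s`. -/
def load {n ℓ : ℕ} (c : Placement n ℓ) (s : Fin ℓ) : ℕ :=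
  (Finset.univ.filter fun p => c p = s).card

/-- Every server has at most `k` processes. -/
def Feasible {n ℓ : ℕ} (k : ℕ) (c : Placement n ℓ) : Prop :=
  ∀ s, load c s ≤ k

/-- Communication cost of a request: `1` if its two processes are on different servers,
`0` otherwise. -/
def commCost {n ℓ : ℕ} (c : Placement n ℓ) (r : Request n) : ℕ :=
  if c r = c (next r) then 0 else 1

/-- Migration cost: the number of processes whose server changes. -/
def migrationCost {n ℓ : ℕ} (c d : Placement n ℓ) : ℕ :=
  (Finset.univ.filter fun p => c p ≠ d p).card

/-- Cost of the static algorithm that migrates from `init` to `c` before the first request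
and then keeps the placement `c` for the whole request sequence `σ`. -/
def staticCost {n ℓ : ℕ} (init c : Placement n ℓ) (σ : List (Request n)) : ℕ :=
  migrationCost init c + (σ.map (commCost c)).sum

/-- `OPT`: the least cost on `σ` of a static algorithm that starts with the placement `init` and
respects the capacity `k`. -/
noncomputable def staticOpt {n ℓ : ℕ} (k : ℕ) (init : Placement n ℓ)
    (σ : List (Request n)) : ℕ :=
  sInf {m | ∃ c : Placement n ℓ, Feasible k c ∧ staticCost init c σ = m}

/-- If the initial placement respects the capacities, `OPT` is attained. -/
theorem exists_staticCost_eq_staticOpt {n ℓ k : ℕ} {init : Placement n ℓ}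
    (h : Feasible k init) (σ : List (Request n)) :
    ∃ c : Placement n ℓ, Feasible k c ∧ staticCost init c σ = staticOpt k init σ :=
  Nat.sInf_mem (s := {m | ∃ c : Placement n ℓ, Feasible k c ∧ staticCost init c σ = m})
    ⟨_, init, h, rfl⟩

/-- A deterministic online algorithm, given by the placement it has chosen once the requests in
the list (in order of arrival) have been served. -/
abbrev OnlineStrategy (n ℓ : ℕ) : Type := List (Request n) → Placement n ℓ

/-- Total cost of an online strategy on `σ`. Each request is served with the placement that was
chosen before it arrived; afterwards the strategy may migrate. -/
def onlineCost {n ℓ : ℕ} (S : OnlineStrategy n ℓ) (σ : List (Request n)) : ℕ :=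
  ∑ t : Fin σ.length,
    (commCost (S (σ.take t.val)) (σ.get t) + migrationCost (S (σ.take t.val)) (S (σ.take (t.val + 1))))

/-- A randomized online algorithm that starts with the placement `init`: a random deterministic
online strategy, over an arbitrary probability space. -/
structure RandomizedOnlineAlgorithm {n ℓ : ℕ} (init : Placement n ℓ) where
  /-- the sample space -/
  Ω : Type
  /-- its events -/
  mΩ : MeasurableSpace Ω
  /-- the distribution of the random choices -/
  μ : Measure Ω
  /-- `μ` is a probability measure -/
  isProb : IsProbabilityMeasure μ
  /-- the strategy played for each outcome of the random choices -/
  strategy : Ω → OnlineStrategy n ℓ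
  /-- the placement after each finite sequence of requests is a random variable -/
  measurable_strategy : ∀ h : List (Request n), Measurable fun ω => strategy ω h
  /-- before the first request nothing has been migrated -/
  strategy_nil : ∀ ω, strategy ω [] = init

namespace RandomizedOnlineAlgorithm

variable {n ℓ : ℕ} {init : Placement n ℓ}

/-- The algorithm uses resource augmentation `α` with respect to the capacity `k`: whatever the
requests and the random choices are, no server ever holds more than `α * k` processes. -/
def UsesAugmentation (A : RandomizedOnlineAlgorithm init) (α : ℝ) (k : ℕ) : Prop :=
  ∀ (ω : A.Ω) (h : List (Request n)) (s : Fin ℓ), (load (A.strategy ω h) s : ℝ) ≤ α * k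

/-- The expected cost of the algorithm on the request sequence `σ`. -/
noncomputable def expectedCost (A : RandomizedOnlineAlgorithm init)
    (σ : List (Request n)) : ℝ :=
  letI := A.mΩ
  ∫ ω, (onlineCost (A.strategy ω) σ : ℝ) ∂A.μ

/-- The cost is always integrable, so `expectedCost` is a genuine expectation. -/
theorem integrable_cost (A : RandomizedOnlineAlgorithm init) (σ : List (Request n)) :
    letI := A.mΩ
    Integrable (fun ω => (onlineCost (A.strategy ω) σ : ℝ)) A.μ := by
  let _ := A.mΩ
  have := A.isProb
  have hc (r : Request n) : Measurable fun c : Placement n ℓ => (commCost c r : ℝ) :=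
    measurable_of_countable _
  have hd : Measurable (Function.uncurry fun c d : Placement n ℓ => (migrationCost c d : ℝ)) :=
    measurable_of_countable _
  have hm : Measurable fun ω => (onlineCost (A.strategy ω) σ : ℝ) := by
    simp only [onlineCost, Nat.cast_sum, Nat.cast_add]
    refine Finset.measurable_sum _ fun t _ => ?_
    have h1 := ((hc (σ.get t)).comp (A.measurable_strategy (σ.take t.val)))
    have h2 := ((A.measurable_strategy (σ.take t.val)).prodMk
          (A.measurable_strategy (σ.take (t.val + 1))))
    have h3 := hd.comp h2
    refine Measurable.add ?_ ?_
    · exact h1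
    exact h3
  refine Integrable.of_bound hm.aestronglyMeasurable (∑ _t : Fin σ.length, ((1 : ℝ) + n))
    (Filter.Eventually.of_forall fun ω => ?_)
  rw [Real.norm_of_nonneg (Nat.cast_nonneg _)]
  unfold onlineCost
  push_cast
  refine Finset.sum_le_sum fun t _ => add_le_add ?_ ?_
  · unfold commCost
    split_ifs <;> simp
  · have := Finset.card_filter_le (Finset.univ : Finset (Fin n))
      (fun p => A.strategy ω (σ.take t.val) p ≠ A.strategy ω (σ.take (t.val + 1)) p)
    rw [Finset.card_univ, Fintype.card_fin] at this
    exact_mod_cast this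

end RandomizedOnlineAlgorithm

end RingPartitioning

/-!
# Randomized online partitioning of a ring

Let `u` count the requests to every edge of the ring. An arc is *saturated* (`Sat`) if every one of
its edges has been requested at least as often as the arc has edges, and the initial placement is
not nearly monochromatic on it. A static algorithm either has a cut inside such an arc or has to
migrate a constant fraction of it, so it pays for the length of the arc. Around each saturated arc
an interval of nine times its length is reserved, unless the arc is already covered by an earlier
interval. Reserved arcs of the same order of magnitude are then disjoint, so the total length of all
reserved arcs (the family `skel`) is `O(log k)` times the cost of any static algorithm
(`sum_skel_le`). It remains to pay `O(log k)` per unit of reserved length.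

The ring is cut open at a uniformly random edge `θ`. As long as `θ` is not covered by a reserved
interval, the placement is defined on the resulting path (`Setting.col`). Each maximal reserved
interval has a left and a right cut. The processes between the right cut of one interval and the left
cut of the next one keep a common colour, namely the initial colour that prevails in the heavily
requested segments next to the cuts; no other colour can be nearly as frequent there, for otherwise
the segment would be saturated and a larger interval would have been reserved. The remaining
processes are *guests*. The cuts move by marking games (`pick`): a cut walks among the edges that are
not yet marked in the current phase, in a uniformly random order of priority, and the range of the
game grows by a factor `1 + 1 / q` from phase to phase (`gpick`). Against a request sequence that
does not depend on the priorities, a phase on `b` edges costs `O(b)` times a harmonic number in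
expectation; `phasePot` is a potential for this (`sum_perm_hit_le`). The expected cost of an arc is
therefore linear in its length, up to a factor `O(q log k)` (`arcPot_le`). An interval in which
every edge has been requested often has become nearly monochromatic again or is covered by a larger
one; such a dead interval is dropped.

Guests are distributed over the servers by zones. The ring has about `n / k` zone cuts, each of which
moves in its own window of `k` edges by a further marking game whose thresholds double. As no server
can hold `k + 1` processes, a static algorithm has a cut in each window and pays for the requests
there, which bounds the costs of the game up to a start-up cost of order `k log k` (`zonePot_le`).
The start-up cost is small on average because a zone cut is used only after its first edge, or the
edge `θ`, has been covered, and these edges are uniformly random (`sum_zonesPot_le`). This is why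
there is no additive term. If `θ` itself gets covered, all processes become guests; this costs `n`, but
its probability is at most the reserved length divided by `n`.

A server thus holds at most `2 k` guests (`card_zone_le`), at most `k` processes that it had at the
start, and at most `2 k / c` others (`Setting.Live.card_new_le`): a process with a new colour lies in
an interval in which that colour was already prevalent by a factor `c` at the start. Here
`q = 2 c + 1` is the precision of nearly monochromatic intervals, so `c = ⌈2 / min ε 1⌉` gives the
augmentation `3 + ε`, and the cost carries the factor `q ^ 2`.
-/

namespace RingPartitioning

open Finset

set_option linter.unusedSectionVars false

/-! ### Marking games -/

/-- The indices below `b` whose counter is still below the threshold `τ`. -/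
def unmarked (b τ : ℕ) (u : ℕ → ℕ) : Finset ℕ := (range b).filter fun i => u i < τ

/-- The index of `S` of least priority (the smallest one, if there are several). It is `0` if `S`
is empty. -/
noncomputable def firstMin (S : Finset ℕ) (ρ : ℕ → ℕ) : ℕ :=
  open Classical in
  if h : ∃ i, i ∈ S ∧ ∀ j ∈ S, ρ i ≤ ρ j then Nat.find h else 0

/-- A marking game is given by phases; phase `m` is played on the indices below `b m` with
threshold `τ m`. It is open as long as some phase has an unmarked index. -/
def GameOpen (b τ : ℕ → ℕ) (u : ℕ → ℕ) : Prop := ∃ m, (unmarked (b m) (τ m) u).Nonempty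

/-- The current phase: the first one with an unmarked index. -/
noncomputable def phase (b τ : ℕ → ℕ) (u : ℕ → ℕ) : ℕ :=
  open Classical in
  if h : GameOpen b τ u then Nat.find h else 0

/-- The position of the player: the unmarked index of least priority in the current phase, and `0`
after the end of the game. -/
noncomputable def pick (b τ : ℕ → ℕ) (u ρ : ℕ → ℕ) : ℕ :=
  firstMin (unmarked (b (phase b τ u)) (τ (phase b τ u)) u) ρ

theorem mem_unmarked {b τ : ℕ} {u : ℕ → ℕ} {i : ℕ} : i ∈ unmarked b τ u ↔ i < b ∧ u i < τ := by
  simp [unmarked]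

theorem unmarked_anti {b τ : ℕ} {u v : ℕ → ℕ} (h : u ≤ v) : unmarked b τ v ⊆ unmarked b τ u := by
  intro i hi
  rw [mem_unmarked] at hi ⊢
  exact ⟨hi.1, (h i).trans_lt hi.2⟩

theorem exists_firstMin {S : Finset ℕ} (h : S.Nonempty) (ρ : ℕ → ℕ) :
    ∃ i, i ∈ S ∧ ∀ j ∈ S, ρ i ≤ ρ j := S.exists_min_image ρ h

theorem firstMin_spec {S : Finset ℕ} (h : S.Nonempty) (ρ : ℕ → ℕ) :
    firstMin S ρ ∈ S ∧ ∀ j ∈ S, ρ (firstMin S ρ) ≤ ρ j := by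
  classical
  have h' := exists_firstMin h ρ
  rw [firstMin, dif_pos h']
  exact Nat.find_spec h'

theorem firstMin_empty (ρ : ℕ → ℕ) : firstMin ∅ ρ = 0 := by
  simp [firstMin]

theorem firstMin_unique {S : Finset ℕ} {ρ : ℕ → ℕ} {i : ℕ} (hi : i ∈ S)
    (h : ∀ j ∈ S, j ≠ i → ρ i < ρ j) : firstMin S ρ = i := by
  have hs := firstMin_spec ⟨i, hi⟩ ρ
  by_contra hne
  exact absurd (hs.2 i hi) (not_le.2 (h _ hs.1 hne))

/-- Deleting another index does not change the choice. -/
theorem firstMin_erase {S : Finset ℕ} {ρ : ℕ → ℕ} {i : ℕ} (hi : firstMin S ρ ≠ i) :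
    firstMin (S.erase i) ρ = firstMin S ρ := by
  classical
  rcases S.eq_empty_or_nonempty with rfl | hS
  · simp
  have h := exists_firstMin hS ρ
  have hf : firstMin S ρ = Nat.find h := by rw [firstMin, dif_pos h]
  have hs := firstMin_spec hS ρ
  have h' : ∃ j, j ∈ S.erase i ∧ ∀ l ∈ S.erase i, ρ j ≤ ρ l :=
    ⟨_, mem_erase.2 ⟨hi, hs.1⟩, fun l hl => hs.2 l (mem_of_mem_erase hl)⟩
  rw [firstMin, dif_pos h']
  rw [Nat.find_eq_iff]
  refine ⟨⟨mem_erase.2 ⟨hi, hs.1⟩, fun l hl => hs.2 l (mem_of_mem_erase hl)⟩, ?_⟩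
  rintro m hm ⟨hm1, hm2⟩
  rw [hf] at hm
  refine Nat.find_min h hm ⟨mem_of_mem_erase hm1, fun j hj => ?_⟩
  exact (hm2 _ (mem_erase.2 ⟨hi, hs.1⟩)).trans (hs.2 j hj)

variable {b τ u v ρ : ℕ → ℕ}

theorem phase_spec (h : GameOpen b τ u) :
    (unmarked (b (phase b τ u)) (τ (phase b τ u)) u).Nonempty := by
  classical
  rw [phase, dif_pos h]
  exact Nat.find_spec h

theorem phase_min {m : ℕ} (h : m < phase b τ u) : unmarked (b m) (τ m) u = ∅ := by
  classical
  by_cases ho : GameOpen b τ u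
  · rw [phase, dif_pos ho] at h
    exact not_nonempty_iff_eq_empty.1 (Nat.find_min ho h)
  · rw [phase, dif_neg ho] at h
    exact absurd h (Nat.not_lt_zero _)

theorem phase_le {m : ℕ} (h : (unmarked (b m) (τ m) u).Nonempty) : phase b τ u ≤ m := by
  by_contra hc
  rw [phase_min (not_le.1 hc)] at h
  exact not_nonempty_empty h

theorem phase_eq {m : ℕ} (h : (unmarked (b m) (τ m) u).Nonempty)
    (h' : ∀ m' < m, unmarked (b m') (τ m') u = ∅) : phase b τ u = m := by
  refine le_antisymm (phase_le h) ?_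
  by_contra hc
  have := phase_spec ⟨m, h⟩
  rw [h' _ (not_le.1 hc)] at this
  exact not_nonempty_empty this

theorem pick_mem (h : GameOpen b τ u) :
    pick b τ u ρ ∈ unmarked (b (phase b τ u)) (τ (phase b τ u)) u :=
  (firstMin_spec (phase_spec h) ρ).1

theorem unmarked_eq_empty_of_not_open (h : ¬ GameOpen b τ u) (m : ℕ) :
    unmarked (b m) (τ m) u = ∅ := by
  by_contra hc
  exact h ⟨m, nonempty_iff_ne_empty.2 hc⟩

theorem pick_of_not_open (h : ¬ GameOpen b τ u) : pick b τ u ρ = 0 := by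
  rw [pick, unmarked_eq_empty_of_not_open h, firstMin_empty]

theorem GameOpen.anti (huv : u ≤ v) (h : GameOpen b τ v) : GameOpen b τ u := by
  obtain ⟨m, hm⟩ := h
  exact ⟨m, hm.mono (unmarked_anti huv)⟩

theorem phase_mono (huv : u ≤ v) (h : GameOpen b τ v) : phase b τ u ≤ phase b τ v :=
  phase_le ((phase_spec h).mono (unmarked_anti huv))

theorem le_update_succ (u : ℕ → ℕ) (i : ℕ) : u ≤ Function.update u i (u i + 1) := by
  intro j
  by_cases h : j = i
  · subst h; simp
  · simp [h]

theorem unmarked_update (b τ : ℕ) (u : ℕ → ℕ) (i : ℕ) :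
    unmarked b τ (Function.update u i (u i + 1)) =
      if u i + 1 = τ then (unmarked b τ u).erase i else unmarked b τ u := by
  ext j
  by_cases hji : j = i
  · subst hji
    split_ifs with h <;> simp [mem_unmarked] <;> omega
  · split_ifs with h <;> simp [mem_unmarked, hji]

/-- The player moves only if her own index is hit and gets marked by this hit. -/
theorem pick_update {i : ℕ}
    (h : pick b τ (Function.update u i (u i + 1)) ρ ≠ pick b τ u ρ) :
    GameOpen b τ u ∧ pick b τ u ρ = i ∧ u i + 1 = τ (phase b τ u) := by
  have hle := le_update_succ u i
  by_cases ho : GameOpen b τ u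
  swap
  · exact absurd (by rw [pick_of_not_open ho, pick_of_not_open fun h' => ho (h'.anti hle)]) h
  refine ⟨ho, ?_⟩
  by_contra hc
  apply h
  have hmem := pick_mem (ρ := ρ) ho
  have hup := unmarked_update (b (phase b τ u)) (τ (phase b τ u)) u i
  have hpick : pick b τ u ρ ∈
      unmarked (b (phase b τ u)) (τ (phase b τ u)) (Function.update u i (u i + 1)) := by
    rw [hup]
    split_ifs with h1
    · exact mem_erase.2 ⟨fun h2 => hc ⟨h2, h1⟩, hmem⟩
    · exact hmem
  have hph : phase b τ (Function.update u i (u i + 1)) = phase b τ u :=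
    phase_eq ⟨_, hpick⟩ fun m hm => subset_empty.1 ((unmarked_anti hle).trans (phase_min hm).subset)
  rw [pick, hph, hup]
  split_ifs with h1
  · exact firstMin_erase fun h2 => hc ⟨h2, h1⟩
  · rfl

/-! ### The potential of a marking game -/

/-- The number of indices below `b` whose counter is at most `v`. -/
def countLE (b v : ℕ) (u : ℕ → ℕ) : ℕ := ((range b).filter fun i => u i ≤ v).card

/-- The potential of a single phase. A hit of an unmarked index raises the sum by at least the
inverse of the number of unmarked indices, and a hit that marks an index raises the second term
by `K` times that. -/
noncomputable def phasePot (b τ : ℕ) (K : ℝ) (u : ℕ → ℕ) : ℝ :=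
  ∑ v ∈ range τ, ((harmonic b : ℝ) - harmonic (countLE b v u)) +
    K * ((harmonic b : ℝ) - harmonic (countLE b (τ - 1) u))

theorem harmonic_mono {m n : ℕ} (h : m ≤ n) : (harmonic m : ℝ) ≤ harmonic n := by
  have : harmonic m ≤ harmonic n := by
    unfold harmonic
    exact sum_le_sum_of_subset_of_nonneg (range_mono h) fun i _ _ => by positivity
  exact_mod_cast this

theorem harmonic_nonneg (n : ℕ) : (0 : ℝ) ≤ harmonic n := by
  have := harmonic_mono (Nat.zero_le n)
  simpa using this

theorem countLE_le (b v : ℕ) (u : ℕ → ℕ) : countLE b v u ≤ b :=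
  (card_filter_le _ _).trans_eq (card_range b)

theorem countLE_anti {b x : ℕ} {u v : ℕ → ℕ} (h : u ≤ v) : countLE b x v ≤ countLE b x u :=
  card_le_card fun i hi => by
    rw [mem_filter] at hi ⊢
    exact ⟨hi.1, (h i).trans hi.2⟩

theorem phasePot_term_nonneg (b v : ℕ) (u : ℕ → ℕ) :
    0 ≤ (harmonic b : ℝ) - harmonic (countLE b v u) :=
  sub_nonneg.2 (harmonic_mono (countLE_le b v u))

theorem phasePot_nonneg {b τ : ℕ} {K : ℝ} (hK : 0 ≤ K) (u : ℕ → ℕ) : 0 ≤ phasePot b τ K u :=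
  add_nonneg (sum_nonneg fun _ _ => phasePot_term_nonneg _ _ _)
    (mul_nonneg hK (phasePot_term_nonneg _ _ _))

theorem phasePot_mono {b τ : ℕ} {K : ℝ} (hK : 0 ≤ K) {u v : ℕ → ℕ} (h : u ≤ v) :
    phasePot b τ K u ≤ phasePot b τ K v := by
  unfold phasePot
  gcongr <;> exact_mod_cast harmonic_mono (countLE_anti h)

theorem phasePot_le {b τ : ℕ} {K : ℝ} (hK : 0 ≤ K) (u : ℕ → ℕ) :
    phasePot b τ K u ≤ (τ + K) * harmonic b := by
  have h1 : ∀ v, (harmonic b : ℝ) - harmonic (countLE b v u) ≤ harmonic b := fun v =>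
    sub_le_self _ (harmonic_nonneg _)
  have h2 : ∑ v ∈ range τ, ((harmonic b : ℝ) - harmonic (countLE b v u)) ≤ τ * harmonic b := by
    refine (sum_le_sum fun v _ => h1 v).trans ?_
    simp
  unfold phasePot
  have h3 := mul_le_mul_of_nonneg_left (h1 (τ - 1)) hK
  linarith

theorem countLE_update {b i : ℕ} (hi : i < b) (u : ℕ → ℕ) :
    countLE b (u i) u = countLE b (u i) (Function.update u i (u i + 1)) + 1 := by
  unfold countLE
  have : ((range b).filter fun j => u j ≤ u i) =
      insert i ((range b).filter fun j => Function.update u i (u i + 1) j ≤ u i) := by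
    ext j
    by_cases hji : j = i
    · subst hji; simp [hi]
    · simp [hji]
  rw [this, card_insert_of_notMem (by simp)]

/-- A hit of the index `i` raises the potential by its cost divided by the number of unmarked indices,
which is the expected cost of the hit if the player is at a uniformly random unmarked index: the
harmonic number of the count at the level of `i` drops by one term. -/
theorem phasePot_hit {b τ : ℕ} {K : ℝ} (hK : 0 ≤ K) {u : ℕ → ℕ} {i : ℕ}
    (hi : i ∈ unmarked b τ u) :
    (1 + if u i + 1 = τ then K else 0) / (unmarked b τ u).card ≤
      phasePot b τ K (Function.update u i (u i + 1)) - phasePot b τ K u := by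
  obtain ⟨hib, hiτ⟩ := mem_unmarked.1 hi
  set u' := Function.update u i (u i + 1) with hu'
  have hle : u ≤ u' := le_update_succ u i
  have hcard : 0 < (unmarked b τ u).card := card_pos.2 ⟨i, hi⟩
  have hstep : (harmonic (countLE b (u i) u) : ℝ) - harmonic (countLE b (u i) u') =
      1 / (countLE b (u i) u : ℝ) := by
    rw [countLE_update hib u, harmonic_succ]
    push_cast
    simp [hu']
  have hcpos : 0 < countLE b (u i) u := by rw [countLE_update hib u]; omega
  have hcle : countLE b (u i) u ≤ (unmarked b τ u).card := card_le_card fun j hj => by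
    rw [mem_filter, mem_range] at hj
    exact mem_unmarked.2 ⟨hj.1, hj.2.trans_lt hiτ⟩
  have hinv : 1 / ((unmarked b τ u).card : ℝ) ≤ 1 / (countLE b (u i) u : ℝ) := by
    apply one_div_le_one_div_of_le
    · exact_mod_cast hcpos
    · exact_mod_cast hcle
  have hdiff : phasePot b τ K u' - phasePot b τ K u =
      ∑ v ∈ range τ, ((harmonic (countLE b v u) : ℝ) - harmonic (countLE b v u')) +
      K * ((harmonic (countLE b (τ - 1) u) : ℝ) - harmonic (countLE b (τ - 1) u')) := by
    unfold phasePot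
    have : ∑ v ∈ range τ, ((harmonic (countLE b v u) : ℝ) - harmonic (countLE b v u')) =
        ∑ v ∈ range τ, ((harmonic b : ℝ) - harmonic (countLE b v u')) -
        ∑ v ∈ range τ, ((harmonic b : ℝ) - harmonic (countLE b v u)) := by
      rw [← sum_sub_distrib]
      exact sum_congr rfl fun _ _ => by ring
    rw [this]; ring
  have hterm : ∀ v, 0 ≤ (harmonic (countLE b v u) : ℝ) - harmonic (countLE b v u') := fun v =>
    sub_nonneg.2 (harmonic_mono (countLE_anti hle))
  have h1 : 1 / ((unmarked b τ u).card : ℝ) ≤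
      ∑ v ∈ range τ, ((harmonic (countLE b v u) : ℝ) - harmonic (countLE b v u')) := by
    refine hinv.trans ?_
    rw [← hstep]
    exact single_le_sum (f := fun v => (harmonic (countLE b v u) : ℝ) - harmonic (countLE b v u'))
      (fun v _ => hterm v) (mem_range.2 hiτ)
  rw [hdiff, add_div]
  refine add_le_add h1 ?_
  split_ifs with h
  · have : τ - 1 = u i := by omega
    rw [this, hstep, div_eq_mul_one_div]
    exact mul_le_mul_of_nonneg_left hinv hK
  · rw [zero_div]
    exact mul_nonneg hK (hterm _)

/-! ### Uniformly random priorities -/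

/-- Under a uniformly random permutation, a given index of `S` has the least priority with
probability `1 / |S|`. -/
theorem card_firstMin_mul_le {n : ℕ} {S : Finset ℕ} {g : ℕ → Fin n} (hg : Set.InjOn g S) {i : ℕ}
    (hi : i ∈ S) :
    ((univ : Finset (Equiv.Perm (Fin n))).filter
      fun π => firstMin S (fun j => (π (g j)).val) = i).card * S.card ≤ n.factorial := by
  classical
  set Ev : ℕ → Finset (Equiv.Perm (Fin n)) := fun i =>
    univ.filter fun π => firstMin S (fun j => (π (g j)).val) = i with hEv
  have hswap : ∀ j ∈ S, (Ev i).card ≤ (Ev j).card := by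
    intro j hj
    refine card_le_card_of_injOn (fun π => π * Equiv.swap (g i) (g j)) ?_
      (fun _ _ _ _ h => mul_right_cancel h)
    intro π hπ
    simp only [hEv, coe_filter, mem_univ, true_and, Set.mem_ofPred_eq] at hπ ⊢
    have hspec := (firstMin_spec ⟨i, hi⟩ (fun j => (π (g j)).val)).2
    rw [hπ] at hspec
    have hlt : ∀ l ∈ S, l ≠ i → (π (g i)).val < (π (g l)).val := by
      intro l hl hli
      refine lt_of_le_of_ne (hspec l hl) fun h => hli ?_
      exact (hg hi hl (π.injective (Fin.ext h))).symm
    refine firstMin_unique hj fun l hl hlj => ?_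
    simp only [Equiv.Perm.coe_mul, Function.comp_apply, Equiv.swap_apply_right]
    by_cases hli : l = i
    · subst hli
      rw [Equiv.swap_apply_left]
      exact hlt j hj (Ne.symm hlj)
    · rw [Equiv.swap_apply_of_ne_of_ne (fun h => hli (hg hl hi h)) (fun h => hlj (hg hl hj h))]
      exact hlt l hl hli
  have hdisj : ∀ x ∈ S, ∀ y ∈ S, x ≠ y → Disjoint (Ev x) (Ev y) := by
    intro x _ y _ hxy
    rw [disjoint_filter]
    rintro π - rfl h
    exact hxy h
  calc (Ev i).card * S.card = ∑ _j ∈ S, (Ev i).card := by simp [mul_comm]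
    _ ≤ ∑ j ∈ S, (Ev j).card := sum_le_sum hswap
    _ = (S.biUnion Ev).card := (card_biUnion hdisj).symm
    _ ≤ (univ : Finset (Equiv.Perm (Fin n))).card := card_le_univ _
    _ = n.factorial := by rw [card_univ, Fintype.card_perm, Fintype.card_fin]

/-- The expected cost of a hit in a marking game: `1` if the player is hit, and `K` more if she has
to move. It is at most the increase of the potential of the current phase. -/
theorem sum_perm_hit_le {n : ℕ} {b τ u : ℕ → ℕ} {g : ℕ → Fin n} {K : ℕ → ℝ} (hK : ∀ m, 0 ≤ K m)
    (hg : GameOpen b τ u → Set.InjOn g (Set.Iio (b (phase b τ u)))) {i : ℕ} :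
    (∑ π : Equiv.Perm (Fin n),
      open Classical in
      if GameOpen b τ u ∧ pick b τ u (fun j => (π (g j)).val) = i then
        1 + (if u i + 1 = τ (phase b τ u) then K (phase b τ u) else 0) else 0) ≤
      n.factorial *
        (phasePot (b (phase b τ u)) (τ (phase b τ u)) (K (phase b τ u))
            (Function.update u i (u i + 1)) -
          phasePot (b (phase b τ u)) (τ (phase b τ u)) (K (phase b τ u)) u) := by
  classical
  set m := phase b τ u with hm
  have hmono := sub_nonneg.2 (phasePot_mono (b := b m) (τ := τ m) (hK m) (le_update_succ u i))
  by_cases ho : GameOpen b τ u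
  swap
  · simp only [ho, false_and, if_false, sum_const_zero]
    positivity
  by_cases hi : i ∈ unmarked (b m) (τ m) u
  · have h1 := phasePot_hit (hK m) hi
    have hinj : Set.InjOn g (unmarked (b m) (τ m) u) :=
      (hg ho).mono fun j hj => (mem_unmarked.1 hj).1
    have h2 := card_firstMin_mul_le hinj hi
    have hc : 0 < (unmarked (b m) (τ m) u).card := card_pos.2 ⟨i, hi⟩
    simp only [ho, true_and]
    rw [← sum_filter, sum_const, nsmul_eq_mul]
    set A : ℝ := 1 + if u i + 1 = τ m then K m else 0 with hA
    have hA0 : 0 ≤ A := by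
      rw [hA]; split_ifs <;> linarith [hK m]
    set c := ((univ : Finset (Equiv.Perm (Fin n))).filter
      fun π => firstMin (unmarked (b m) (τ m) u) (fun j => (π (g j)).val) = i).card with hcdef
    have h3 : (c : ℝ) * A ≤ n.factorial * (A / (unmarked (b m) (τ m) u).card) := by
      rw [mul_div_assoc', le_div_iff₀ (by exact_mod_cast hc)]
      have : (c : ℝ) * (unmarked (b m) (τ m) u).card ≤ n.factorial := by exact_mod_cast h2
      nlinarith
    refine le_trans (le_of_eq ?_) (h3.trans (mul_le_mul_of_nonneg_left h1 (by positivity)))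
    rfl
  · have : ∀ π : Equiv.Perm (Fin n), ¬ (GameOpen b τ u ∧
        pick b τ u (fun j => (π (g j)).val) = i) := by
      rintro π ⟨h, rfl⟩
      exact hi (pick_mem h)
    simp only [this, if_false, sum_const_zero]
    positivity

/-! ### Growing games -/

/-- The lengths at which a growing game changes its phase: they grow by a factor `1 + 1 / q`. -/
def len (q : ℕ) : ℕ → ℕ
  | 0 => 0
  | m + 1 => len q m + 1 + len q m / q

/-- The range, and also the threshold, of phase `m` of a growing game on `Λ` indices. -/
def rng (q Λ m : ℕ) : ℕ := min (len q (m + 1)) Λ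

/-- The length of the initial segment that is known to consist of indices with large counters:
all counters below `glue q Λ u` are at least `glue q Λ u`. -/
noncomputable def glue (q Λ : ℕ) (u : ℕ → ℕ) : ℕ :=
  open Classical in
  if GameOpen (rng q Λ) (rng q Λ) u then min (len q (phase (rng q Λ) (rng q Λ) u)) Λ else Λ

/-- The position of the player in a growing game. -/
noncomputable def gpick (q Λ : ℕ) (u ρ : ℕ → ℕ) : ℕ := pick (rng q Λ) (rng q Λ) u ρ

theorem len_succ (q m : ℕ) : len q (m + 1) = len q m + 1 + len q m / q := rfl

theorem le_len (q m : ℕ) : m ≤ len q m := by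
  induction m with
  | zero => exact Nat.zero_le _
  | succ m ih => rw [len_succ]; have := Nat.zero_le (len q m / q); omega

theorem len_mono (q : ℕ) : Monotone (len q) :=
  monotone_nat_of_le_succ fun m => by
    rw [len_succ]; have := Nat.zero_le (len q m / q); omega

theorem rng_mono (q Λ : ℕ) : Monotone (rng q Λ) := fun _ _ h =>
  min_le_min_right _ (len_mono q (Nat.succ_le_succ h))

theorem rng_le (q Λ m : ℕ) : rng q Λ m ≤ Λ := min_le_right _ _

theorem rng_eq_of_le {q Λ m : ℕ} (h : Λ ≤ m) : rng q Λ m = Λ :=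
  min_eq_right ((h.trans (Nat.le_succ m)).trans (le_len q _))

theorem rng_succ_le {q Λ m : ℕ} (h : 0 < rng q Λ m) : rng q Λ (m + 1) ≤ 3 * rng q Λ m := by
  have h1 := len_succ q (m + 1)
  have h2 : len q (m + 1) / q ≤ len q (m + 1) := Nat.div_le_self _ _
  unfold rng at *
  omega

section
variable {q Λ : ℕ} {u v ρ : ℕ → ℕ}

theorem glue_le : glue q Λ u ≤ Λ := by
  unfold glue; split_ifs
  · exact min_le_right _ _
  · exact le_rfl

theorem le_of_not_open (h : ¬ GameOpen (rng q Λ) (rng q Λ) u) {i : ℕ} (hi : i < Λ) :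
    Λ ≤ u i := by
  by_contra hc
  refine h ⟨Λ, i, mem_unmarked.2 ?_⟩
  rw [rng_eq_of_le le_rfl]
  exact ⟨hi, not_le.1 hc⟩

theorem glue_le_of_lt {i : ℕ} (hi : i < glue q Λ u) : glue q Λ u ≤ u i := by
  unfold glue at *
  split_ifs at * with ho
  · set m := phase (rng q Λ) (rng q Λ) u with hm
    rcases Nat.eq_zero_or_pos m with h0 | h0
    · rw [h0] at hi
      simp [len] at hi
    · have h1 := phase_min (b := rng q Λ) (τ := rng q Λ) (u := u) (m := m - 1) (by omega)
      have h2 : rng q Λ (m - 1) = min (len q m) Λ := by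
        unfold rng; rw [Nat.sub_add_cancel h0]
      rw [h2] at h1
      by_contra hc
      have : i ∈ unmarked (min (len q m) Λ) (min (len q m) Λ) u :=
        mem_unmarked.2 ⟨hi, not_le.1 hc⟩
      rw [h1] at this
      exact notMem_empty _ this
  · exact le_of_not_open ho hi

theorem rng_phase_le (h : GameOpen (rng q Λ) (rng q Λ) u) :
    rng q Λ (phase (rng q Λ) (rng q Λ) u) ≤ glue q Λ u + 1 + glue q Λ u / q := by
  unfold glue
  rw [if_pos h]
  set m := phase (rng q Λ) (rng q Λ) u
  unfold rng
  rcases le_total (len q m) Λ with h1 | h1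
  · rw [min_eq_left h1]
    exact (min_le_left _ _).trans (len_succ q m).le
  · rw [min_eq_right h1]
    have := Nat.zero_le (Λ / q)
    exact (min_le_right _ _).trans (by omega)

theorem gpick_lt_rng (h : GameOpen (rng q Λ) (rng q Λ) u) :
    gpick q Λ u ρ < rng q Λ (phase (rng q Λ) (rng q Λ) u) :=
  (mem_unmarked.1 (pick_mem h)).1

theorem gpick_of_not_open (h : ¬ GameOpen (rng q Λ) (rng q Λ) u) : gpick q Λ u ρ = 0 :=
  pick_of_not_open h

theorem gpick_le : gpick q Λ u ρ ≤ glue q Λ u + glue q Λ u / q := by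
  by_cases h : GameOpen (rng q Λ) (rng q Λ) u
  · have h1 := gpick_lt_rng (ρ := ρ) h
    have h2 := rng_phase_le h
    omega
  · rw [gpick_of_not_open h]; exact Nat.zero_le _

theorem gpick_lt (h : 0 < Λ) : gpick q Λ u ρ < Λ := by
  by_cases ho : GameOpen (rng q Λ) (rng q Λ) u
  · exact (gpick_lt_rng ho).trans_le (rng_le _ _ _)
  · rwa [gpick_of_not_open ho]

theorem le_glue_add_div {κ : ℕ} (hκ : κ ≤ Λ) (h : ∀ i < κ, κ ≤ u i) :
    κ ≤ glue q Λ u + glue q Λ u / q := by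
  by_cases ho : GameOpen (rng q Λ) (rng q Λ) u
  · have h1 := rng_phase_le ho
    obtain ⟨i, hi⟩ := phase_spec ho
    rw [mem_unmarked] at hi
    by_contra hc
    have := h i (by omega)
    omega
  · unfold glue; rw [if_neg ho]
    exact hκ.trans (Nat.le_add_right _ _)

theorem glue_mono (h : u ≤ v) : glue q Λ u ≤ glue q Λ v := by
  by_cases ho : GameOpen (rng q Λ) (rng q Λ) v
  · have := phase_mono h ho
    unfold glue
    rw [if_pos ho, if_pos (ho.anti h)]
    exact min_le_min_right _ (len_mono q this)
  · rw [glue, glue, if_neg ho]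
    exact glue_le

theorem glue_eq_zero (h : u 0 = 0) : glue q Λ u = 0 := by
  by_contra hc
  have := glue_le_of_lt (Nat.pos_of_ne_zero hc)
  omega

/-- After a move the player stays within three times the range of the phase before the move: the
index that was marked last is unmarked in the following phase. -/
theorem gpick_update_le {i : ℕ}
    (h : gpick q Λ (Function.update u i (u i + 1)) ρ ≠ gpick q Λ u ρ) :
    gpick q Λ (Function.update u i (u i + 1)) ρ ≤
      3 * rng q Λ (phase (rng q Λ) (rng q Λ) u) := by
  obtain ⟨ho, hpi, hmark⟩ := pick_update h
  set m := phase (rng q Λ) (rng q Λ) u with hm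
  by_cases ho' : GameOpen (rng q Λ) (rng q Λ) (Function.update u i (u i + 1))
  swap
  · rw [gpick_of_not_open ho']; exact Nat.zero_le _
  have hi := pick_mem (ρ := ρ) ho
  rw [hpi, mem_unmarked, ← hm] at hi
  have hpos : 0 < rng q Λ m := by omega
  refine (gpick_lt_rng ho').le.trans (le_trans ?_ (rng_succ_le hpos))
  have hr := rng_mono q Λ (Nat.le_succ m)
  rcases hr.lt_or_eq with hlt | heq
  · apply rng_mono
    refine phase_le ⟨i, mem_unmarked.2 ⟨hi.1.trans hlt, ?_⟩⟩
    rw [Function.update_self, hmark]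
    exact hlt
  · have : rng q Λ m = Λ := by
      have h1 := len_succ q (m + 1)
      have h2 := Nat.zero_le (len q (m + 1) / q)
      unfold rng at heq ⊢
      simp only [Nat.succ_eq_add_one] at heq
      omega
    rw [Nat.succ_eq_add_one, this] at heq
    rw [← heq]
    exact rng_le _ _ _

/-- The ranges of all phases together are at most `4 q` times the number of indices. -/
theorem sum_rng_le (hq : 0 < q) :
    ∑ m ∈ (range Λ).filter (fun m => len q m < Λ), rng q Λ m ≤ 4 * q * Λ := by
  have h1 : ∀ M, ∑ m ∈ range M, (len q m + 1) ≤ q * len q M := by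
    intro M
    induction M with
    | zero => simp
    | succ M ih =>
      rw [sum_range_succ, len_succ]
      have := Nat.div_add_mod (len q M) q
      have := Nat.mod_lt (len q M) hq
      nlinarith
  rcases Nat.eq_zero_or_pos Λ with rfl | hΛ
  · simp
  have hex : ∃ M, Λ ≤ len q M := ⟨Λ, le_len q Λ⟩
  obtain ⟨M, hM, hmin⟩ : ∃ M, Λ ≤ len q M ∧ ∀ m < M, len q m < Λ := by
    classical
    exact ⟨Nat.find hex, Nat.find_spec hex, fun m hm => not_le.1 (Nat.find_min hex hm)⟩
  have hM0 : M ≠ 0 := by rintro rfl; simp [len] at hM; omega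
  obtain ⟨M', rfl⟩ := Nat.exists_eq_succ_of_ne_zero hM0
  have h2 : len q (M' + 1) ≤ 2 * Λ := by
    have h3 := hmin M' (Nat.lt_succ_self _)
    have h4 : len q M' / q ≤ len q M' := Nat.div_le_self _ _
    have h5 := len_succ q M'
    omega
  have hsub : (range Λ).filter (fun m => len q m < Λ) ⊆ range (M' + 1) := by
    intro m hm
    rw [mem_filter] at hm
    rw [mem_range]
    by_contra hc
    have := len_mono q (not_lt.1 hc)
    simp only [Nat.succ_eq_add_one] at hM
    omega
  calc _ ≤ ∑ m ∈ (range Λ).filter (fun m => len q m < Λ), 2 * (len q m + 1) := by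
        refine sum_le_sum fun m _ => ?_
        have h4 : len q m / q ≤ len q m := Nat.div_le_self _ _
        have h5 := len_succ q m
        unfold rng
        omega
    _ ≤ ∑ m ∈ range (M' + 1), 2 * (len q m + 1) := sum_le_sum_of_subset hsub
    _ = 2 * ∑ m ∈ range (M' + 1), (len q m + 1) := by rw [mul_sum]
    _ ≤ 2 * (q * (2 * Λ)) := by
        have := h1 (M' + 1)
        have := Nat.mul_le_mul_left q h2
        omega
    _ = 4 * q * Λ := by ring

/-- Only the phases with `len q m < Λ` are ever played: as soon as the length reaches `Λ`, the last phase
on all `Λ` indices has been completed. -/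
theorem phase_mem_filter (h : GameOpen (rng q Λ) (rng q Λ) u) :
    phase (rng q Λ) (rng q Λ) u ∈ (range Λ).filter (fun m => len q m < Λ) := by
  set m := phase (rng q Λ) (rng q Λ) u with hm
  obtain ⟨i, hi⟩ := phase_spec h
  rw [mem_unmarked, ← hm] at hi
  have hΛ : 0 < Λ := by
    have := rng_le q Λ m
    omega
  have hlt : len q m < Λ := by
    rcases Nat.eq_zero_or_pos m with h0 | h0
    · rw [h0]; exact hΛ
    · by_contra hc
      have h1 := phase_min (b := rng q Λ) (τ := rng q Λ) (u := u) (m := m - 1) (by omega)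
      have h2 : rng q Λ (m - 1) = rng q Λ m := by
        have := len_mono q (Nat.le_succ m)
        unfold rng; rw [Nat.sub_add_cancel h0]
        simp only [Nat.succ_eq_add_one] at this
        omega
      rw [h2] at h1
      have : i ∈ unmarked (rng q Λ m) (rng q Λ m) u := mem_unmarked.2 hi
      rw [h1] at this
      exact notMem_empty _ this
  rw [mem_filter, mem_range]
  exact ⟨(le_len q m).trans_lt hlt, hlt⟩

end

/-! ### Nearly monochromatic intervals -/

section
variable {ι : Type*} [DecidableEq ι]

/-- The interval `[x, y]` is nearly monochromatic with colour `a`: at most a fraction `1 / q` of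
its points have another colour. -/
def NearMono (q : ℕ) (F : ℤ → ι) (x y : ℤ) (a : ι) : Prop :=
  q * ((Icc x y).filter fun p => F p ≠ a).card ≤ (Icc x y).card

/-- The colour of a nearly monochromatic interval. For other intervals it is the colour of the left
end. -/
noncomputable def maj (q : ℕ) (F : ℤ → ι) (x y : ℤ) : ι :=
  open Classical in
  if h : ∃ a, NearMono q F x y a then h.choose else F x

variable {q : ℕ} {F : ℤ → ι}

theorem nearMono_maj {x y : ℤ} (h : ∃ a, NearMono q F x y a) : NearMono q F x y (maj q F x y) := by
  rw [maj, dif_pos h]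
  exact h.choose_spec

/-- Nearly monochromatic intervals with a large intersection have the same colour. -/
theorem NearMono.eq {x y x' y' u v : ℤ} {a b : ι} (h : NearMono q F x y a)
    (h' : NearMono q F x' y' b) (hu : x ≤ u) (hv : v ≤ y) (hu' : x' ≤ u) (hv' : v ≤ y')
    (hxy : x ≤ y + 1) (hxy' : x' ≤ y' + 1)
    (hov : (y + 1 - x) + (y' + 1 - x') < q * (v + 1 - u)) : a = b := by
  by_contra hab
  have hsub : Icc u v ⊆ ((Icc x y).filter fun p => F p ≠ a) ∪
      ((Icc x' y').filter fun p => F p ≠ b) := by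
    intro p hp
    rw [mem_Icc] at hp
    simp only [mem_union, mem_filter, mem_Icc]
    by_cases hpa : F p = a
    · right
      refine ⟨⟨by omega, by omega⟩, ?_⟩
      rw [hpa]; exact hab
    · left
      exact ⟨⟨by omega, by omega⟩, hpa⟩
  have h1 := (card_le_card hsub).trans (card_union_le _ _)
  unfold NearMono at h h'
  rw [Int.card_Icc] at *
  have h2 : q * (v + 1 - u).toNat ≤ (y + 1 - x).toNat + (y' + 1 - x').toNat := by
    calc _ ≤ q * _ := Nat.mul_le_mul_left q h1
      _ = _ := Nat.mul_add _ _ _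
      _ ≤ _ := add_le_add h h'
  have h3 : ((q : ℤ) * (v + 1 - u).toNat) ≤ (y + 1 - x).toNat + (y' + 1 - x').toNat := by
    exact_mod_cast h2
  have h4 : (q : ℤ) * (v + 1 - u) ≤ q * ((v + 1 - u).toNat : ℤ) :=
    mul_le_mul_of_nonneg_left (Int.self_le_toNat _) (by positivity)
  have h5 : ((y + 1 - x).toNat : ℤ) = y + 1 - x := Int.toNat_of_nonneg (by omega)
  have h6 : ((y' + 1 - x').toNat : ℤ) = y' + 1 - x' := Int.toNat_of_nonneg (by omega)
  omega

theorem nearMono_self (hq : 2 ≤ q) {x : ℤ} {a : ι} : NearMono q F x x a ↔ F x = a := by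
  unfold NearMono
  rw [Icc_self, filter_singleton, card_singleton]
  split_ifs with h
  · rw [card_singleton]
    exact ⟨fun h' => by omega, fun h' => absurd h' h⟩
  · simpa using h

theorem maj_self (hq : 2 ≤ q) (x : ℤ) : maj q F x x = F x :=
  ((nearMono_self hq).1 (nearMono_maj ⟨_, (nearMono_self hq).2 rfl⟩)).symm

/-- Along a chain of nearly monochromatic intervals that grow by one point at a time the colour
does not change. -/
theorem maj_chain (hq : 4 ≤ q) {x y : ℕ → ℤ} (hx : ∀ s, x (s + 1) ≤ x s)
    (hy : ∀ s, y s ≤ y (s + 1)) (hxy : ∀ s, y s - x s = s) {s t : ℕ} (hst : s ≤ t)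
    (h : ∀ m, s ≤ m → m ≤ t → ∃ a, NearMono q F (x m) (y m) a) :
    maj q F (x s) (y s) = maj q F (x t) (y t) := by
  induction t, hst using Nat.le_induction with
  | base => rfl
  | succ t hst ih =>
    rw [ih fun m h1 h2 => h m h1 (by omega)]
    have h1 := nearMono_maj (h t hst (by omega))
    have h2 := nearMono_maj (h (t + 1) (by omega) le_rfl)
    have e1 := hxy t
    have e2 := hxy (t + 1)
    have e3 := hx t
    have e4 := hy t
    push_cast at e2
    refine h1.eq h2 le_rfl le_rfl e3 e4 (by omega) (by omega) ?_
    have : (4 : ℤ) * (y t + 1 - x t) ≤ q * (y t + 1 - x t) :=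
      mul_le_mul_of_nonneg_right (by exact_mod_cast hq) (by omega)
    omega

/-- A nearly monochromatic interval that is extended by a fraction `1 / q` of its length still has
few points of other colours. -/
theorem NearMono.extend {q' : ℕ} {x y x' y' : ℤ} {a : ι} (h : NearMono (2 * q' + 1) F x y a)
    (hxy : x ≤ y) (hx : x' ≤ x) (hy : y ≤ y')
    (hc : (y' - x').toNat ≤ (y - x).toNat + (y - x).toNat / (2 * q' + 1)) :
    q' * ((Icc x' y').filter fun p => F p ≠ a).card ≤
      ((Icc x' y').filter fun p => F p = a).card := by
  set s := (y - x).toNat with hs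
  have hI : (Icc x y).card = s + 1 := by rw [Int.card_Icc]; omega
  have hI' : (Icc x' y').card = (y' - x').toNat + 1 := by rw [Int.card_Icc]; omega
  unfold NearMono at h
  set bad := ((Icc x y).filter fun p => F p ≠ a).card with hbad
  set good := ((Icc x y).filter fun p => F p = a).card with hgood
  set bad' := ((Icc x' y').filter fun p => F p ≠ a).card with hbad'
  set good' := ((Icc x' y').filter fun p => F p = a).card with hgood'
  have e1 : good + bad = s + 1 := by
    rw [← hI, hgood, hbad]; exact card_filter_add_card_filter_not _
  have e2 : good' + bad' = (y' - x').toNat + 1 := by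
    rw [← hI', hgood', hbad']; exact card_filter_add_card_filter_not _
  have e3 : good ≤ good' := card_le_card (filter_subset_filter _ (Icc_subset_Icc hx hy))
  have e4 : s / (2 * q' + 1) * (2 * q' + 1) ≤ s := Nat.div_mul_le_self _ _
  rw [hI] at h
  generalize s / (2 * q' + 1) = e at *
  have e5 : bad' ≤ bad + e := by omega
  have e6 : (2 * q' + 1) * bad' ≤ 2 * s + 1 := by
    have : (2 * q' + 1) * bad' ≤ (2 * q' + 1) * (bad + e) := Nat.mul_le_mul_left _ e5
    nlinarith
  have e7 : (2 * q' + 1) * (s + 1) ≤ (2 * q' + 1) * good + (s + 1) := by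
    rw [← e1]; nlinarith
  have e8 : (2 * q' + 1) * (q' * bad') ≤ (2 * q' + 1) * good := by
    have : q' * ((2 * q' + 1) * bad') ≤ q' * (2 * s + 1) := Nat.mul_le_mul_left _ e6
    nlinarith
  exact (Nat.le_of_mul_le_mul_left e8 (by omega)).trans e3

theorem card_filter_Ioc_split {P : ℤ → Prop} [DecidablePred P] {x y z : ℤ} (h : x ≤ y)
    (h' : y ≤ z) : ((Ioc x z).filter P).card =
      ((Ioc x y).filter P).card + ((Ioc y z).filter P).card := by
  rw [← card_union_of_disjoint, ← filter_union, Ioc_union_Ioc_eq_Ioc h h']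
  refine disjoint_filter_filter (disjoint_left.2 fun p hp hp' => ?_)
  rw [mem_Ioc] at hp hp'
  omega

/-- If every point of `B` lies in an interval in which colour `a` prevails by a factor `c`, then
`B` contains few points of other colours: the intervals can be thinned out so that every point is
covered at most twice. -/
theorem card_bad_le {c : ℕ} {a : ι} {hi : ℤ} (B : Finset ℤ) (hB : B.Nonempty) (t : ℤ)
    (hF : ∀ p ∈ B, F p ≠ a)
    (h : ∀ p ∈ B, ∃ x y, t < x ∧ x ≤ p ∧ p ≤ y ∧ y ≤ hi ∧
      c * ((Icc x y).filter fun p => F p ≠ a).card ≤ ((Icc x y).filter fun p => F p = a).card) :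
    c * B.card ≤ ((Ioc t hi).filter fun p => F p = a).card +
      ((Ioc (B.min' hB) hi).filter fun p => F p = a).card := by
  induction hN : B.card using Nat.strong_induction_on generalizing B t with
  | _ N ih =>
  set p := B.min' hB with hp
  have hpB : p ∈ B := B.min'_mem hB
  -- among the intervals at the least point of `B`, take one that extends furthest to the right
  obtain ⟨y, ⟨x, htx, hxp, hpy, hyhi, hc⟩, hymax⟩ : ∃ y, (∃ x, t < x ∧ x ≤ p ∧ p ≤ y ∧ y ≤ hi ∧
      c * ((Icc x y).filter fun p => F p ≠ a).card ≤ ((Icc x y).filter fun p => F p = a).card) ∧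
      ∀ z, (∃ x, t < x ∧ x ≤ p ∧ p ≤ z ∧ z ≤ hi ∧
      c * ((Icc x z).filter fun p => F p ≠ a).card ≤ ((Icc x z).filter fun p => F p = a).card) →
      z ≤ y := by
    refine Int.exists_greatest_of_bdd ⟨hi, fun z ⟨x, _, _, _, hz, _⟩ => hz⟩ ?_
    obtain ⟨x, y, h'⟩ := h p hpB
    exact ⟨y, x, h'⟩
  have hIcc : Icc x y = Ioc (x - 1) y := by ext z; simp [mem_Icc, mem_Ioc]
  have h0 : c * (B.filter fun z => z ≤ y).card ≤ ((Icc x y).filter fun p => F p = a).card := by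
    refine le_trans (Nat.mul_le_mul_left c (card_le_card fun z hz => ?_)) hc
    rw [mem_filter] at hz
    have := B.min'_le z hz.1
    exact mem_filter.2 ⟨mem_Icc.2 ⟨by omega, hz.2⟩, hF z hz.1⟩
  have hsplit : B.card = (B.filter fun z => z ≤ y).card + (B.filter fun z => ¬ z ≤ y).card :=
    (card_filter_add_card_filter_not _).symm
  rw [hIcc, card_filter_Ioc_split (by omega : x - 1 ≤ p) hpy] at h0
  have h1 : ((Ioc (x - 1) p).filter fun p => F p = a).card ≤
      ((Ioc t p).filter fun p => F p = a).card :=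
    card_le_card (filter_subset_filter _ (Ioc_subset_Ioc_left (by omega)))
  have h2 := card_filter_Ioc_split (P := fun p => F p = a) (by omega : t ≤ p)
    (by omega : p ≤ hi)
  have h3 := card_filter_Ioc_split (P := fun p => F p = a) hpy hyhi
  rw [← hN, hsplit, Nat.mul_add]
  rcases (B.filter fun z => ¬ z ≤ y).eq_empty_or_nonempty with he | hne
  · rw [he, card_empty]
    omega
  · set B' := B.filter fun z => ¬ z ≤ y with hB'
    have hlt : B'.card < N := by
      have : 0 < (B.filter fun z => z ≤ y).card := card_pos.2 ⟨p, mem_filter.2 ⟨hpB, hpy⟩⟩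
      omega
    have h4 := ih _ hlt B' hne p (fun z hz => hF z (mem_filter.1 hz).1) (by
      intro z hz
      obtain ⟨hzB, hzy⟩ := mem_filter.1 hz
      obtain ⟨x', y', h5, h6, h7, h8, h9⟩ := h z hzB
      refine ⟨x', y', ?_, h6, h7, h8, h9⟩
      by_contra hxp'
      have := hymax y' ⟨x', h5, by omega, by omega, h8, h9⟩
      omega) rfl
    have h5 : y < B'.min' hne := by
      have := (mem_filter.1 (B'.min'_mem hne)).2
      omega
    have h6 : ((Ioc (B'.min' hne) hi).filter fun p => F p = a).card ≤
        ((Ioc y hi).filter fun p => F p = a).card :=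
      card_le_card (filter_subset_filter _ (Ioc_subset_Ioc_left h5.le))
    omega

end

/-! ### Families of intervals on a path -/

/-- The inclusion-maximal intervals of a family. -/
def maxl (𝒥 : Finset (ℤ × ℤ)) : Finset (ℤ × ℤ) :=
  𝒥.filter fun M => ∀ J ∈ 𝒥, J.1 ≤ M.1 → M.2 ≤ J.2 → J = M

section
variable {𝒥 : Finset (ℤ × ℤ)}

theorem mem_of_mem_maxl {M : ℤ × ℤ} (h : M ∈ maxl 𝒥) : M ∈ 𝒥 := (mem_filter.1 h).1

theorem exists_maxl {J : ℤ × ℤ} (hJ : J ∈ 𝒥) : ∃ M ∈ maxl 𝒥, M.1 ≤ J.1 ∧ J.2 ≤ M.2 := by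
  obtain ⟨M, hM, hmax⟩ := (𝒥.filter fun M => M.1 ≤ J.1 ∧ J.2 ≤ M.2).exists_max_image
    (fun M => M.2 - M.1) ⟨J, mem_filter.2 ⟨hJ, le_rfl, le_rfl⟩⟩
  rw [mem_filter] at hM
  refine ⟨M, mem_filter.2 ⟨hM.1, fun J' hJ' h1 h2 => ?_⟩, hM.2⟩
  have := hmax J' (mem_filter.2 ⟨hJ', by omega, by omega⟩)
  exact Prod.ext (by omega) (by omega)

theorem eq_of_mem_maxl {M N : ℤ × ℤ} (hM : M ∈ maxl 𝒥) (hN : N ∈ maxl 𝒥) (h1 : M.1 ≤ N.1)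
    (h2 : N.2 ≤ M.2) : M = N := (mem_filter.1 hN).2 M (mem_of_mem_maxl hM) h1 h2

theorem maxl_snd_lt {M N : ℤ × ℤ} (hM : M ∈ maxl 𝒥) (hN : N ∈ maxl 𝒥) (h : M.1 < N.1) :
    M.2 < N.2 := by
  by_contra hc
  have := eq_of_mem_maxl hM hN h.le (not_lt.1 hc)
  rw [this] at h
  omega

theorem maxl_eq_of_fst {M N : ℤ × ℤ} (hM : M ∈ maxl 𝒥) (hN : N ∈ maxl 𝒥) (h : M.1 = N.1) :
    M = N := by
  rcases le_total M.2 N.2 with h2 | h2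
  · exact (eq_of_mem_maxl hN hM h.ge h2).symm
  · exact eq_of_mem_maxl hM hN h.le h2

end

/-- `N` follows `J` in the family `𝓛`, ordered by left ends. -/
def IsNext (𝓛 : Finset (ℤ × ℤ)) (J N : ℤ × ℤ) : Prop :=
  N ∈ 𝓛 ∧ J.1 < N.1 ∧ ∀ M ∈ 𝓛, J.1 < M.1 → N.1 ≤ M.1

theorem exists_isNext {𝓛 : Finset (ℤ × ℤ)} {J M : ℤ × ℤ} (hM : M ∈ 𝓛) (h : J.1 < M.1) :
    ∃ N, IsNext 𝓛 J N := by
  obtain ⟨N, hN, hmin⟩ := (𝓛.filter fun M => J.1 < M.1).exists_min_image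
    (fun M => M.1) ⟨M, mem_filter.2 ⟨hM, h⟩⟩
  rw [mem_filter] at hN
  exact ⟨N, hN.1, hN.2, fun M' hM' h' => hmin M' (mem_filter.2 ⟨hM', h'⟩)⟩

theorem exists_prev {𝓛 : Finset (ℤ × ℤ)} {N M : ℤ × ℤ} (hN : N ∈ 𝓛)
    (hM : M ∈ 𝓛) (h : M.1 < N.1) :
    ∃ J ∈ 𝓛, IsNext 𝓛 J N ∧ M.1 ≤ J.1 := by
  obtain ⟨J, hJ, hmax⟩ := (𝓛.filter fun M => M.1 < N.1).exists_max_image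
    (fun M => M.1) ⟨M, mem_filter.2 ⟨hM, h⟩⟩
  rw [mem_filter] at hJ
  refine ⟨J, hJ.1, ⟨hN, hJ.2, fun M' hM' h' => ?_⟩, hmax M (mem_filter.2 ⟨hM, h⟩)⟩
  by_contra hc
  have := hmax M' (mem_filter.2 ⟨hM', not_le.1 hc⟩)
  omega

/-! ### The placement on a path -/

/-- The data on a path that do not change with time: the precision `q`, the largest length `D` of
a game, the end edges `A` and `B` (the path consists of the points of `(A, B]`), the initial
colours `F` and the priorities `ρ` of the edges. The edge `e` joins `e` and `e + 1`. -/
structure Setting (ι : Type*) where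
  /-- the precision of nearly monochromatic intervals -/
  q : ℕ
  /-- the largest length of a game -/
  D : ℕ
  /-- the edge before the first point -/
  A : ℤ
  /-- the edge behind the last point -/
  B : ℤ
  /-- the initial colours -/
  F : ℤ → ι
  /-- the priorities of the edges -/
  ρ : ℤ → ℕ

/-- The number of edges of an interval. -/
def width (I : ℤ × ℤ) : ℕ := (I.2 - I.1).toNat

/-- The values of `w` on the edges from the left end of the interval on. -/
def fromLeft (w : ℤ → ℕ) (I : ℤ × ℤ) (i : ℕ) : ℕ := w (I.1 + i)

/-- The values of `w` on the edges from the right end of the interval on. -/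
def fromRight (w : ℤ → ℕ) (I : ℤ × ℤ) (i : ℕ) : ℕ := w (I.2 - 1 - i)

namespace Setting

variable {ι : Type*} [DecidableEq ι] (S : Setting ι) (w : ℤ → ℕ) (I : ℤ × ℤ)

/-- The number of edges on which each of the two games of an interval is played. -/
def cap : ℕ := min (width I) S.D

/-- The cut edge of the left game of an interval. -/
noncomputable def XL : ℤ := I.1 + gpick S.q (S.cap I) (fromLeft w I) (fromLeft S.ρ I)

/-- The cut edge of the right game of an interval. -/
noncomputable def XR : ℤ := I.2 - 1 - gpick S.q (S.cap I) (fromRight w I) (fromRight S.ρ I)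

/-- The length of the heavy initial segment of an interval. -/
noncomputable def glL : ℕ := glue S.q (S.cap I) (fromLeft w I)

/-- The length of the heavy final segment of an interval. -/
noncomputable def glR : ℕ := glue S.q (S.cap I) (fromRight w I)

/-- The colour of the heavy initial segment of an interval. -/
noncomputable def majP : ι := maj S.q S.F I.1 (I.1 + S.glL w I)

/-- The colour of the heavy final segment of an interval. -/
noncomputable def majS : ι := maj S.q S.F (I.2 - S.glR w I) I.2

/-- The left game of an interval is open. -/
def OpenL : Prop := GameOpen (rng S.q (S.cap I)) (rng S.q (S.cap I)) (fromLeft w I)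

/-- The right game of an interval is open. -/
def OpenR : Prop := GameOpen (rng S.q (S.cap I)) (rng S.q (S.cap I)) (fromRight w I)

/-- Every edge of the interval has been requested so often that it forms a nearly monochromatic
cluster again. -/
def Dead : Prop := width I ≤ S.D ∧ ∀ e, I.1 ≤ e → e < I.2 → width I ≤ w e

/-- `J` is the last interval of `𝓛` with a cut before `p`. -/
def IsLast (𝓛 : Finset (ℤ × ℤ)) (p : ℤ) (J : ℤ × ℤ) : Prop :=
  J ∈ 𝓛 ∧ min (S.XL w J) (S.XR w J) < p ∧
    ∀ M ∈ 𝓛, min (S.XL w M) (S.XR w M) < p → M.1 ≤ J.1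

/-- The colour of a point `p` between the first cut of `J` and the first cut of the following
interval `N`. The value `none` marks guests. -/
noncomputable def piece (J N : ℤ × ℤ) (p : ℤ) : Option ι :=
  if p ≤ S.XR w J then none
  else if S.XR w J < N.1 then some (S.majS w J)
  else if J.2 ≤ S.XL w N then some (S.majP w N)
  else none

/-- The colour of the point `p`, determined by the requests `w` and the set `𝓛` of live
intervals. Guests have no colour. -/
noncomputable def col (𝓛 : Finset (ℤ × ℤ)) (p : ℤ) : Option ι :=
  open Classical in
  if h : ∃ JN : (ℤ × ℤ) × (ℤ × ℤ), S.IsLast w 𝓛 p JN.1 ∧ IsNext 𝓛 JN.1 JN.2 then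
    S.piece w h.choose.1 h.choose.2 p
  else none

/-- The properties of the family of intervals on which the construction relies. -/
structure Valid (𝒥 : Finset (ℤ × ℤ)) : Prop where
  /-- nearly monochromatic intervals have a dominant colour -/
  four_le : 4 ≤ S.q
  /-- games have at least one edge -/
  one_le : 1 ≤ S.D
  /-- intervals have edges -/
  lt : ∀ J ∈ 𝒥, J.1 < J.2
  /-- the edge before the path is an interval -/
  left : (S.A, S.A + 1) ∈ 𝒥
  /-- the edge behind the path is an interval -/
  right : (S.B, S.B + 1) ∈ 𝒥
  /-- the path has points -/
  A_lt_B : S.A < S.B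
  /-- all other intervals lie on the path -/
  inside : ∀ J ∈ 𝒥, J = (S.A, S.A + 1) ∨ J = (S.B, S.B + 1) ∨ (S.A + 1 ≤ J.1 ∧ J.2 ≤ S.B)
  /-- the edge before the path counts as never requested -/
  wA : w S.A = 0
  /-- the edge behind the path counts as never requested -/
  wB : w S.B = 0
  /-- the edges at which the initial colour changes are covered -/
  cut : ∀ e, S.A < e → e < S.B → S.F e ≠ S.F (e + 1) → ∃ J ∈ 𝒥, J.1 ≤ e ∧ e < J.2
  /-- saturated arcs are covered, together with their neighbourhoods -/
  sat : ∀ x y, S.A + 1 ≤ x → x < y → y ≤ S.B → y - x ≤ S.D →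
    (∀ e, x ≤ e → e < y → y - x ≤ w e) → (¬ ∃ a, NearMono S.q S.F x y a) →
    ∃ J ∈ 𝒥, J.1 ≤ x - (y - x) ∧ y + (y - x) ≤ J.2
  /-- arcs of length `D` are not nearly monochromatic -/
  big : ∀ x, S.A + 1 ≤ x → x + S.D ≤ S.B → ¬ ∃ a, NearMono S.q S.F x (x + S.D) a

/-- `𝓛` is a set of maximal intervals that contains all of them but dead ones. -/
structure Live (𝒥 𝓛 : Finset (ℤ × ℤ)) : Prop extends S.Valid w 𝒥 where
  /-- live intervals are maximal -/
  sub : 𝓛 ⊆ maxl 𝒥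
  /-- the other maximal intervals are dead -/
  dead : ∀ M ∈ maxl 𝒥, M ∉ 𝓛 → S.Dead w M

/-- The initial segment of length `s` of `M` is heavy, and long in comparison with the overlap of
`M` with the earlier maximal intervals. -/
def PCert (𝒥 : Finset (ℤ × ℤ)) (M : ℤ × ℤ) (s : ℕ) : Prop :=
  s ≤ width M ∧ s ≤ S.D ∧ (∀ e, M.1 ≤ e → e < M.1 + s → s ≤ w e) ∧
    ∀ M' ∈ maxl 𝒥, M'.1 < M.1 → 4 * (M'.2 - M.1) ≤ 5 * s

/-- The final segment of length `s` of `M` is heavy, and long in comparison with the overlap of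
`M` with the later maximal intervals. -/
def SCert (𝒥 : Finset (ℤ × ℤ)) (M : ℤ × ℤ) (s : ℕ) : Prop :=
  s ≤ width M ∧ s ≤ S.D ∧ (∀ e, M.2 - s ≤ e → e < M.2 → s ≤ w e) ∧
    ∀ M' ∈ maxl 𝒥, M.1 < M'.1 → 4 * (M.2 - M'.1) ≤ 5 * s

variable {S w I} {𝒥 𝓛 : Finset (ℤ × ℤ)}

theorem four_mul_div_le {q : ℕ} (hq : 4 ≤ q) (g : ℕ) : 4 * (g / q) ≤ g :=
  (Nat.mul_le_mul_right _ hq).trans (Nat.mul_div_le g q)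

theorem cap_le_width : S.cap I ≤ width I := min_le_left _ _

theorem cap_le : S.cap I ≤ S.D := min_le_right _ _

theorem glL_le_cap : S.glL w I ≤ S.cap I := glue_le

theorem glR_le_cap : S.glR w I ≤ S.cap I := glue_le

theorem glL_le_of_mem {e : ℤ} (h1 : I.1 ≤ e) (h2 : e < I.1 + S.glL w I) : S.glL w I ≤ w e := by
  have := glue_le_of_lt (q := S.q) (Λ := S.cap I) (u := fromLeft w I) (i := (e - I.1).toNat)
    (by change _ < S.glL w I; omega)
  unfold fromLeft at this
  rw [show I.1 + ((e - I.1).toNat : ℤ) = e by omega] at this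
  exact this

theorem glR_le_of_mem {e : ℤ} (h1 : I.2 - S.glR w I ≤ e) (h2 : e < I.2) : S.glR w I ≤ w e := by
  have := glue_le_of_lt (q := S.q) (Λ := S.cap I) (u := fromRight w I) (i := (I.2 - 1 - e).toNat)
    (by change _ < S.glR w I; omega)
  unfold fromRight at this
  rw [show I.2 - 1 - ((I.2 - 1 - e).toNat : ℤ) = e by omega] at this
  exact this

theorem le_glL {κ : ℕ} (h1 : κ ≤ width I) (h2 : κ ≤ S.D)
    (h : ∀ e, I.1 ≤ e → e < I.1 + κ → κ ≤ w e) : κ ≤ S.glL w I + S.glL w I / S.q :=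
  le_glue_add_div (le_min h1 h2) fun i hi => h _ (by omega) (by omega)

theorem le_glR {κ : ℕ} (h1 : κ ≤ width I) (h2 : κ ≤ S.D)
    (h : ∀ e, I.2 - κ ≤ e → e < I.2 → κ ≤ w e) : κ ≤ S.glR w I + S.glR w I / S.q :=
  le_glue_add_div (le_min h1 h2) fun i hi => h _ (by omega) (by omega)

theorem le_XL : I.1 ≤ S.XL w I := by unfold XL; omega

theorem XR_lt : S.XR w I < I.2 := by unfold XR; omega

theorem XL_le : S.XL w I ≤ I.1 + (S.glL w I + S.glL w I / S.q : ℕ) := by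
  have := gpick_le (q := S.q) (Λ := S.cap I) (u := fromLeft w I) (ρ := fromLeft S.ρ I)
  unfold XL
  change _ ≤ I.1 + ((glue S.q (S.cap I) (fromLeft w I) +
    glue S.q (S.cap I) (fromLeft w I) / S.q : ℕ) : ℤ)
  omega

theorem le_XR : I.2 - 1 - (S.glR w I + S.glR w I / S.q : ℕ) ≤ S.XR w I := by
  have := gpick_le (q := S.q) (Λ := S.cap I) (u := fromRight w I) (ρ := fromRight S.ρ I)
  unfold XR
  change I.2 - 1 - ((glue S.q (S.cap I) (fromRight w I) +
    glue S.q (S.cap I) (fromRight w I) / S.q : ℕ) : ℤ) ≤ _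
  omega

theorem cap_pos (hD : 1 ≤ S.D) (hI : I.1 < I.2) : 0 < S.cap I := by
  unfold cap width; omega

theorem XL_lt (hD : 1 ≤ S.D) (hI : I.1 < I.2) : S.XL w I < I.1 + S.cap I := by
  have := gpick_lt (q := S.q) (u := fromLeft w I) (ρ := fromLeft S.ρ I) (cap_pos hD hI)
  unfold XL; omega

theorem lt_XR (hD : 1 ≤ S.D) (hI : I.1 < I.2) : I.2 - 1 - S.cap I < S.XR w I := by
  have := gpick_lt (q := S.q) (u := fromRight w I) (ρ := fromRight S.ρ I) (cap_pos hD hI)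
  unfold XR; omega

theorem cap_le' (hI : I.1 < I.2) : (S.cap I : ℤ) ≤ I.2 - I.1 := by
  have := cap_le_width (S := S) (I := I)
  unfold width at this
  omega

theorem min_lt_snd : min (S.XL w I) (S.XR w I) < I.2 := min_lt_of_right_lt XR_lt

theorem fst_le_XR (hD : 1 ≤ S.D) (hI : I.1 < I.2) : I.1 ≤ S.XR w I := by
  have := lt_XR (w := w) hD hI
  have := cap_le' (S := S) hI
  omega

theorem fst_le_min (hD : 1 ≤ S.D) (hI : I.1 < I.2) : I.1 ≤ min (S.XL w I) (S.XR w I) :=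
  le_min le_XL (fst_le_XR hD hI)

/-! ### Colours of heavy segments -/

namespace Valid

theorem inside_of_heavy (hV : S.Valid w 𝒥) {M : ℤ × ℤ} (hM : M ∈ 𝒥) {e : ℤ} (h1 : M.1 ≤ e)
    (h2 : e < M.2) (he : 0 < w e) : S.A + 1 ≤ M.1 ∧ M.2 ≤ S.B := by
  rcases hV.inside M hM with rfl | rfl | h
  · have : e = S.A := by simp only at h1 h2; omega
    rw [this, hV.wA] at he; omega
  · have : e = S.B := by simp only at h1 h2; omega
    rw [this, hV.wB] at he; omega
  · exact h

/-- Heavy initial segments of maximal intervals are nearly monochromatic, unless the overlap with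
an earlier interval is large: otherwise a larger interval would have been created. -/
theorem exists_nearMono_prefix (hV : S.Valid w 𝒥) {M : ℤ × ℤ} (hM : M ∈ maxl 𝒥) {s : ℕ}
    (h1 : s ≤ width M) (h2 : s ≤ S.D) (h3 : ∀ e, M.1 ≤ e → e < M.1 + s → s ≤ w e)
    (h4 : s ≠ 0 → ∀ M' ∈ maxl 𝒥, M'.1 < M.1 → M'.2 - M.1 < 2 * s) :
    ∃ a, NearMono S.q S.F M.1 (M.1 + s) a := by
  have hq := hV.four_le
  rcases Nat.eq_zero_or_pos s with rfl | hs
  · refine ⟨S.F M.1, ?_⟩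
    simpa using (nearMono_self (q := S.q) (by omega)).2 rfl
  · by_contra hc
    have hlt := hV.lt M (mem_of_mem_maxl hM)
    have hw : (width M : ℤ) = M.2 - M.1 := by unfold width; omega
    obtain ⟨hA, hB⟩ := hV.inside_of_heavy (mem_of_mem_maxl hM) le_rfl hlt
      (hs.trans_le (h3 M.1 le_rfl (by omega)))
    obtain ⟨J, hJ, hJ1, hJ2⟩ := hV.sat M.1 (M.1 + s) hA (by omega) (by omega) (by omega)
      (fun e he he' => by have := h3 e he he'; omega) hc
    obtain ⟨M', hM', hM1, hM2⟩ := exists_maxl hJ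
    have := h4 (by omega) M' hM' (by omega)
    omega

/-- The mirror image of `exists_nearMono_prefix`. -/
theorem exists_nearMono_suffix (hV : S.Valid w 𝒥) {M : ℤ × ℤ} (hM : M ∈ maxl 𝒥) {s : ℕ}
    (h1 : s ≤ width M) (h2 : s ≤ S.D) (h3 : ∀ e, M.2 - s ≤ e → e < M.2 → s ≤ w e)
    (h4 : s ≠ 0 → ∀ M' ∈ maxl 𝒥, M.1 < M'.1 → M.2 - M'.1 < 2 * s) :
    ∃ a, NearMono S.q S.F (M.2 - s) M.2 a := by
  have hq := hV.four_le
  rcases Nat.eq_zero_or_pos s with rfl | hs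
  · refine ⟨S.F M.2, ?_⟩
    simpa using (nearMono_self (q := S.q) (by omega)).2 rfl
  · by_contra hc
    have hlt := hV.lt M (mem_of_mem_maxl hM)
    have hw : (width M : ℤ) = M.2 - M.1 := by unfold width; omega
    obtain ⟨hA, hB⟩ := hV.inside_of_heavy (mem_of_mem_maxl hM) (by omega : M.1 ≤ M.2 - 1)
      (by omega) (hs.trans_le (h3 _ (by omega) (by omega)))
    obtain ⟨J, hJ, hJ1, hJ2⟩ := hV.sat (M.2 - s) M.2 (by omega) (by omega) (by omega) (by omega)
      (fun e he he' => by have := h3 e he he'; omega) hc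
    obtain ⟨M', hM', hM1, hM2⟩ := exists_maxl hJ
    have hne : M.1 < M'.1 := by
      by_contra hle
      have := eq_of_mem_maxl hM' hM (not_lt.1 hle) (by omega)
      rw [this] at hM1 hM2; omega
    have := h4 (by omega) M' hM' hne
    omega

end Valid

theorem PCert.exists_nearMono (hV : S.Valid w 𝒥) {M : ℤ × ℤ} (hM : M ∈ maxl 𝒥) {s : ℕ}
    (h : S.PCert w 𝒥 M s) : ∃ a, NearMono S.q S.F M.1 (M.1 + s) a := by
  obtain ⟨h1, h2, h3, h4⟩ := h
  exact hV.exists_nearMono_prefix hM h1 h2 h3 fun hs M' hM' hlt => by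
    have := h4 M' hM' hlt
    omega

theorem SCert.exists_nearMono (hV : S.Valid w 𝒥) {M : ℤ × ℤ} (hM : M ∈ maxl 𝒥) {s : ℕ}
    (h : S.SCert w 𝒥 M s) : ∃ a, NearMono S.q S.F (M.2 - s) M.2 a := by
  obtain ⟨h1, h2, h3, h4⟩ := h
  exact hV.exists_nearMono_suffix hM h1 h2 h3 fun hs M' hM' hlt => by
    have := h4 M' hM' hlt
    omega

/-- The colour of heavy initial segments does not depend on their length, as long as they are not
much shorter than the overlaps with earlier intervals. -/
theorem maj_prefix_eq (hV : S.Valid w 𝒥) {M : ℤ × ℤ} (hM : M ∈ maxl 𝒥) {s t : ℕ} (hst : s ≤ t)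
    (h1 : t ≤ width M) (h2 : t ≤ S.D) (h3 : ∀ e, M.1 ≤ e → e < M.1 + t → t ≤ w e)
    (h4 : ∀ M' ∈ maxl 𝒥, M'.1 < M.1 → 4 * (M'.2 - M.1) ≤ 5 * s ∨ M'.2 - M.1 < 2 * s) :
    maj S.q S.F M.1 (M.1 + s) = maj S.q S.F M.1 (M.1 + t) := by
  refine maj_chain hV.four_le (x := fun _ => M.1) (y := fun m => M.1 + m) (fun _ => le_rfl)
    (fun m => by push_cast; omega) (fun m => by omega) hst fun m hm hm' => ?_
  refine hV.exists_nearMono_prefix hM (hm'.trans h1) (hm'.trans h2)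
    (fun e he he' => hm'.trans (h3 e he (by omega))) fun hm0 M' hM' hlt => ?_
  have := h4 M' hM' hlt
  omega

/-- The mirror image of `maj_prefix_eq`. -/
theorem maj_suffix_eq (hV : S.Valid w 𝒥) {M : ℤ × ℤ} (hM : M ∈ maxl 𝒥) {s t : ℕ} (hst : s ≤ t)
    (h1 : t ≤ width M) (h2 : t ≤ S.D) (h3 : ∀ e, M.2 - t ≤ e → e < M.2 → t ≤ w e)
    (h4 : ∀ M' ∈ maxl 𝒥, M.1 < M'.1 → 4 * (M.2 - M'.1) ≤ 5 * s ∨ M.2 - M'.1 < 2 * s) :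
    maj S.q S.F (M.2 - s) M.2 = maj S.q S.F (M.2 - t) M.2 := by
  refine maj_chain hV.four_le (x := fun m => M.2 - m) (y := fun _ => M.2)
    (fun m => by push_cast; omega) (fun _ => le_rfl) (fun m => by omega) hst fun m hm hm' => ?_
  refine hV.exists_nearMono_suffix hM (hm'.trans h1) (hm'.trans h2)
    (fun e he he' => hm'.trans (h3 e (by omega) he')) fun hm0 M' hM' hlt => ?_
  have := h4 M' hM' hlt
  omega

theorem Dead.pCert {M : ℤ × ℤ} (hM : M ∈ maxl 𝒥) (h : S.Dead w M) (hlt : M.1 < M.2) :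
    S.PCert w 𝒥 M (width M) := by
  have hw : (width M : ℤ) = M.2 - M.1 := by unfold width; omega
  refine ⟨le_rfl, h.1, fun e h1 h2 => h.2 e h1 (by omega), fun M' hM' hlt' => ?_⟩
  have := maxl_snd_lt hM' hM hlt'
  omega

theorem Dead.sCert {M : ℤ × ℤ} (h : S.Dead w M) (hlt : M.1 < M.2) :
    S.SCert w 𝒥 M (width M) := by
  have hw : (width M : ℤ) = M.2 - M.1 := by unfold width; omega
  exact ⟨le_rfl, h.1, fun e h1 h2 => h.2 e (by omega) h2, fun M' hM' hlt' => by omega⟩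

/-- If no cut of the live intervals up to `J` lies far inside the following interval `N`, then the
heavy initial segment of `N` determines a colour. -/
theorem Live.pCert (hL : S.Live w 𝒥 𝓛) {J N : ℤ × ℤ} (hJ : J ∈ 𝓛) (hN : IsNext 𝓛 J N)
    (h : J.2 ≤ S.XL w N) : S.PCert w 𝒥 N (S.glL w N) := by
  have hg := four_mul_div_le hL.four_le (S.glL w N)
  have hNm := hL.sub hN.1
  refine ⟨glL_le_cap.trans cap_le_width, glL_le_cap.trans cap_le,
    fun e h1 h2 => glL_le_of_mem h1 h2, fun M hM hlt => ?_⟩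
  -- a live interval before `N` ends before the cut of `N`, which is close to the heavy segment; a dead
  -- one is heavy itself, so that its overlap with `N` is part of the heavy segment
  by_cases hM𝓛 : M ∈ 𝓛
  · have h1 : M.2 ≤ J.2 := by
      by_contra hc
      have h2 : J.1 < M.1 := by
        by_contra hc'
        rcases (not_lt.1 hc').lt_or_eq with h3 | h3
        · exact hc (maxl_snd_lt hM (hL.sub hJ) h3).le
        · exact hc (maxl_eq_of_fst hM (hL.sub hJ) h3 ▸ le_rfl)
      have := hN.2.2 M hM𝓛 h2
      omega
    have h2 := XL_le (S := S) (w := w) (I := N)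
    push_cast at h2
    omega
  · obtain ⟨hd1, hd2⟩ := hL.dead M hM hM𝓛
    have hMl := hL.lt M (mem_of_mem_maxl hM)
    have hMN := maxl_snd_lt hM hNm hlt
    have hw : (width M : ℤ) = M.2 - M.1 := by unfold width; omega
    have hw' : (width N : ℤ) = N.2 - N.1 := by
      have := hL.lt N (mem_of_mem_maxl hNm)
      unfold width; omega
    rcases le_or_gt M.2 N.1 with h0 | h0
    · omega
    · have := le_glL (S := S) (w := w) (I := N) (κ := (M.2 - N.1).toNat) (by omega) (by omega)
        (fun e h1 h2 => by have := hd2 e (by omega) (by omega); omega)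
      omega

/-- If the right cut of `J` does not lie in the following interval, then the heavy final segment of `J`
determines a colour. -/
theorem Live.sCert (hL : S.Live w 𝒥 𝓛) {J N : ℤ × ℤ} (hJ : J ∈ 𝓛) (hN : IsNext 𝓛 J N)
    (h : S.XR w J < N.1) : S.SCert w 𝒥 J (S.glR w J) := by
  have hg := four_mul_div_le hL.four_le (S.glR w J)
  have hJm := hL.sub hJ
  refine ⟨glR_le_cap.trans cap_le_width, glR_le_cap.trans cap_le,
    fun e h1 h2 => glR_le_of_mem h1 h2, fun M hM hlt => ?_⟩
  by_cases hM𝓛 : M ∈ 𝓛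
  · have h1 := hN.2.2 M hM𝓛 hlt
    have h2 := le_XR (S := S) (w := w) (I := J)
    push_cast at h2
    omega
  · obtain ⟨hd1, hd2⟩ := hL.dead M hM hM𝓛
    have hMl := hL.lt M (mem_of_mem_maxl hM)
    have hMN := maxl_snd_lt hJm hM hlt
    have hw : (width M : ℤ) = M.2 - M.1 := by unfold width; omega
    have hw' : (width J : ℤ) = J.2 - J.1 := by
      have := hL.lt J (mem_of_mem_maxl hJm)
      unfold width; omega
    rcases le_or_gt J.2 M.1 with h0 | h0
    · omega
    · have := le_glR (S := S) (w := w) (I := J) (κ := (J.2 - M.1).toNat) (by omega) (by omega)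
        (fun e h1 h2 => by have := hd2 e (by omega) (by omega); omega)
      omega

/-- Between two consecutive maximal intervals the initial colours are constant. -/
theorem Valid.gap_const (hV : S.Valid w 𝒥) {M N : ℤ × ℤ} (hM : M ∈ maxl 𝒥)
    (hN : IsNext (maxl 𝒥) M N) {p p' : ℤ} (h1 : M.2 ≤ p) (h2 : p ≤ p') (h3 : p' ≤ N.1) :
    S.F p = S.F p' := by
  induction p', h2 using Int.leInduction with
  | base => rfl
  | succ p' hle ih =>
    rw [ih (by omega)]
    by_contra hc
    have hA : S.A < p' := by
      have := hV.lt M (mem_of_mem_maxl hM)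
      rcases hV.inside M (mem_of_mem_maxl hM) with h | h | h
      · rw [h] at h1; simp only at h1; omega
      · rw [h] at h1; simp only at h1; have := hV.A_lt_B; omega
      · omega
    have hB : p' < S.B := by
      have := hV.lt N (mem_of_mem_maxl hN.1)
      rcases hV.inside N (mem_of_mem_maxl hN.1) with h | h | h
      · rw [h] at h3; simp only at h3; omega
      · rw [h] at h3; simp only at h3; omega
      · omega
    obtain ⟨J, hJ, hJ1, hJ2⟩ := hV.cut p' hA hB hc
    obtain ⟨M', hM', hM1, hM2⟩ := exists_maxl hJ
    rcases lt_or_ge M.1 M'.1 with h | h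
    · have := hN.2.2 M' hM' h
      omega
    · have : M'.2 ≤ M.2 := by
        rcases h.lt_or_eq with h' | h'
        · exact (maxl_snd_lt hM' hM h').le
        · exact (maxl_eq_of_fst hM' hM h').symm ▸ le_rfl
      omega

/-- If consecutive maximal intervals do not overlap, the colour of the first one extends to the
gap. -/
theorem SCert.maj_eq_of_disjoint (hV : S.Valid w 𝒥) {M N : ℤ × ℤ} (hM : M ∈ maxl 𝒥)
    (hN : IsNext (maxl 𝒥) M N) {s : ℕ} (h : S.SCert w 𝒥 M s) (hd : M.2 ≤ N.1) :
    maj S.q S.F (M.2 - s) M.2 = S.F M.2 := by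
  have hq := hV.four_le
  obtain ⟨h1, h2, h3, h4⟩ := h
  rw [← maj_suffix_eq hV hM (Nat.zero_le s) h1 h2 h3 fun M' hM' hlt => ?_]
  · simpa using maj_self (q := S.q) (by omega) M.2
  · have := hN.2.2 M' hM' hlt
    left; omega

/-- Consecutive maximal intervals agree on the colour between them. -/
theorem maj_step (hV : S.Valid w 𝒥) {M N : ℤ × ℤ} (hM : M ∈ maxl 𝒥)
    (hN : IsNext (maxl 𝒥) M N) {s t : ℕ} (hs : S.SCert w 𝒥 M s) (ht : S.PCert w 𝒥 N t) :
    maj S.q S.F (M.2 - s) M.2 = maj S.q S.F N.1 (N.1 + t) := by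
  have hq := hV.four_le
  have hMN := maxl_snd_lt hM hN.1 hN.2.1
  -- the maximal intervals before `N` end at `M.2` or before
  have hprev : ∀ M' ∈ maxl 𝒥, M'.1 < N.1 → M'.2 ≤ M.2 := by
    intro M' hM' hlt
    rcases lt_trichotomy M'.1 M.1 with h | h | h
    · exact (maxl_snd_lt hM' hM h).le
    · exact (maxl_eq_of_fst hM' hM h).symm ▸ le_rfl
    · have := hN.2.2 M' hM' h; omega
  rcases le_or_gt M.2 N.1 with hd | hd
  · rw [hs.maj_eq_of_disjoint hV hM hN hd, hV.gap_const hM hN le_rfl hd le_rfl]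
    obtain ⟨h1, h2, h3, h4⟩ := ht
    rw [← maj_prefix_eq hV hN.1 (Nat.zero_le t) h1 h2 h3 fun M' hM' hlt => ?_]
    · simpa using (maj_self (q := S.q) (F := S.F) (by omega) N.1).symm
    · have := hprev M' hM' hlt
      left; omega
  -- if `M` and `N` overlap, shorten both heavy segments to the length `κ` of the overlap; they
  -- meet in more than half of it
  · obtain ⟨κ, hκ⟩ : ∃ κ : ℕ, (κ : ℤ) = M.2 - N.1 := ⟨(M.2 - N.1).toNat, by omega⟩
    have hs4 := hs.2.2.2 N hN.1 hN.2.1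
    have ht4 := ht.2.2.2 M hM hN.2.1
    obtain ⟨h1, h2, h3, h4⟩ := hs
    obtain ⟨h1', h2', h3', h4'⟩ := ht
    have e1 := maj_suffix_eq hV hM (min_le_left s κ) h1 h2 h3 fun M' hM' hlt => by
      have := hN.2.2 M' hM' hlt
      right; omega
    have e2 := maj_prefix_eq hV hN.1 (min_le_left t κ) h1' h2' h3' fun M' hM' hlt => by
      have := hprev M' hM' hlt
      right; omega
    rw [← e1, ← e2]
    have n1 := hV.exists_nearMono_suffix hM (s := min s κ) (by omega) (by omega)
      (fun e he he' => (min_le_left _ _).trans (h3 e (by omega) he')) fun _ M' hM' hlt => by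
      have := hN.2.2 M' hM' hlt
      omega
    have n2 := hV.exists_nearMono_prefix hN.1 (s := min t κ) (by omega) (by omega)
      (fun e he he' => (min_le_left _ _).trans (h3' e he (by omega))) fun _ M' hM' hlt => by
      have := hprev M' hM' hlt
      omega
    have hpos : (4 : ℤ) * (N.1 + min t κ + 1 - (M.2 - min s κ)) ≤
        S.q * (N.1 + min t κ + 1 - (M.2 - min s κ)) :=
      mul_le_mul_of_nonneg_right (by exact_mod_cast hq) (by omega)
    refine (nearMono_maj n1).eq (nearMono_maj n2) (u := M.2 - min s κ) (v := N.1 + min t κ)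
      ?_ ?_ ?_ ?_ ?_ ?_ ?_ <;> push_cast at * <;> omega

/-- The colour of the final segment of `J` propagates through the dead intervals that follow. -/
theorem Live.maj_chain_dead (hL : S.Live w 𝒥 𝓛) {J : ℤ × ℤ} (hJ : J ∈ maxl 𝒥) {s : ℕ}
    (hs : S.SCert w 𝒥 J s) {G : ℤ × ℤ} (hG : G ∈ maxl 𝒥) (hJG : J.1 < G.1) {t : ℕ}
    (ht : S.PCert w 𝒥 G t) (hdead : ∀ M ∈ maxl 𝒥, J.1 < M.1 → M.1 < G.1 → S.Dead w M) :
    maj S.q S.F (J.2 - s) J.2 = maj S.q S.F G.1 (G.1 + t) := by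
  have hV := hL.toValid
  induction hn : (G.1 - J.1).toNat using Nat.strong_induction_on generalizing G t with
  | _ n ih =>
  obtain ⟨M, hM, hMG, hJM⟩ := exists_prev hG hJ hJG
  rcases hJM.lt_or_eq with hlt | heq
  · have hd := hdead M hM hlt hMG.2.1
    have hMlt := hL.lt M (mem_of_mem_maxl hM)
    have hw : (width M : ℤ) = M.2 - M.1 := by unfold width; omega
    have hGM := hMG.2.1
    rw [ih _ (by omega) hM hlt (hd.pCert hM hMlt)
      (fun M' hM' h1 h2 => hdead M' hM' h1 (by omega)) rfl, ← maj_step hV hM hMG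
      (hd.sCert hMlt) ht, hw]
    congr 1 <;> omega
  · rw [maxl_eq_of_fst hJ hM heq] at hs ⊢
    exact maj_step hV hM hMG hs ht

/-- Consecutive live intervals agree on the colour between them, if both determine one. -/
theorem Live.majS_eq_majP (hL : S.Live w 𝒥 𝓛) {J N : ℤ × ℤ} (hJ : J ∈ 𝓛) (hN : IsNext 𝓛 J N)
    (h1 : S.XR w J < N.1) (h2 : J.2 ≤ S.XL w N) : S.majS w J = S.majP w N := by
  refine hL.maj_chain_dead (hL.sub hJ) (hL.sCert hJ hN h1) (hL.sub hN.1) hN.2.1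
    (hL.pCert hJ hN h2) fun M hM hlt hlt' => hL.dead M hM fun hM𝓛 => ?_
  have := hN.2.2 M hM𝓛 hlt
  omega

end Setting

namespace Setting

variable {ι : Type*} [DecidableEq ι] {S : Setting ι} {w w' : ℤ → ℕ} {I : ℤ × ℤ}
  {𝒥 𝓛 : Finset (ℤ × ℤ)}

/-! ### The pieces of the placement -/

theorem Valid.left_mem_maxl (hV : S.Valid w 𝒥) : (S.A, S.A + 1) ∈ maxl 𝒥 := by
  refine mem_filter.2 ⟨hV.left, fun J hJ h1 h2 => ?_⟩
  rcases hV.inside J hJ with h | h | h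
  · exact h
  · rw [h] at h1; simp only at h1; have := hV.A_lt_B; omega
  · simp only at h1; omega

theorem Valid.right_mem_maxl (hV : S.Valid w 𝒥) : (S.B, S.B + 1) ∈ maxl 𝒥 := by
  refine mem_filter.2 ⟨hV.right, fun J hJ h1 h2 => ?_⟩
  rcases hV.inside J hJ with h | h | h
  · rw [h] at h2; simp only at h2; have := hV.A_lt_B; omega
  · exact h
  · simp only at h2; omega

namespace Live

theorem left_mem (hL : S.Live w 𝒥 𝓛) : (S.A, S.A + 1) ∈ 𝓛 := by
  by_contra hc
  have := (hL.dead _ hL.left_mem_maxl hc).2 S.A le_rfl (by simp)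
  rw [hL.wA] at this
  simp [width] at this

theorem right_mem (hL : S.Live w 𝒥 𝓛) : (S.B, S.B + 1) ∈ 𝓛 := by
  by_contra hc
  have := (hL.dead _ hL.right_mem_maxl hc).2 S.B le_rfl (by simp)
  rw [hL.wB] at this
  simp [width] at this

theorem mem (hL : S.Live w 𝒥 𝓛) {J : ℤ × ℤ} (hJ : J ∈ 𝓛) : J ∈ 𝒥 := mem_of_mem_maxl (hL.sub hJ)

theorem fst_lt_snd (hL : S.Live w 𝒥 𝓛) {J : ℤ × ℤ} (hJ : J ∈ 𝓛) : J.1 < J.2 :=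
  hL.lt J (hL.mem hJ)

theorem snd_le_snd (hL : S.Live w 𝒥 𝓛) {J N : ℤ × ℤ} (hJ : J ∈ 𝓛) (hN : N ∈ 𝓛)
    (h : J.1 ≤ N.1) : J.2 ≤ N.2 := by
  rcases h.lt_or_eq with h | h
  · exact (maxl_snd_lt (hL.sub hJ) (hL.sub hN) h).le
  · exact (maxl_eq_of_fst (hL.sub hJ) (hL.sub hN) h) ▸ le_rfl

theorem snd_lt_snd (hL : S.Live w 𝒥 𝓛) {J N : ℤ × ℤ} (hJ : J ∈ 𝓛) (hN : N ∈ 𝓛)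
    (h : J.1 < N.1) : J.2 < N.2 := maxl_snd_lt (hL.sub hJ) (hL.sub hN) h

theorem fst_le (hL : S.Live w 𝒥 𝓛) {J : ℤ × ℤ} (hJ : J ∈ 𝓛) :
    J.1 ≤ min (S.XL w J) (S.XR w J) := fst_le_min hL.one_le (hL.fst_lt_snd hJ)

theorem fst_lt_of_isLast (hL : S.Live w 𝒥 𝓛) {p : ℤ} {J : ℤ × ℤ} (hJ : S.IsLast w 𝓛 p J) :
    J.1 < p := (hL.fst_le hJ.1).trans_lt hJ.2.1

theorem exists_isLast (hL : S.Live w 𝒥 𝓛) {p : ℤ} (hp : S.A < p) : ∃ J, S.IsLast w 𝓛 p J := by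
  obtain ⟨J, hJ, hmax⟩ := (𝓛.filter fun M => min (S.XL w M) (S.XR w M) < p).exists_max_image
    (fun M => M.1) ⟨(S.A, S.A + 1), mem_filter.2 ⟨hL.left_mem,
      (min_lt_snd (S := S) (w := w) (I := (S.A, S.A + 1))).trans_le (by simpa using hp)⟩⟩
  rw [mem_filter] at hJ
  exact ⟨J, hJ.1, hJ.2, fun M hM h => hmax M (mem_filter.2 ⟨hM, h⟩)⟩

theorem exists_isNext (hL : S.Live w 𝒥 𝓛) {p : ℤ} (hp : p ≤ S.B) {J : ℤ × ℤ}
    (hJ : S.IsLast w 𝓛 p J) : ∃ N, IsNext 𝓛 J N :=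
  RingPartitioning.exists_isNext hL.right_mem (by
    have := hL.fst_lt_of_isLast hJ
    simp only
    omega)

theorem col_eq (hL : S.Live w 𝒥 𝓛) {p : ℤ} {J N : ℤ × ℤ} (hJ : S.IsLast w 𝓛 p J)
    (hN : IsNext 𝓛 J N) : S.col w 𝓛 p = S.piece w J N p := by
  have h : ∃ JN : (ℤ × ℤ) × (ℤ × ℤ), S.IsLast w 𝓛 p JN.1 ∧ IsNext 𝓛 JN.1 JN.2 := ⟨(J, N), hJ, hN⟩
  rw [col, dif_pos h]
  obtain ⟨h1, h2⟩ := h.choose_spec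
  have e1 : h.choose.1 = J := maxl_eq_of_fst (hL.sub h1.1) (hL.sub hJ.1)
    (le_antisymm (hJ.2.2 _ h1.1 h1.2.1) (h1.2.2 _ hJ.1 hJ.2.1))
  rw [e1] at h2
  have e2 : h.choose.2 = N := maxl_eq_of_fst (hL.sub h2.1) (hL.sub hN.1)
    (le_antisymm (h2.2.2 _ hN.1 hN.2.1) (hN.2.2 _ h2.1 h2.2.1))
  rw [e1, e2]

theorem le_next (_hL : S.Live w 𝒥 𝓛) {p : ℤ} {J N : ℤ × ℤ} (hJ : S.IsLast w 𝓛 p J)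
    (hN : IsNext 𝓛 J N) : p ≤ min (S.XL w N) (S.XR w N) := by
  by_contra hc
  have := hJ.2.2 N hN.1 (not_le.1 hc)
  have := hN.2.1
  omega

/-- Behind the interval `J` the colour is determined by the following interval. -/
theorem col_eq_majP (hL : S.Live w 𝒥 𝓛) {p : ℤ} {J N : ℤ × ℤ} (hJ : S.IsLast w 𝓛 p J)
    (hN : IsNext 𝓛 J N) (h : J.2 ≤ p) : S.col w 𝓛 p = some (S.majP w N) := by
  have h1 := hL.le_next hJ hN
  have h2 : J.2 ≤ S.XL w N := h.trans (h1.trans (min_le_left _ _))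
  have h3 := XR_lt (S := S) (w := w) (I := J)
  rw [hL.col_eq hJ hN, piece, if_neg (by omega)]
  split_ifs with h4
  · rw [hL.majS_eq_majP hJ.1 hN h4 h2]
  · rfl

/-- Before the interval `N` the colour is determined by the preceding interval. -/
theorem col_eq_majS (hL : S.Live w 𝒥 𝓛) {p : ℤ} {J N : ℤ × ℤ} (hJ : S.IsLast w 𝓛 p J)
    (hN : IsNext 𝓛 J N) (h : p ≤ N.1) :
    S.col w 𝓛 p = if p ≤ S.XR w J then none else some (S.majS w J) := by
  rw [hL.col_eq hJ hN, piece]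
  split_ifs with h1 h2 h3 <;> first | rfl | omega

/-- Guests are interior points of live intervals. -/
theorem exists_of_col_eq_none (hL : S.Live w 𝒥 𝓛) {p : ℤ} (hA : S.A < p) (hB : p ≤ S.B)
    (h : S.col w 𝓛 p = none) : ∃ J ∈ 𝓛, J.1 < p ∧ p < J.2 := by
  obtain ⟨J, hJ⟩ := hL.exists_isLast hA
  obtain ⟨N, hN⟩ := hL.exists_isNext hB hJ
  refine ⟨J, hJ.1, hL.fst_lt_of_isLast hJ, ?_⟩
  by_contra hc
  rw [hL.col_eq_majP hJ hN (not_lt.1 hc)] at h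
  exact absurd h (by simp)

/-- The colour changes only at the cuts of live intervals. -/
theorem exists_cut (hL : S.Live w 𝒥 𝓛) {p : ℤ} (hA : S.A < p) (hB : p < S.B)
    (h : S.col w 𝓛 p ≠ S.col w 𝓛 (p + 1)) : ∃ M ∈ 𝓛, p = S.XL w M ∨ p = S.XR w M := by
  obtain ⟨J, hJ⟩ := hL.exists_isLast hA
  obtain ⟨N, hN⟩ := hL.exists_isNext hB.le hJ
  obtain ⟨J', hJ'⟩ := hL.exists_isLast (hA.trans (lt_add_one p))
  have hvis : J.1 ≤ J'.1 := hJ'.2.2 J hJ.1 (hJ.2.1.trans (lt_add_one p))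
  rcases hvis.lt_or_eq with hlt | heq
  · have h1 : p ≤ min (S.XL w J') (S.XR w J') := by
      by_contra hc
      have := hJ.2.2 J' hJ'.1 (not_le.1 hc)
      omega
    have h2 : min (S.XL w J') (S.XR w J') = p := le_antisymm (Int.lt_add_one_iff.1 hJ'.2.1) h1
    refine ⟨J', hJ'.1, ?_⟩
    rcases min_choice (S.XL w J') (S.XR w J') with h3 | h3
    · left; rw [← h3, h2]
    · right; rw [← h3, h2]
  · have e := maxl_eq_of_fst (hL.sub hJ.1) (hL.sub hJ'.1) heq
    rw [← e] at hJ'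
    refine ⟨J, hJ.1, Or.inr ?_⟩
    rw [hL.col_eq hJ hN, hL.col_eq hJ' hN] at h
    by_contra hc
    apply h
    unfold piece
    simp only [show p + 1 ≤ S.XR w J ↔ p ≤ S.XR w J by omega]

/-- The first point of the path keeps its initial colour, because the edge before it counts as never
requested. -/
theorem col_left (hL : S.Live w 𝒥 𝓛) : S.col w 𝓛 (S.A + 1) = some (S.F (S.A + 1)) := by
  have hq := hL.four_le
  have hAB := hL.A_lt_B
  obtain ⟨J, hJ⟩ := hL.exists_isLast (lt_add_one S.A)
  obtain ⟨N, hN⟩ := hL.exists_isNext (p := S.A + 1) hL.A_lt_B hJ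
  have h1 := hL.fst_lt_of_isLast hJ
  have e : J = (S.A, S.A + 1) := by
    rcases hL.inside J (hL.mem hJ.1) with h | h | h
    · exact h
    · rw [h] at h1; simp only at h1; omega
    · omega
  have h2 : S.A + 1 ≤ N.1 := by
    have := hN.2.1
    rw [e] at this; simp only at this; omega
  have h3 := XR_lt (S := S) (w := w) (I := J)
  rw [hL.col_eq_majS hJ hN h2, if_neg (by rw [e] at h3 ⊢; simp only at h3; omega), majS, glR,
    glue_eq_zero (by unfold fromRight; rw [e]; simpa using hL.wA), e]
  simpa using maj_self (by omega) _

theorem col_right (hL : S.Live w 𝒥 𝓛) : S.col w 𝓛 S.B = some (S.F S.B) := by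
  have hq := hL.four_le
  have hAB := hL.A_lt_B
  obtain ⟨J, hJ⟩ := hL.exists_isLast hAB
  obtain ⟨N, hN⟩ := hL.exists_isNext le_rfl hJ
  have h1 := hL.fst_lt_of_isLast hJ
  have hJB : J.2 ≤ S.B := by
    rcases hL.inside J (hL.mem hJ.1) with h | h | h
    · rw [h]; simp only; omega
    · rw [h] at h1; simp only at h1; omega
    · omega
  have e : N = (S.B, S.B + 1) := by
    have h2 := hL.le_next hJ hN
    have h3 := min_lt_snd (S := S) (w := w) (I := N)
    have h4 := hN.2.1
    rcases hL.inside N (hL.mem hN.1) with h | h | h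
    · rw [h] at h3 h2; simp only at h3; omega
    · exact h
    · omega
  rw [hL.col_eq_majP hJ hN hJB, majP, glL,
    glue_eq_zero (by unfold fromLeft; rw [e]; simpa using hL.wB), e]
  simpa using maj_self (by omega) _

/-- If no edge was requested and there are only intervals of width one, the placement is the
initial one. -/
theorem col_init (hL : S.Live w 𝒥 (maxl 𝒥)) (hw : ∀ e, w e = 0)
    (h𝒥 : ∀ J ∈ 𝒥, J.2 = J.1 + 1) {p : ℤ} (hA : S.A < p) (hB : p ≤ S.B) :
    S.col w (maxl 𝒥) p = some (S.F p) := by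
  have hq := hL.four_le
  obtain ⟨J, hJ⟩ := hL.exists_isLast hA
  obtain ⟨N, hN⟩ := hL.exists_isNext hB hJ
  have h1 := hL.fst_lt_of_isLast hJ
  have h2 := h𝒥 J (hL.mem hJ.1)
  have h3 := h𝒥 N (hL.mem hN.1)
  have h4 := hL.le_next hJ hN
  have h5 := min_lt_snd (S := S) (w := w) (I := N)
  rw [hL.col_eq_majP hJ hN (by omega), majP, glL, glue_eq_zero (by unfold fromLeft; rw [hw]),
    hL.gap_const hJ.1 hN (by omega : J.2 ≤ p) (by omega : p ≤ N.1) le_rfl]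
  simpa using maj_self (by omega) _

/-! ### Closed games -/

/-- Points deep inside a live interval are guests. -/
theorem col_eq_none (hL : S.Live w 𝒥 𝓛) {M : ℤ × ℤ} (hM : M ∈ 𝓛) {p : ℤ} (hA : S.A < p)
    (hB : p ≤ S.B) (h1 : M.1 + S.D ≤ p) (h2 : p + S.D ≤ M.2) : S.col w 𝓛 p = none := by
  obtain ⟨J, hJ⟩ := hL.exists_isLast hA
  obtain ⟨N, hN⟩ := hL.exists_isNext hB hJ
  have h3 := XL_lt (w := w) hL.one_le (hL.fst_lt_snd hM)
  have h4 := cap_le (S := S) (I := M)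
  have h5 := hJ.2.2 M hM (min_lt_of_left_lt (by omega))
  have h6 := hL.snd_le_snd hM hJ.1 h5
  have h7 := lt_XR (w := w) hL.one_le (hL.fst_lt_snd hJ.1)
  have h8 := cap_le (S := S) (I := J)
  rw [hL.col_eq hJ hN, piece, if_pos (by omega)]

/-- After the end of the left game of an interval that is not dead, the surroundings of its left
end are covered by a larger interval and consist of guests. -/
theorem col_XL_of_not_openL (hL : S.Live w 𝒥 𝓛) {M : ℤ × ℤ} (hM : M ∈ 𝓛) (hd : ¬ S.Dead w M)
    (ho : ¬ S.OpenL w M) : S.col w 𝓛 (S.XL w M) = none ∧ S.col w 𝓛 (S.XL w M + 1) = none := by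
  have hD := hL.one_le
  have hlt := hL.fst_lt_snd hM
  have hw : (width M : ℤ) = M.2 - M.1 := by unfold width; omega
  have hheavy : ∀ e, M.1 ≤ e → e < M.1 + S.cap M → S.cap M ≤ w e := by
    intro e h1 h2
    have := le_of_not_open ho (i := (e - M.1).toNat) (by omega)
    unfold fromLeft at this
    rwa [show M.1 + ((e - M.1).toNat : ℤ) = e by omega] at this
  have hcapD : S.cap M = S.D := by
    unfold cap
    by_contra hc
    refine hd ⟨by omega, fun e h1 h2 => ?_⟩
    have h3 : S.cap M = width M := by unfold cap; omega
    rw [h3] at hheavy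
    exact hheavy e h1 (by omega)
  have hX : S.XL w M = M.1 := by rw [XL, gpick_of_not_open ho]; simp
  have hDw : S.D ≤ width M := hcapD ▸ cap_le_width
  rw [hcapD] at hheavy
  obtain ⟨hA, hB⟩ := hL.inside_of_heavy (hL.mem hM) le_rfl hlt
    (by have := hheavy M.1 le_rfl (by omega); omega)
  obtain ⟨J, hJ, hJ1, hJ2⟩ := hL.sat M.1 (M.1 + S.D) hA (by omega) (by omega) (by omega)
    (fun e h1 h2 => by have := hheavy e h1 h2; omega) (hL.big M.1 hA (by omega))
  obtain ⟨M', hM', h1, h2⟩ := exists_maxl hJ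
  have hM'𝓛 : M' ∈ 𝓛 := by
    by_contra hc
    have := (hL.dead M' hM' hc).1
    unfold width at this
    omega
  rw [hX]
  exact ⟨hL.col_eq_none hM'𝓛 (by omega) (by omega) (by omega) (by omega),
    hL.col_eq_none hM'𝓛 (by omega) (by omega) (by omega) (by omega)⟩

/-- The mirror image of `col_XL_of_not_openL`. -/
theorem col_XR_of_not_openR (hL : S.Live w 𝒥 𝓛) {M : ℤ × ℤ} (hM : M ∈ 𝓛) (hd : ¬ S.Dead w M)
    (ho : ¬ S.OpenR w M) : S.col w 𝓛 (S.XR w M) = none ∧ S.col w 𝓛 (S.XR w M + 1) = none := by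
  have hD := hL.one_le
  have hlt := hL.fst_lt_snd hM
  have hw : (width M : ℤ) = M.2 - M.1 := by unfold width; omega
  have hheavy : ∀ e, M.2 - S.cap M ≤ e → e < M.2 → S.cap M ≤ w e := by
    intro e h1 h2
    have := le_of_not_open ho (i := (M.2 - 1 - e).toNat) (by omega)
    unfold fromRight at this
    rwa [show M.2 - 1 - ((M.2 - 1 - e).toNat : ℤ) = e by omega] at this
  have hcapD : S.cap M = S.D := by
    unfold cap
    by_contra hc
    refine hd ⟨by omega, fun e h1 h2 => ?_⟩
    have h3 : S.cap M = width M := by unfold cap; omega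
    rw [h3] at hheavy
    exact hheavy e (by omega) h2
  have hX : S.XR w M = M.2 - 1 := by rw [XR, gpick_of_not_open ho]; simp
  have hDw : S.D ≤ width M := hcapD ▸ cap_le_width
  rw [hcapD] at hheavy
  obtain ⟨hA, hB⟩ := hL.inside_of_heavy (hL.mem hM) (by omega : M.1 ≤ M.2 - 1) (by omega)
    (by have := hheavy (M.2 - 1) (by omega) (by omega); omega)
  obtain ⟨J, hJ, hJ1, hJ2⟩ := hL.sat (M.2 - S.D) M.2 (by omega) (by omega) (by omega) (by omega)
    (fun e h1 h2 => by have := hheavy e h1 h2; omega)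
    (by have := hL.big (M.2 - S.D) (by omega) (by omega); rwa [sub_add_cancel] at this)
  obtain ⟨M', hM', h1, h2⟩ := exists_maxl hJ
  have hM'𝓛 : M' ∈ 𝓛 := by
    by_contra hc
    have := (hL.dead M' hM' hc).1
    unfold width at this
    omega
  rw [hX]
  exact ⟨hL.col_eq_none hM'𝓛 (by omega) (by omega) (by omega) (by omega),
    hL.col_eq_none hM'𝓛 (by omega) (by omega) (by omega) (by omega)⟩

/-- If no live interval is dead, the colour changes only at the cuts of open games. -/
theorem exists_open_cut (hL : S.Live w 𝒥 𝓛) (hd : ∀ M ∈ 𝓛, ¬ S.Dead w M) {p : ℤ} (hA : S.A < p)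
    (hB : p < S.B) (h : S.col w 𝓛 p ≠ S.col w 𝓛 (p + 1)) :
    ∃ M ∈ 𝓛, (S.OpenL w M ∧ p = S.XL w M) ∨ (S.OpenR w M ∧ p = S.XR w M) := by
  obtain ⟨M, hM, rfl | rfl⟩ := hL.exists_cut hA hB h
  · refine ⟨M, hM, Or.inl ⟨?_, rfl⟩⟩
    by_contra ho
    obtain ⟨h1, h2⟩ := hL.col_XL_of_not_openL hM (hd M hM) ho
    exact h (h1.trans h2.symm)
  · refine ⟨M, hM, Or.inr ⟨?_, rfl⟩⟩
    by_contra ho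
    obtain ⟨h1, h2⟩ := hL.col_XR_of_not_openR hM (hd M hM) ho
    exact h (h1.trans h2.symm)

/-! ### Changes of the placement -/

/-- The colour determined by a heavy initial segment persists under further requests. -/
theorem majP_eq (hL : S.Live w 𝒥 𝓛) (hV' : S.Valid w' 𝒥) (hw : w ≤ w') {J N : ℤ × ℤ}
    (hJ : J ∈ 𝓛) (hN : IsNext 𝓛 J N) (h : J.2 ≤ S.XL w N) : S.majP w N = S.majP w' N := by
  obtain ⟨_, _, _, h4⟩ := hL.pCert hJ hN h
  have hmono : fromLeft w N ≤ fromLeft w' N := fun i => hw _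
  exact maj_prefix_eq hV' (hL.sub hN.1) (glue_mono hmono) (glL_le_cap.trans cap_le_width)
    (glL_le_cap.trans cap_le) (fun e h1 h2 => glL_le_of_mem h1 h2)
    fun M' hM' hlt => Or.inl (h4 M' hM' hlt)

/-- The colour determined by a heavy final segment persists under further requests. -/
theorem majS_eq (hL : S.Live w 𝒥 𝓛) (hV' : S.Valid w' 𝒥) (hw : w ≤ w') {J N : ℤ × ℤ}
    (hJ : J ∈ 𝓛) (hN : IsNext 𝓛 J N) (h : S.XR w J < N.1) : S.majS w J = S.majS w' J := by
  obtain ⟨_, _, _, h4⟩ := hL.sCert hJ hN h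
  have hmono : fromRight w J ≤ fromRight w' J := fun i => hw _
  exact maj_suffix_eq hV' (hL.sub hJ) (glue_mono hmono) (glR_le_cap.trans cap_le_width)
    (glR_le_cap.trans cap_le) (fun e h1 h2 => glR_le_of_mem h1 h2)
    fun M' hM' hlt => Or.inl (h4 M' hM' hlt)

/-- While the set of live intervals does not change, new requests change the colour of a point
only if a cut jumps over it. -/
theorem col_congr (hL : S.Live w 𝒥 𝓛) (hL' : S.Live w' 𝒥 𝓛) (hw : w ≤ w') {p : ℤ} (hA : S.A < p)
    (hB : p ≤ S.B)
    (h1 : ∀ M ∈ 𝓛, S.XL w M ≠ S.XL w' M → p ≤ M.1 ∨ (S.XL w M < p ∧ S.XL w' M < p))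
    (h2 : ∀ M ∈ 𝓛, S.XR w M ≠ S.XR w' M → M.2 ≤ p ∨ (p ≤ S.XR w M ∧ p ≤ S.XR w' M)) :
    S.col w 𝓛 p = S.col w' 𝓛 p := by
  have hXL : ∀ M ∈ 𝓛, (S.XL w M < p ↔ S.XL w' M < p) := by
    intro M hM
    by_cases he : S.XL w M = S.XL w' M
    · rw [he]
    · rcases h1 M hM he with h | h
      · have := le_XL (S := S) (w := w) (I := M)
        have := le_XL (S := S) (w := w') (I := M)
        omega
      · exact ⟨fun _ => h.2, fun _ => h.1⟩
  have hXR : ∀ M ∈ 𝓛, (S.XR w M < p ↔ S.XR w' M < p) := by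
    intro M hM
    by_cases he : S.XR w M = S.XR w' M
    · rw [he]
    · rcases h2 M hM he with h | h
      · have := XR_lt (S := S) (w := w) (I := M)
        have := XR_lt (S := S) (w := w') (I := M)
        omega
      · omega
  have hvis : ∀ M ∈ 𝓛, (min (S.XL w M) (S.XR w M) < p ↔ min (S.XL w' M) (S.XR w' M) < p) := by
    intro M hM
    rw [min_lt_iff, min_lt_iff, hXL M hM, hXR M hM]
  obtain ⟨J, hJ⟩ := hL.exists_isLast hA
  obtain ⟨N, hN⟩ := hL.exists_isNext hB hJ
  have hJ' : S.IsLast w' 𝓛 p J :=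
    ⟨hJ.1, (hvis J hJ.1).1 hJ.2.1, fun M hM h => hJ.2.2 M hM ((hvis M hM).2 h)⟩
  have hp := hL.le_next hJ hN
  have hp' := hL'.le_next hJ' hN
  rw [le_min_iff] at hp hp'
  by_cases hJp : J.2 ≤ p
  · rw [hL.col_eq_majP hJ hN hJp, hL'.col_eq_majP hJ' hN hJp,
      hL.majP_eq hL'.toValid hw hJ.1 hN (hJp.trans hp.1)]
  have hXRJ := hXR J hJ.1
  by_cases hpR : p ≤ S.XR w J
  · rw [hL.col_eq hJ hN, hL'.col_eq hJ' hN, piece, piece, if_pos hpR, if_pos (by omega)]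
  by_cases hpN : p ≤ N.1
  · rw [hL.col_eq_majS hJ hN hpN, hL'.col_eq_majS hJ' hN hpN, if_neg hpR, if_neg (by omega),
      hL.majS_eq hL'.toValid hw hJ.1 hN (by omega)]
  have e1 : S.XR w J = S.XR w' J := by
    by_contra he
    rcases h2 J hJ.1 he with h | h <;> omega
  have e2 : S.XL w N = S.XL w' N := by
    by_contra he
    rcases h1 N hN.1 he with h | h <;> omega
  rw [hL.col_eq hJ hN, hL'.col_eq hJ' hN, piece, piece, ← e1, ← e2]
  split_ifs with h3 h4
  · rw [hL.majS_eq hL'.toValid hw hJ.1 hN h3]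
  · rw [hL.majP_eq hL'.toValid hw hJ.1 hN h4]
  · rfl

/-- The live intervals after the creation of the interval `I`. -/
def _root_.RingPartitioning.addLive (𝒥 𝓛 : Finset (ℤ × ℤ)) (I : ℤ × ℤ) : Finset (ℤ × ℤ) :=
  insert I (𝓛.filter fun M => M ∈ maxl (insert I 𝒥))

/-- The family of live intervals after the creation of a new maximal interval. -/
theorem addLive (hL : S.Live w 𝒥 𝓛) (hV : S.Valid w (insert I 𝒥)) (hI : I ∈ maxl (insert I 𝒥)) :
    S.Live w (insert I 𝒥) (addLive 𝒥 𝓛 I) where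
  toValid := hV
  sub := by
    intro M hM
    rcases mem_insert.1 hM with rfl | h
    · exact hI
    · exact (mem_filter.1 h).2
  dead := by
    intro M hM hM'
    have hMI : M ≠ I := by
      rintro rfl
      exact hM' (mem_insert_self _ _)
    have hM𝒥 : M ∈ maxl 𝒥 := by
      have h := mem_filter.1 hM
      exact mem_filter.2 ⟨(mem_insert.1 h.1).resolve_left hMI,
        fun J hJ => h.2 J (mem_insert_of_mem hJ)⟩
    exact hL.dead M hM𝒥 fun h => hM' (mem_insert_of_mem (mem_filter.2 ⟨h, hM⟩))

/-- An interval that stops being maximal is contained in the new one. -/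
theorem _root_.RingPartitioning.subset_of_notMem_maxl_insert {M : ℤ × ℤ} (hM : M ∈ maxl 𝒥)
    (h : M ∉ maxl (insert I 𝒥)) : I.1 ≤ M.1 ∧ M.2 ≤ I.2 := by
  by_contra hc
  refine h (mem_filter.2 ⟨mem_insert_of_mem (mem_of_mem_maxl hM), fun J hJ h1 h2 => ?_⟩)
  rcases mem_insert.1 hJ with rfl | hJ
  · exact absurd ⟨h1, h2⟩ hc
  · exact (mem_filter.1 hM).2 J hJ h1 h2

/-- The creation of an interval affects only the colours of its interior points. -/
theorem col_addLive (hL : S.Live w 𝒥 𝓛) (hV : S.Valid w (insert I 𝒥))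
    (hI : I ∈ maxl (insert I 𝒥)) {p : ℤ} (hA : S.A < p) (hB : p ≤ S.B)
    (hp : p ≤ I.1 ∨ I.2 ≤ p) : S.col w 𝓛 p = S.col w (RingPartitioning.addLive 𝒥 𝓛 I) p := by
  have hL' := hL.addLive hV hI
  have hIlt : I.1 < I.2 := hV.lt I (mem_insert_self _ _)
  have hII : I ∈ RingPartitioning.addLive 𝒥 𝓛 I := mem_insert_self _ _
  obtain ⟨J, hJ⟩ := hL.exists_isLast hA
  obtain ⟨N, hN⟩ := hL.exists_isNext hB hJ
  have hJp := hL.fst_lt_of_isLast hJ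
  have hstay : ∀ M ∈ 𝓛, ¬ (I.1 ≤ M.1 ∧ M.2 ≤ I.2) → M ∈ RingPartitioning.addLive 𝒥 𝓛 I := by
    intro M hM h
    refine mem_insert_of_mem (mem_filter.2 ⟨hM, ?_⟩)
    by_contra hc
    exact h (subset_of_notMem_maxl_insert (hL.sub hM) hc)
  have hback : ∀ M ∈ RingPartitioning.addLive 𝒥 𝓛 I, M = I ∨ M ∈ 𝓛 := by
    intro M hM
    rcases mem_insert.1 hM with h | h
    · exact Or.inl h
    · exact Or.inr (mem_filter.1 h).1
  rcases hp with hp | hp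
  · have hJ' : S.IsLast w (RingPartitioning.addLive 𝒥 𝓛 I) p J := by
      refine ⟨hstay J hJ.1 (by omega), hJ.2.1, fun M hM h => ?_⟩
      rcases hback M hM with rfl | hM'
      · have := hL'.fst_le hM; omega
      · exact hJ.2.2 M hM' h
    obtain ⟨N', hN'⟩ := hL'.exists_isNext hB hJ'
    by_cases hpN : p ≤ N.1
    · have hpN' : p ≤ N'.1 := by
        rcases hback N' hN'.1 with h | h
        · rw [h]; exact hp
        · exact hpN.trans (hN.2.2 N' h hN'.2.1)
      rw [hL.col_eq_majS hJ hN hpN, hL'.col_eq_majS hJ' hN' hpN']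
    · have hN2 : IsNext (RingPartitioning.addLive 𝒥 𝓛 I) J N := by
        refine ⟨hstay N hN.1 (by omega), hN.2.1, fun M hM h => ?_⟩
        rcases hback M hM with rfl | hM'
        · omega
        · exact hN.2.2 M hM' h
      rw [hL.col_eq hJ hN, hL'.col_eq hJ' hN2]
  · by_cases hcase : I.1 < J.1 ∧ ¬ (J.2 ≤ I.2)
    · have hJmem := hstay J hJ.1 (by omega)
      have hJ' : S.IsLast w (RingPartitioning.addLive 𝒥 𝓛 I) p J := by
        refine ⟨hJmem, hJ.2.1, fun M hM h => ?_⟩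
        rcases hback M hM with rfl | hM'
        · exact hcase.1.le
        · exact hJ.2.2 M hM' h
      have hN2 : IsNext (RingPartitioning.addLive 𝒥 𝓛 I) J N := by
        have := hL.snd_lt_snd hJ.1 hN.1 hN.2.1
        refine ⟨hstay N hN.1 (by omega), hN.2.1, fun M hM h => ?_⟩
        rcases hback M hM with rfl | hM'
        · omega
        · exact hN.2.2 M hM' h
      rw [hL.col_eq hJ hN, hL'.col_eq hJ' hN2]
    · have hJ2 : J.2 ≤ I.2 := by
        by_contra hc
        have hJmem := hstay J hJ.1 (by omega)
        have := hL'.snd_le_snd hJmem hII (by omega)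
        omega
      have hNp := hL.le_next hJ hN
      have hN2 := min_lt_snd (S := S) (w := w) (I := N)
      have hNmem := hstay N hN.1 (by omega)
      have hIN : I.1 < N.1 := by
        by_contra hc
        have := hL'.snd_le_snd hNmem hII (by omega)
        omega
      -- the intervals behind `I` are behind `J` as well
      have hbehind : ∀ M ∈ RingPartitioning.addLive 𝒥 𝓛 I, I.1 < M.1 → M ∈ 𝓛 ∧ J.1 < M.1 := by
        intro M hM h
        have hM' := (hback M hM).resolve_left (by rintro rfl; omega)
        refine ⟨hM', ?_⟩
        by_contra hc
        have h1 := hL.snd_le_snd hM' hJ.1 (not_lt.1 hc)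
        have h2 := hL'.snd_lt_snd hII hM h
        omega
      have hI' : S.IsLast w (RingPartitioning.addLive 𝒥 𝓛 I) p I := by
        refine ⟨hII, (min_lt_snd (S := S)).trans_le hp, fun M hM h => ?_⟩
        by_contra hc
        obtain ⟨h1, h2⟩ := hbehind M hM (not_le.1 hc)
        have := hJ.2.2 M h1 h
        omega
      have hNI : IsNext (RingPartitioning.addLive 𝒥 𝓛 I) I N := by
        refine ⟨hNmem, hIN, fun M hM h => ?_⟩
        obtain ⟨h1, h2⟩ := hbehind M hM h
        exact hN.2.2 M h1 h2
      rw [hL.col_eq_majP hJ hN (by omega), hL'.col_eq_majP hI' hNI hp]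

theorem erase (hL : S.Live w 𝒥 𝓛) (hd : S.Dead w I) : S.Live w 𝒥 (𝓛.erase I) where
  toValid := hL.toValid
  sub := (erase_subset _ _).trans hL.sub
  dead := by
    intro M hM hM'
    by_cases h : M = I
    · rw [h]; exact hd
    · exact hL.dead M hM fun h' => hM' (mem_erase.2 ⟨h, h'⟩)

/-- The death of an interval affects only the colours of its interior points. -/
theorem col_erase (hL : S.Live w 𝒥 𝓛) (hI : I ∈ 𝓛) (hd : S.Dead w I) {p : ℤ} (hA : S.A < p)
    (hB : p ≤ S.B) (hp : p ≤ I.1 ∨ I.2 ≤ p) : S.col w 𝓛 p = S.col w (𝓛.erase I) p := by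
  have hL' := hL.erase hd
  obtain ⟨J, hJ⟩ := hL.exists_isLast hA
  obtain ⟨N, hN⟩ := hL.exists_isNext hB hJ
  have hJp := hL.fst_lt_of_isLast hJ
  by_cases hJI : J = I
  · have hp : I.2 ≤ p := by
      rw [hJI] at hJp
      omega
    obtain ⟨J', hJ'⟩ := hL'.exists_isLast hA
    have hJ'𝓛 := mem_of_mem_erase hJ'.1
    have hJ'I : J'.1 < I.1 := by
      have := hJ.2.2 J' hJ'𝓛 hJ'.2.1
      rw [hJI] at this
      refine lt_of_le_of_ne this fun h => ?_
      exact ne_of_mem_erase hJ'.1 (maxl_eq_of_fst (hL.sub hJ'𝓛) (hL.sub hI) h)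
    have hJ'2 := hL.snd_lt_snd hJ'𝓛 hI hJ'I
    have hN1 := hN.2.1
    rw [hJI] at hN1
    have hN' : IsNext (𝓛.erase I) J' N := by
      refine ⟨mem_erase.2 ⟨?_, hN.1⟩, by omega, fun M hM h => ?_⟩
      · rintro rfl; omega
      have hM𝓛 := mem_of_mem_erase hM
      rcases lt_trichotomy M.1 I.1 with h1 | h1 | h1
      · have h2 := hL.snd_lt_snd hM𝓛 hI h1
        have := hJ'.2.2 M hM ((min_lt_snd (S := S)).trans_le (by omega))
        omega
      · exact absurd (maxl_eq_of_fst (hL.sub hM𝓛) (hL.sub hI) h1) (ne_of_mem_erase hM)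
      · exact hN.2.2 M hM𝓛 (by rw [hJI]; exact h1)
    rw [hL.col_eq_majP hJ hN (by rw [hJI]; exact hp), hL'.col_eq_majP hJ' hN' (by omega)]
  · have hJ' : S.IsLast w (𝓛.erase I) p J :=
      ⟨mem_erase.2 ⟨hJI, hJ.1⟩, hJ.2.1, fun M hM h => hJ.2.2 M (mem_of_mem_erase hM) h⟩
    by_cases hNI : N = I
    · obtain ⟨N', hN'⟩ := hL'.exists_isNext hB hJ'
      have h1 := hN.2.2 N' (mem_of_mem_erase hN'.1) hN'.2.1
      have h2 := hL.le_next hJ hN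
      have h3 := min_lt_snd (S := S) (w := w) (I := N)
      have h4 : p ≤ N.1 := by
        rw [hNI] at h2 h3 ⊢
        omega
      rw [hL.col_eq_majS hJ hN h4, hL'.col_eq_majS hJ' hN' (h4.trans h1)]
    · have hN' : IsNext (𝓛.erase I) J N := ⟨mem_erase.2 ⟨hNI, hN.1⟩, hN.2.1,
        fun M hM h => hN.2.2 M (mem_of_mem_erase hM) h⟩
      rw [hL.col_eq hJ hN, hL'.col_eq hJ' hN']

end Live

end Setting

namespace Setting

variable {ι : Type*} [DecidableEq ι] {S : Setting ι} {w : ℤ → ℕ} {𝒥 𝓛 : Finset (ℤ × ℤ)}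

/-! ### The number of points with a new colour -/

/-- The interval `[x, y]` around `p` lies on the path, and in it the colour `a` prevails by a
factor `c`. -/
def Around (S : Setting ι) (c : ℕ) (p : ℤ) (a : ι) : Prop :=
  ∃ x y, S.A < x ∧ x ≤ p ∧ p ≤ y ∧ y ≤ S.B ∧
    c * ((Icc x y).filter fun z => S.F z ≠ a).card ≤ ((Icc x y).filter fun z => S.F z = a).card

namespace Live

/-- Between the left end of an interval and its left cut, the colour of the heavy initial segment
prevails: the cut is at most a fraction `1 / q` beyond the segment. -/
theorem around_prefix {c : ℕ} (hc : S.q = 2 * c + 1) (hL : S.Live w 𝒥 𝓛) {J N : ℤ × ℤ}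
    (hJ : J ∈ 𝓛) (hN : IsNext 𝓛 J N) (h : J.2 ≤ S.XL w N) {p : ℤ} (h1 : N.1 ≤ p)
    (h2 : p ≤ S.XL w N) (hB : p ≤ S.B) : S.Around c p (S.majP w N) := by
  have hcert := hL.pCert hJ hN h
  have hmono := nearMono_maj (hcert.exists_nearMono hL.toValid (hL.sub hN.1))
  have hX := XL_le (S := S) (w := w) (I := N)
  have hlt := hL.fst_lt_snd hN.1
  have hg : S.glL w N ≤ width N := hcert.1
  have hw : (width N : ℤ) = N.2 - N.1 := by unfold width; omega
  have hA : S.A < N.1 := by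
    have := hL.A_lt_B
    have := hN.2.1
    rcases hL.inside J (hL.mem hJ) with h | h | h
    · rw [h] at this; simp only at this; omega
    · rw [h] at this; simp only at this; omega
    · omega
  have hgB : N.1 + S.glL w N ≤ S.B := by
    rcases hL.inside N (hL.mem hN.1) with h | h | h
    · rw [h] at hA; simp at hA
    · have : S.glL w N = 0 := by
        rw [glL, glue_eq_zero (by unfold fromLeft; rw [h]; simpa using hL.wB)]
      rw [this, h]; simp
    · omega
  rw [hc] at hX hmono
  refine ⟨N.1, max p (N.1 + S.glL w N), hA, h1, le_max_left _ _, max_le hB hgB, ?_⟩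
  have := hmono.extend (y' := max p (N.1 + S.glL w N)) (by omega) le_rfl (le_max_right _ _) (by
    have e : (N.1 + (S.glL w N : ℤ) - N.1).toNat = S.glL w N := by omega
    rw [e]
    generalize S.glL w N / (2 * c + 1) = z at *
    push_cast at hX
    omega)
  rwa [← hc] at this

/-- The mirror image of `around_prefix`. -/
theorem around_suffix {c : ℕ} (hc : S.q = 2 * c + 1) (hL : S.Live w 𝒥 𝓛) {J N : ℤ × ℤ}
    (hJ : J ∈ 𝓛) (hN : IsNext 𝓛 J N) (h : S.XR w J < N.1) {p : ℤ} (h1 : S.XR w J < p)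
    (h2 : p ≤ J.2) (hA : S.A < p) : S.Around c p (S.majS w J) := by
  have hcert := hL.sCert hJ hN h
  have hmono := nearMono_maj (hcert.exists_nearMono hL.toValid (hL.sub hJ))
  have hX := le_XR (S := S) (w := w) (I := J)
  have hlt := hL.fst_lt_snd hJ
  have hg : S.glR w J ≤ width J := hcert.1
  have hw : (width J : ℤ) = J.2 - J.1 := by unfold width; omega
  have hB : J.2 ≤ S.B := by
    have h3 := hN.2.1
    have h4 := hL.A_lt_B
    rcases hL.inside J (hL.mem hJ) with h | h | h
    · rw [h]; simp only; omega
    · rw [h] at h3; simp only at h3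
      rcases hL.inside N (hL.mem hN.1) with h | h | h
      · rw [h] at h3; simp only at h3; omega
      · rw [h] at h3; simp at h3
      · have := hL.fst_lt_snd hN.1; omega
    · omega
  have hgA : S.A < J.2 - S.glR w J := by
    rcases hL.inside J (hL.mem hJ) with h | h | h
    · have : S.glR w J = 0 := by
        rw [glR, glue_eq_zero (by unfold fromRight; rw [h]; simpa using hL.wA)]
      rw [this, h]; simp
    · rw [h] at hB; simp at hB
    · omega
  rw [hc] at hX hmono
  refine ⟨min p (J.2 - S.glR w J), J.2, lt_min hA hgA, min_le_left _ _, h2, hB, ?_⟩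
  have := hmono.extend (x' := min p (J.2 - S.glR w J)) (by omega) (min_le_right _ _) le_rfl (by
    have e : (J.2 - (J.2 - (S.glR w J : ℤ))).toNat = S.glR w J := by omega
    rw [e]
    generalize S.glR w J / (2 * c + 1) = z at *
    push_cast at hX
    omega)
  rwa [← hc] at this

/-- A point whose colour is not the initial one lies in an interval in which its colour
prevails. -/
theorem around {c : ℕ} (hc : S.q = 2 * c + 1) (hL : S.Live w 𝒥 𝓛) {p : ℤ} (hA : S.A < p)
    (hB : p ≤ S.B) {a : ι} (ha : S.col w 𝓛 p = some a) (hF : S.F p ≠ a) : S.Around c p a := by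
  have hV := hL.toValid
  obtain ⟨J, hJ⟩ := hL.exists_isLast hA
  obtain ⟨N, hN⟩ := hL.exists_isNext hB hJ
  have hJp := hL.fst_lt_of_isLast hJ
  have hNp := hL.le_next hJ hN
  have hNXL : p ≤ S.XL w N := hNp.trans (min_le_left _ _)
  rw [hL.col_eq hJ hN, piece] at ha
  split_ifs at ha with h1 h2 h3
  · have ha : S.majS w J = a := Option.some.inj ha
    rcases le_or_gt p J.2 with hpJ | hpJ
    · rw [← ha]
      exact hL.around_suffix hc hJ.1 hN h2 (not_le.1 h1) hpJ hA
    have hJN : J.2 ≤ S.XL w N := hpJ.le.trans hNXL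
    rcases le_or_gt N.1 p with hpN | hpN
    · rw [← ha, hL.majS_eq_majP hJ.1 hN h2 hJN]
      exact hL.around_prefix hc hJ.1 hN hJN hpN hNXL hB
    -- `p` lies in a dead interval or in a gap between `J` and `N`
    have hJm := hL.sub hJ.1
    obtain ⟨M, hM, hmax⟩ := ((maxl 𝒥).filter fun M => M.1 ≤ p).exists_max_image
      (fun M => M.1) ⟨J, mem_filter.2 ⟨hJm, hJp.le⟩⟩
    rw [mem_filter] at hM
    have hJM : J.1 ≤ M.1 := hmax J (mem_filter.2 ⟨hJm, hJp.le⟩)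
    have hdead : ∀ M' ∈ maxl 𝒥, J.1 < M'.1 → M'.1 ≤ p → S.Dead w M' := by
      intro M' hM' h4 h5
      refine hL.dead M' hM' fun h6 => ?_
      have := hN.2.2 M' h6 h4
      omega
    have hlt := hL.lt M (mem_of_mem_maxl hM.1)
    have hw : (width M : ℤ) = M.2 - M.1 := by unfold width; omega
    have hcol : J.1 < M.1 → maj S.q S.F M.1 (M.1 + width M) = a := by
      intro h4
      have hd := hdead M hM.1 h4 hM.2
      rw [← ha]
      exact (hL.maj_chain_dead hJm (hL.sCert hJ.1 hN h2) hM.1 h4 (hd.pCert hM.1 hlt)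
        fun M' hM' h5 h6 => hdead M' hM' h5 (by omega)).symm
    rcases le_or_gt p M.2 with hpM | hpM
    · have hJM' : J.1 < M.1 := by
        refine lt_of_le_of_ne hJM fun h => ?_
        have := maxl_eq_of_fst hJm hM.1 h
        rw [← this] at hpM; omega
      have hd := hdead M hM.1 hJM' hM.2
      have hmono := nearMono_maj ((hd.pCert hM.1 hlt).exists_nearMono hV hM.1)
      rw [hcol hJM', hw, add_sub_cancel, hc] at hmono
      obtain ⟨h4, h5⟩ := hL.inside_of_heavy (mem_of_mem_maxl hM.1) le_rfl hlt
        (by have := hd.2 M.1 le_rfl hlt; omega)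
      exact ⟨M.1, M.2, by omega, hM.2, hpM, h5, hmono.extend hlt.le le_rfl le_rfl (Nat.le_add_right _ _)⟩
    · exfalso
      have hMN : M.1 < N.1 := by omega
      obtain ⟨N', hN'⟩ := RingPartitioning.exists_isNext (hL.sub hN.1) hMN
      have hpN' : p < N'.1 := by
        by_contra hcon
        have := hmax N' (mem_filter.2 ⟨hN'.1, not_lt.1 hcon⟩)
        have := hN'.2.1
        omega
      have hgap := hV.gap_const hM.1 hN' le_rfl hpM.le hpN'.le
      apply hF
      rw [← hgap]
      rcases hJM.lt_or_eq with h4 | h4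
      · have hd := hdead M hM.1 h4 hM.2
        rw [← hcol h4, ← (hd.sCert hlt).maj_eq_of_disjoint hV hM.1 hN' (by omega), hw]
        congr 1 <;> omega
      · have e := maxl_eq_of_fst hJm hM.1 h4
        rw [← e] at hN' ⊢
        rw [← ha]
        exact ((hL.sCert hJ.1 hN h2).maj_eq_of_disjoint hV hJm hN' (by omega)).symm
  · have ha : S.majP w N = a := Option.some.inj ha
    rw [← ha]
    exact hL.around_prefix hc hJ.1 hN h3 (by omega) hNXL hB

/-- Few points have a colour other than their initial one. -/
theorem card_new_le {c : ℕ} (hc : S.q = 2 * c + 1) (hL : S.Live w 𝒥 𝓛) (a : ι) :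
    c * ((Ioc S.A S.B).filter fun p => S.col w 𝓛 p = some a ∧ S.F p ≠ a).card ≤
      2 * ((Ioc S.A S.B).filter fun p => S.F p = a).card := by
  set B := (Ioc S.A S.B).filter fun p => S.col w 𝓛 p = some a ∧ S.F p ≠ a with hBdef
  rcases B.eq_empty_or_nonempty with h | h
  · rw [h]; simp
  have h1 := card_bad_le (F := S.F) (c := c) (a := a) (hi := S.B) B h S.A
    (fun p hp => (mem_filter.1 hp).2.2) (fun p hp => by
      obtain ⟨h1, h2, h3⟩ := mem_filter.1 hp
      rw [mem_Ioc] at h1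
      obtain ⟨x, y, h⟩ := hL.around hc h1.1 h1.2 h2 h3
      exact ⟨x, y, h⟩)
  have h2 : ((Ioc (B.min' h) S.B).filter fun p => S.F p = a).card ≤
      ((Ioc S.A S.B).filter fun p => S.F p = a).card := by
    refine card_le_card (filter_subset_filter _ (Ioc_subset_Ioc_left ?_))
    have := (mem_filter.1 (B.min'_mem h)).1
    rw [mem_Ioc] at this
    exact this.1.le
  omega

end Live

end Setting

/-! ### The ring and its universal cover -/

section
variable {n ℓ : ℕ} [NeZero n]

/-- The process (and also the edge from it to its successor) with number `x` modulo `n`. -/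
def pt (n : ℕ) [NeZero n] (x : ℤ) : Fin n :=
  ⟨(x % n).toNat, by
    have hn : (0 : ℤ) < n := by exact_mod_cast Nat.pos_of_ne_zero (NeZero.ne n)
    have := Int.emod_lt_of_pos x hn
    have := Int.emod_nonneg x hn.ne'
    omega⟩

theorem n_pos : (0 : ℤ) < n := by exact_mod_cast Nat.pos_of_ne_zero (NeZero.ne n)

theorem pt_val (x : ℤ) : ((pt n x).val : ℤ) = x % n :=
  Int.toNat_of_nonneg (Int.emod_nonneg x (n_pos (n := n)).ne')

theorem pt_eq_iff {x y : ℤ} : pt n x = pt n y ↔ (n : ℤ) ∣ x - y := by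
  rw [Fin.ext_iff, ← Int.natCast_inj, pt_val, pt_val]
  constructor
  · intro h; exact (Int.emod_eq_emod_iff_emod_sub_eq_zero.1 h) |> Int.dvd_of_emod_eq_zero
  · intro h; exact Int.emod_eq_emod_iff_emod_sub_eq_zero.2 (Int.emod_eq_zero_of_dvd h)

theorem pt_add_mul (x t : ℤ) : pt n (x + t * n) = pt n x := pt_eq_iff.2 ⟨t, by ring⟩

theorem pt_add_n (x : ℤ) : pt n (x + n) = pt n x := pt_eq_iff.2 ⟨1, by ring⟩

@[simp] theorem pt_coe (i : Fin n) : pt n (i.val : ℤ) = i := by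
  rw [Fin.ext_iff, ← Int.natCast_inj, pt_val]
  exact Int.emod_eq_of_lt (by positivity) (by exact_mod_cast i.isLt)

theorem next_pt (x : ℤ) : next (pt n x) = pt n (x + 1) := by
  rw [Fin.ext_iff, ← Int.natCast_inj, pt_val]
  unfold next
  push_cast
  rw [pt_val, Int.emod_add_emod]

theorem eq_of_pt_eq {x y : ℤ} (h : pt n x = pt n y) (h1 : x < y + n) (h2 : y < x + n) : x = y := by
  obtain ⟨t, ht⟩ := pt_eq_iff.1 h
  have hn := n_pos (n := n)
  have h3 : t < 1 := by
    by_contra hc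
    nlinarith
  have h4 : -1 < t := by
    by_contra hc
    nlinarith
  have : t = 0 := by omega
  rw [this] at ht
  omega

theorem pt_injOn {x y : ℤ} (h : y < x + n) : Set.InjOn (pt n) (Finset.Icc x y) := by
  intro a ha b hb hab
  rw [Finset.mem_coe, mem_Icc] at ha hb
  exact eq_of_pt_eq hab (by omega) (by omega)

/-! ### Saturated arcs -/

/-- An arc is given by its first process and the number of its edges. -/
abbrev Arc := ℤ × ℕ

/-- The arcs that are considered. -/
noncomputable def cands (n D : ℕ) : Finset Arc := Ico (0 : ℤ) n ×ˢ Icc 1 (min D (n - 1))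

/-- The interval that is reserved around an arc. -/
def outer (I : Arc) : ℤ × ℤ := (I.1 - 4 * I.2, I.1 + 5 * I.2)

/-- The arc is saturated: every edge of the arc has been requested at least as often as the arc has
edges, and the initial placement is not nearly monochromatic on the arc. Then every static algorithm
pays a constant fraction of the length of the arc. -/
def Sat (q : ℕ) (F : Fin n → Fin ℓ) (u : Fin n → ℕ) (I : Arc) : Prop :=
  (∀ e, I.1 ≤ e → e < I.1 + I.2 → I.2 ≤ u (pt n e)) ∧
    ¬ ∃ a, NearMono q (fun x => F (pt n x)) I.1 (I.1 + I.2) a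

/-- The arc and its neighbourhood lie in the interval reserved for some arc of `L`. -/
def Covered (n : ℕ) (L : Finset Arc) (I : Arc) : Prop :=
  ∃ I₀ ∈ L, ∃ t : ℤ, (outer I₀).1 + t * n ≤ I.1 - I.2 ∧ I.1 + 2 * I.2 ≤ (outer I₀).2 + t * n

variable (D q : ℕ) (F : Fin n → Fin ℓ) (u : Fin n → ℕ)

/-- `L'` results from `L` by adding a saturated arc that is not covered yet. -/
def AddStep (L L' : Finset Arc) : Prop :=
  ∃ I ∈ cands n D, Sat q F u I ∧ ¬ Covered n L I ∧ L' = insert I L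

/-- All saturated arcs are covered. -/
def IsClosedFam (L : Finset Arc) : Prop := ∀ I ∈ cands n D, Sat q F u I → Covered n L I

variable {D q F u}

theorem mem_cands {I : Arc} :
    I ∈ cands n D ↔ (0 ≤ I.1 ∧ I.1 < n) ∧ 1 ≤ I.2 ∧ I.2 ≤ D ∧ I.2 < n := by
  have : n ≠ 0 := NeZero.ne n
  unfold cands
  rw [mem_product, mem_Ico, mem_Icc]
  omega

theorem Covered.mono {L L' : Finset Arc} (h : L ⊆ L') {I : Arc} (hI : Covered n L I) :
    Covered n L' I := by
  obtain ⟨I₀, h1, h2⟩ := hI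
  exact ⟨I₀, h h1, h2⟩

theorem covered_self {L : Finset Arc} {I : Arc} (hI : I ∈ L) : Covered n L I :=
  ⟨I, hI, 0, by simp only [outer]; omega, by simp only [outer]; omega⟩

/-- Saturated arcs can be added until all of them are covered; there are finitely many candidates. -/
theorem exists_closure (L : Finset Arc) :
    ∃ L', Relation.ReflTransGen (AddStep D q F u) L L' ∧ IsClosedFam D q F u L' := by
  induction hN : (cands n D \ L).card using Nat.strong_induction_on generalizing L with
  | _ N ih =>
  by_cases hc : IsClosedFam D q F u L
  · exact ⟨L, .refl, hc⟩
  · unfold IsClosedFam at hc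
    push Not at hc
    obtain ⟨I, hI, hs, hcov⟩ := hc
    have hIL : I ∉ L := fun h => hcov (covered_self h)
    have hlt : (cands n D \ insert I L).card < N := by
      rw [← hN]
      refine card_lt_card ⟨sdiff_subset_sdiff le_rfl (subset_insert _ _), fun h => ?_⟩
      have := h (mem_sdiff.2 ⟨hI, hIL⟩)
      simp at this
    obtain ⟨L', h1, h2⟩ := ih _ hlt (insert I L) rfl
    exact ⟨L', .head ⟨I, hI, hs, hcov, rfl⟩ h1, h2⟩

variable (D q F)

/-- The family of arcs after the given requests, the last request being listed first. -/
noncomputable def skelRev : List (Request n) → Finset Arc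
  | [] => ∅
  | r :: σ => (exists_closure (D := D) (q := q) (F := F) (u := fun i => (r :: σ).count i)
      (skelRev σ)).choose

/-- The family of arcs after the requests `σ`. -/
noncomputable def skel (σ : List (Request n)) : Finset Arc := skelRev D q F σ.reverse

theorem skel_nil : skel D q F [] = ∅ := rfl

theorem skel_step (σ : List (Request n)) (r : Request n) :
    Relation.ReflTransGen (AddStep D q F fun i => (σ ++ [r]).count i) (skel D q F σ)
      (skel D q F (σ ++ [r])) ∧
    IsClosedFam D q F (fun i => (σ ++ [r]).count i) (skel D q F (σ ++ [r])) := by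
  have h : (fun i => (σ ++ [r]).count i) = fun i => (r :: σ.reverse).count i := by
    funext i
    simp [List.count_append, List.count_cons]
  unfold skel
  rw [List.reverse_append, List.reverse_singleton, List.singleton_append, skelRev, h]
  exact (exists_closure (D := D) (q := q) (F := F) (u := fun i => (r :: σ.reverse).count i)
    (skelRev D q F σ.reverse)).choose_spec

/-- Arcs of about the same length are disjoint. -/
def Separated (n : ℕ) [NeZero n] (L : Finset Arc) : Prop :=
  ∀ I ∈ L, ∀ I' ∈ L, I ≠ I' → Nat.log 2 I.2 = Nat.log 2 I'.2 →
    ∀ x ∈ Icc I.1 (I.1 + I.2), ∀ y ∈ Icc I'.1 (I'.1 + I'.2), pt n x ≠ pt n y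

variable {D q F}

theorem lt_two_mul_of_log_eq {a b : ℕ} (hb : b ≠ 0) (h : Nat.log 2 a = Nat.log 2 b) :
    a < 2 * b := by
  have h1 := Nat.lt_pow_succ_log_self (b := 2) (by norm_num) a
  have h2 := Nat.pow_log_le_self 2 hb
  rw [h, pow_succ] at h1
  omega

theorem not_meet_of_not_covered {L : Finset Arc} {I I' : Arc} (hI : I ∈ L) (h0 : I.2 ≠ 0)
    (h0' : I'.2 ≠ 0) (hI' : ¬ Covered n L I') (hlog : Nat.log 2 I.2 = Nat.log 2 I'.2) {x y : ℤ}
    (hx : x ∈ Icc I.1 (I.1 + I.2)) (hy : y ∈ Icc I'.1 (I'.1 + I'.2)) : pt n x ≠ pt n y := by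
  intro h
  obtain ⟨t, ht⟩ := pt_eq_iff.1 h
  have h1 := lt_two_mul_of_log_eq h0' hlog
  have h2 := lt_two_mul_of_log_eq h0 hlog.symm
  rw [mem_Icc] at hx hy
  refine hI' ⟨I, hI, -t, ?_, ?_⟩ <;> simp only [outer] <;> nlinarith

theorem AddStep.subset {L L' : Finset Arc} (h : AddStep D q F u L L') : L ⊆ L' := by
  obtain ⟨I, _, _, _, rfl⟩ := h
  exact subset_insert _ _

theorem subset_of_addSteps {L L' : Finset Arc}
    (h : Relation.ReflTransGen (AddStep D q F u) L L') : L ⊆ L' := by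
  induction h with
  | refl => exact Subset.rfl
  | tail _ h2 ih => exact ih.trans h2.subset

theorem IsClosedFam.mono {L L' : Finset Arc} (hLL : L ⊆ L') (h : IsClosedFam D q F u L) :
    IsClosedFam D q F u L' := fun I hI hs => (h I hI hs).mono hLL

theorem Sat.mono {u' : Fin n → ℕ} (h : u ≤ u') {I : Arc} (hI : Sat q F u I) : Sat q F u' I :=
  ⟨fun e h1 h2 => (hI.1 e h1 h2).trans (h _), hI.2⟩

theorem count_le_append (σ : List (Request n)) (r : Request n) :
    (fun i => σ.count i) ≤ fun i => (σ ++ [r]).count i := fun i => by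
  simp [List.count_append]

/-- The invariants of the family of arcs. -/
theorem skel_invariant (σ : List (Request n)) :
    (∀ I ∈ skel D q F σ, I ∈ cands n D ∧ Sat q F (fun i => σ.count i) I) ∧
      Separated n (skel D q F σ) ∧ IsClosedFam D q F (fun i => σ.count i) (skel D q F σ) := by
  induction σ using List.reverseRecOn with
  | nil =>
    refine ⟨by simp [skel_nil], by simp [skel_nil, Separated], fun I hI hs => ?_⟩
    rw [mem_cands] at hI
    have := hs.1 I.1 le_rfl (by omega)
    simp at this
    omega
  | append_singleton σ r ih =>
    obtain ⟨h1, h2⟩ := skel_step D q F σ r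
    refine ⟨?_, ?_, h2⟩
    · have h0 : ∀ I ∈ skel D q F σ, I ∈ cands n D ∧ Sat q F (fun i => (σ ++ [r]).count i) I :=
        fun I hI => ⟨(ih.1 I hI).1, (ih.1 I hI).2.mono (count_le_append σ r)⟩
      clear h2
      generalize skel D q F (σ ++ [r]) = L at h1
      induction h1 with
      | refl => exact h0
      | tail _ h ih' =>
        obtain ⟨I', hI', hs, _, rfl⟩ := h
        intro I hI
        rcases mem_insert.1 hI with rfl | hI
        · exact ⟨hI', hs⟩
        · exact ih' I hI
    · have h0 : (∀ I ∈ skel D q F σ, I ∈ cands n D) ∧ Separated n (skel D q F σ) :=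
        ⟨fun I hI => (ih.1 I hI).1, ih.2.1⟩
      clear h2
      suffices h : (∀ I ∈ skel D q F (σ ++ [r]), I ∈ cands n D) ∧
        Separated n (skel D q F (σ ++ [r])) from h.2
      generalize skel D q F (σ ++ [r]) = L at h1
      induction h1 with
      | refl => exact h0
      | tail _ h ih' =>
        obtain ⟨I', hI', hs, hcov, rfl⟩ := h
        have hc := ih'.1
        refine ⟨fun I hI => ?_, fun I hI J hJ hne hlog x hx y hy => ?_⟩
        · rcases mem_insert.1 hI with rfl | hI
          · exact hI'
          · exact hc I hI
        · rw [mem_cands] at hI'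
          rcases mem_insert.1 hI with rfl | hI₁ <;> rcases mem_insert.1 hJ with rfl | hJ₁
          · exact absurd rfl hne
          · have := mem_cands.1 (hc J hJ₁)
            exact (not_meet_of_not_covered hJ₁ (by omega) (by omega) hcov hlog.symm hy hx).symm
          · have := mem_cands.1 (hc I hI₁)
            exact not_meet_of_not_covered hI₁ (by omega) (by omega) hcov hlog hx hy
          · exact ih'.2 I hI₁ J hJ₁ hne hlog x hx y hy

/-! ### The cost of static algorithms -/

/-- The part of the cost of a static algorithm that is due to process `i` and the edge behind it. -/
def procCost (init c : Placement n ℓ) (u : Fin n → ℕ) (i : Fin n) : ℕ :=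
  (if init i ≠ c i then 1 else 0) + u i * commCost c i

theorem staticCost_eq (init c : Placement n ℓ) (σ : List (Request n)) :
    staticCost init c σ = ∑ i, procCost init c (fun i => σ.count i) i := by
  unfold staticCost procCost migrationCost
  rw [sum_add_distrib, card_filter]
  congr 1
  rw [Finset.sum_list_map_count]
  refine (sum_subset (subset_univ _) fun i _ hi => ?_).trans (sum_congr rfl fun i _ => ?_)
  · rw [List.mem_toFinset] at hi
    rw [List.count_eq_zero_of_not_mem hi, zero_smul]
  · rw [smul_eq_mul]

/-- A static algorithm pays for every saturated arc. -/
theorem Sat.le_sum {init c : Placement n ℓ} {I : Arc} (hq : 1 ≤ q) (h : Sat q init u I) :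
    I.2 ≤ q * ∑ x ∈ Icc I.1 (I.1 + I.2), procCost init c u (pt n x) := by
  obtain ⟨h1, h2⟩ := h
  by_cases hcut : ∃ e, I.1 ≤ e ∧ e < I.1 + I.2 ∧ c (pt n e) ≠ c (pt n (e + 1))
  · obtain ⟨e, he1, he2, hne⟩ := hcut
    have h3 : I.2 ≤ procCost init c u (pt n e) := by
      unfold procCost commCost
      rw [next_pt, if_neg hne, mul_one]
      exact (h1 e he1 he2).trans (Nat.le_add_left _ _)
    calc I.2 ≤ procCost init c u (pt n e) := h3
      _ ≤ ∑ x ∈ Icc I.1 (I.1 + I.2), procCost init c u (pt n x) :=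
        single_le_sum (f := fun x => procCost init c u (pt n x)) (fun _ _ => Nat.zero_le _)
          (mem_Icc.2 ⟨he1, he2.le⟩)
      _ ≤ _ := Nat.le_mul_of_pos_left _ (by omega)
  · push Not at hcut
    have hconst : ∀ x, I.1 ≤ x → x ≤ I.1 + I.2 → c (pt n x) = c (pt n I.1) := by
      intro x hx
      induction x, hx using Int.leInduction with
      | base => exact fun _ => rfl
      | succ x hx ih =>
        intro hx'
        rw [← hcut x hx (by omega), ih (by omega)]
    have h3 : ¬ NearMono q (fun x => init (pt n x)) I.1 (I.1 + I.2) (c (pt n I.1)) :=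
      fun h => h2 ⟨_, h⟩
    unfold NearMono at h3
    rw [Int.card_Icc, not_le] at h3
    beta_reduce at h3
    have h4 : ((Icc I.1 (I.1 + (I.2 : ℤ))).filter fun x => init (pt n x) ≠ c (pt n I.1)).card ≤
        ∑ x ∈ Icc I.1 (I.1 + (I.2 : ℤ)), procCost init c u (pt n x) := by
      rw [card_filter]
      refine sum_le_sum fun x hx => ?_
      rw [mem_Icc] at hx
      unfold procCost
      rw [hconst x hx.1 hx.2]
      exact Nat.le_add_right _ _
    have := Nat.mul_le_mul_left q h4
    omega

/-- The total length of the arcs is bounded by the cost of any static algorithm: it pays for every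
arc, and for every order of magnitude the arcs are disjoint. -/
theorem sum_skel_le {init : Placement n ℓ} (hq : 1 ≤ q) (c : Placement n ℓ)
    (σ : List (Request n)) :
    ∑ I ∈ skel D q init σ, I.2 ≤ q * (Nat.log 2 D + 1) * staticCost init c σ := by
  obtain ⟨h1, h2, _⟩ := skel_invariant (D := D) (q := q) (F := init) σ
  set L := skel D q init σ with hL
  set u : Fin n → ℕ := fun i => σ.count i with hu
  have hmaps : ∀ I ∈ L, Nat.log 2 I.2 ∈ range (Nat.log 2 D + 1) := by
    intro I hI
    have := mem_cands.1 (h1 I hI).1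
    rw [mem_range, Nat.lt_succ_iff]
    exact Nat.log_mono_right this.2.2.1
  rw [← sum_fiberwise_of_maps_to hmaps]
  have hclass : ∀ j, ∑ I ∈ L.filter (fun I => Nat.log 2 I.2 = j), I.2 ≤
      q * staticCost init c σ := by
    intro j
    calc ∑ I ∈ L.filter (fun I => Nat.log 2 I.2 = j), I.2
        ≤ ∑ I ∈ L.filter (fun I => Nat.log 2 I.2 = j),
          q * ∑ i ∈ (Icc I.1 (I.1 + (I.2 : ℤ))).image (pt n), procCost init c u i := by
          refine sum_le_sum fun I hI => ?_
          have hI' := h1 I (mem_filter.1 hI).1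
          have hc := mem_cands.1 hI'.1
          rw [sum_image (pt_injOn (by omega))]
          exact hI'.2.le_sum hq
      _ = q * ∑ i ∈ (L.filter (fun I => Nat.log 2 I.2 = j)).biUnion
            (fun I => (Icc I.1 (I.1 + (I.2 : ℤ))).image (pt n)), procCost init c u i := by
          rw [← mul_sum, sum_biUnion]
          intro I hI J hJ hne
          rw [mem_coe, mem_filter] at hI hJ
          refine disjoint_left.2 fun i hi hi' => ?_
          obtain ⟨x, hx, rfl⟩ := mem_image.1 hi
          obtain ⟨y, hy, hxy⟩ := mem_image.1 hi'
          exact h2 I hI.1 J hJ.1 hne (hI.2.trans hJ.2.symm) x hx y hy hxy.symm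
      _ ≤ q * staticCost init c σ := by
          rw [staticCost_eq]
          exact Nat.mul_le_mul_left _ (sum_le_sum_of_subset (subset_univ _))
  calc _ ≤ ∑ _j ∈ range (Nat.log 2 D + 1), q * staticCost init c σ :=
        sum_le_sum fun j _ => hclass j
    _ = _ := by rw [sum_const, card_range, smul_eq_mul]; ring

/-- The edges in the intervals that are reserved for the arcs of `L`. -/
noncomputable def cov (n : ℕ) [NeZero n] (L : Finset Arc) : Finset (Fin n) :=
  L.biUnion fun I => (Ico (outer I).1 (outer I).2).image (pt n)

theorem cov_mono {L L' : Finset Arc} (h : L ⊆ L') : cov n L ⊆ cov n L' :=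
  biUnion_subset_biUnion_of_subset_left _ h

theorem mem_cov {L : Finset Arc} {i : Fin n} :
    i ∈ cov n L ↔ ∃ I ∈ L, ∃ e, (outer I).1 ≤ e ∧ e < (outer I).2 ∧ pt n e = i := by
  simp only [cov, mem_biUnion, mem_image, mem_Ico, and_assoc]

theorem card_cov_le (L : Finset Arc) : (cov n L).card ≤ 9 * ∑ I ∈ L, I.2 := by
  rw [mul_sum]
  refine card_biUnion_le.trans (sum_le_sum fun I _ => card_image_le.trans ?_)
  rw [Int.card_Ico]
  simp only [outer]
  omega

/-- The cost of the static algorithm in a window that is too long for a single server. -/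
theorem exists_cut_of_feasible {k : ℕ} {c : Placement n ℓ} (hc : Feasible k c) (hk : k < n)
    (x : ℤ) : ∃ i < k, c (pt n (x + i)) ≠ c (pt n (x + i + 1)) := by
  by_contra hcon
  push Not at hcon
  have hconst : ∀ i ≤ k, c (pt n (x + i)) = c (pt n x) := by
    intro i
    induction i with
    | zero => intro _; simp
    | succ i ih =>
      intro hi
      rw [← ih (by omega), hcon i (by omega)]
      push_cast
      congr 2; ring
  have h1 : ((Icc x (x + k)).image (pt n)).card ≤ load c (c (pt n x)) := by
    refine card_le_card fun i hi => ?_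
    obtain ⟨y, hy, rfl⟩ := mem_image.1 hi
    rw [mem_Icc] at hy
    refine mem_filter.2 ⟨mem_univ _, ?_⟩
    have := hconst (y - x).toNat (by omega)
    rwa [show x + ((y - x).toNat : ℤ) = y by omega] at this
  rw [card_image_of_injOn (pt_injOn (by omega)), Int.card_Icc] at h1
  have := hc (c (pt n x))
  omega

end

/-! ### The number of colour changes -/

namespace Setting

variable {ι : Type*} [DecidableEq ι] {S : Setting ι} {w w' : ℤ → ℕ} {𝒥 𝓛 : Finset (ℤ × ℤ)}

/-- The number of points over which the left cut of `M` may jump when the requests `w` become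
`w'`. -/
noncomputable def mvL (S : Setting ι) (w w' : ℤ → ℕ) (M : ℤ × ℤ) : ℕ :=
  if S.XL w M = S.XL w' M then 0 else (max (S.XL w M) (S.XL w' M) - M.1).toNat

/-- The number of points over which the right cut of `M` may jump when the requests `w` become
`w'`. -/
noncomputable def mvR (S : Setting ι) (w w' : ℤ → ℕ) (M : ℤ × ℤ) : ℕ :=
  if S.XR w M = S.XR w' M then 0 else (M.2 - 1 - min (S.XR w M) (S.XR w' M)).toNat

namespace Live

/-- The number of colour changes that are caused by moving cuts. -/
theorem card_col_congr (hL : S.Live w 𝒥 𝓛) (hL' : S.Live w' 𝒥 𝓛) (hw : w ≤ w') :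
    ((Ioc S.A S.B).filter fun p => S.col w 𝓛 p ≠ S.col w' 𝓛 p).card ≤
      ∑ M ∈ 𝓛, (S.mvL w w' M + S.mvR w w' M) := by
  have hsub : ((Ioc S.A S.B).filter fun p => S.col w 𝓛 p ≠ S.col w' 𝓛 p) ⊆
      𝓛.biUnion fun M =>
        (if S.XL w M = S.XL w' M then ∅ else Ioc M.1 (max (S.XL w M) (S.XL w' M))) ∪
        (if S.XR w M = S.XR w' M then ∅ else Ioo (min (S.XR w M) (S.XR w' M)) M.2) := by
    intro p hp
    obtain ⟨hp1, hp2⟩ := mem_filter.1 hp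
    rw [mem_Ioc] at hp1
    by_contra hc
    simp only [mem_biUnion, mem_union, not_exists, not_and, not_or] at hc
    refine hp2 (hL.col_congr hL' hw hp1.1 hp1.2 (fun M hM hne => ?_) fun M hM hne => ?_)
    · have h := (hc M hM).1
      rw [if_neg hne, mem_Ioc] at h
      omega
    · have h := (hc M hM).2
      rw [if_neg hne, mem_Ioo] at h
      omega
  refine (card_le_card hsub).trans (card_biUnion_le.trans (sum_le_sum fun M _ => ?_))
  refine (card_union_le _ _).trans (add_le_add ?_ ?_)
  · unfold mvL
    split_ifs
    · simp
    · rw [Int.card_Ioc]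
  · unfold mvR
    split_ifs
    · simp
    · rw [Int.card_Ioo]
      omega

/-- The number of colour changes when dead intervals are dropped. -/
theorem sdiff (hL : S.Live w 𝒥 𝓛) {T : Finset (ℤ × ℤ)} (hT : T ⊆ 𝓛) (hd : ∀ M ∈ T, S.Dead w M) :
    S.Live w 𝒥 (𝓛 \ T) ∧
    ((Ioc S.A S.B).filter fun p => S.col w 𝓛 p ≠ S.col w (𝓛 \ T) p).card ≤
      ∑ M ∈ T, (width M - 1) := by
  induction T using Finset.induction_on with
  | empty => simpa using hL
  | insert M T hM ih =>
    obtain ⟨h1, h2⟩ := ih ((subset_insert _ _).trans hT) fun N hN => hd N (mem_insert_of_mem hN)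
    have hMd := hd M (mem_insert_self _ _)
    have hM𝓛 : M ∈ 𝓛 \ T := mem_sdiff.2 ⟨hT (mem_insert_self _ _), hM⟩
    have e : 𝓛 \ insert M T = (𝓛 \ T).erase M := by
      ext N; simp only [mem_sdiff, mem_insert, mem_erase]; tauto
    rw [e]
    refine ⟨h1.erase hMd, ?_⟩
    rw [sum_insert hM, add_comm]
    have hIoo : (Ioo M.1 M.2).card = width M - 1 := by
      rw [Int.card_Ioo]; unfold width; omega
    rw [← hIoo]
    refine le_trans (card_le_card fun p hp => ?_) ((card_union_le _ _).trans (add_le_add h2 le_rfl))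
    obtain ⟨hp1, hp2⟩ := mem_filter.1 hp
    rw [mem_union, mem_filter, mem_Ioo]
    by_contra hc
    rw [not_or, not_and_not_right] at hc
    have h3 := hc.1 hp1
    rw [mem_Ioc] at hp1
    refine hp2 (h3.trans (h1.col_erase hM𝓛 hMd hp1.1 hp1.2 ?_))
    omega

end Live

end Setting

/-! ### The window of the ring that starts behind a base edge -/

section
variable {n ℓ : ℕ} [NeZero n]

/-- The path that results from cutting the ring at the edge `θ`. -/
def ringSetting (q D : ℕ) (F : Placement n ℓ) (θ : Fin n) (π : Equiv.Perm (Fin n)) :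
    Setting (Fin ℓ) where
  q := q
  D := D
  A := θ.val
  B := θ.val + n
  F := fun x => F (pt n x)
  ρ := fun e => (π (pt n e)).val

/-- The numbers of requests on the path that results from cutting the ring at the edge `θ`. -/
def wAt (θ : Fin n) (u : Fin n → ℕ) (e : ℤ) : ℕ :=
  if (θ.val : ℤ) < e ∧ e < θ.val + n then u (pt n e) else 0

/-- The left end of the interval reserved for the arc `I`, on the path behind the edge `θ`. -/
def liftFst (θ : Fin n) (I : Arc) : ℤ := θ.val + 1 + ((outer I).1 - (θ.val + 1)) % n

/-- The interval reserved for the arc `I`, on the path behind the edge `θ`. -/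
def lift (θ : Fin n) (I : Arc) : ℤ × ℤ := (liftFst θ I, liftFst θ I + 9 * I.2)

/-- The family of intervals on the path: the reserved intervals, the edges at which the initial
colour changes, and the two end edges. -/
noncomputable def fam (F : Placement n ℓ) (θ : Fin n) (L : Finset Arc) : Finset (ℤ × ℤ) :=
  insert ((θ.val : ℤ), (θ.val : ℤ) + 1) (insert ((θ.val : ℤ) + n, (θ.val : ℤ) + n + 1)
    (((Ioo (θ.val : ℤ) (θ.val + n)).filter fun e => F (pt n e) ≠ F (pt n (e + 1))).image
      (fun e => (e, e + 1)) ∪ L.image (lift θ)))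

variable {q D k : ℕ} {F : Placement n ℓ} {θ : Fin n} {π : Equiv.Perm (Fin n)} {u u' : Fin n → ℕ}
  {L L' : Finset Arc} {I : Arc}

theorem mem_fam {J : ℤ × ℤ} : J ∈ fam F θ L ↔ J = ((θ.val : ℤ), (θ.val : ℤ) + 1) ∨
    J = ((θ.val : ℤ) + n, (θ.val : ℤ) + n + 1) ∨
    (((θ.val : ℤ) < J.1 ∧ J.1 < θ.val + n) ∧ F (pt n J.1) ≠ F (pt n (J.1 + 1)) ∧
      J.2 = J.1 + 1) ∨ ∃ I ∈ L, J = lift θ I := by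
  unfold fam
  simp only [mem_insert, mem_union, mem_image, mem_filter, mem_Ioo]
  refine or_congr Iff.rfl (or_congr Iff.rfl (or_congr ⟨?_, ?_⟩ ⟨?_, ?_⟩))
  · rintro ⟨e, ⟨h1, h2⟩, rfl⟩; exact ⟨h1, h2, rfl⟩
  · rintro ⟨h1, h2, h3⟩; exact ⟨J.1, ⟨h1, h2⟩, Prod.ext rfl h3.symm⟩
  · rintro ⟨I, hI, rfl⟩; exact ⟨I, hI, rfl⟩
  · rintro ⟨I, hI, rfl⟩; exact ⟨I, hI, rfl⟩

theorem fam_insert : fam F θ (insert I L) = insert (lift θ I) (fam F θ L) := by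
  ext J
  rw [mem_insert, mem_fam, mem_fam]
  constructor
  · rintro (h | h | h | ⟨I', hI', h⟩)
    · exact Or.inr (Or.inl h)
    · exact Or.inr (Or.inr (Or.inl h))
    · exact Or.inr (Or.inr (Or.inr (Or.inl h)))
    · rcases mem_insert.1 hI' with rfl | hI'
      · exact Or.inl h
      · exact Or.inr (Or.inr (Or.inr (Or.inr ⟨I', hI', h⟩)))
  · rintro (h | h | h | h | ⟨I', hI', h⟩)
    · exact Or.inr (Or.inr (Or.inr ⟨I, mem_insert_self _ _, h⟩))
    · exact Or.inl h
    · exact Or.inr (Or.inl h)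
    · exact Or.inr (Or.inr (Or.inl h))
    · exact Or.inr (Or.inr (Or.inr ⟨I', mem_insert_of_mem hI', h⟩))

theorem width_lift : width (lift θ I) = 9 * I.2 := by
  unfold width lift; simp only; omega

theorem notMem_edges (hθ : θ ∉ cov n L) (hI : I ∈ L) (t s : ℤ) :
    ¬ ((outer I).1 + t * n ≤ θ.val + s * n ∧ θ.val + s * n < (outer I).2 + t * n) := by
  rintro ⟨h1, h2⟩
  refine hθ (mem_cov.2 ⟨I, hI, θ.val + (s - t) * n, ?_, ?_, ?_⟩)
  · rw [sub_mul]; omega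
  · rw [sub_mul]; omega
  · rw [pt_add_mul, pt_coe]

/-- As `θ` is not covered, the interval reserved for an arc of the family does not wrap around on the
path behind `θ`. -/
theorem lift_spec (hθ : θ ∉ cov n L) (hI : I ∈ L) :
    (θ.val : ℤ) + 1 ≤ (lift θ I).1 ∧ (lift θ I).2 ≤ θ.val + n ∧
      ∃ t : ℤ, (lift θ I).1 = (outer I).1 + t * n ∧ (lift θ I).2 = (outer I).2 + t * n := by
  have hn := n_pos (n := n)
  have h1 := Int.emod_nonneg ((outer I).1 - (θ.val + 1)) hn.ne'
  have h2 := Int.emod_lt_of_pos ((outer I).1 - (θ.val + 1)) hn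
  have h3 := Int.emod_add_mul_ediv ((outer I).1 - (θ.val + 1)) n
  set t := -(((outer I).1 - (θ.val + 1)) / (n : ℤ)) with ht
  have e1 : (lift θ I).1 = (outer I).1 + t * n := by
    simp only [lift, liftFst]
    rw [ht, neg_mul, mul_comm]; omega
  have e2 : (lift θ I).2 = (outer I).2 + t * n := by
    have : (lift θ I).2 = (lift θ I).1 + 9 * I.2 := rfl
    rw [this, e1]; simp only [outer]; ring
  have h4 : (θ.val : ℤ) + 1 ≤ (lift θ I).1 := by simp only [lift, liftFst]; omega
  have h5 : (lift θ I).1 ≤ θ.val + n := by simp only [lift, liftFst]; omega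
  refine ⟨h4, ?_, t, e1, e2⟩
  by_contra hc
  refine notMem_edges hθ hI t 1 ⟨?_, ?_⟩ <;> omega

/-- A translate of a reserved interval that meets the path is its lift. -/
theorem lift_eq (hθ : θ ∉ cov n L) (hI : I ∈ L) (h0 : 1 ≤ I.2) {t e : ℤ}
    (h1 : (outer I).1 + t * n ≤ e) (h2 : e < (outer I).2 + t * n) (h3 : (θ.val : ℤ) < e)
    (h4 : e ≤ θ.val + n) : lift θ I = ((outer I).1 + t * n, (outer I).2 + t * n) := by
  obtain ⟨h5, h6, s, e1, e2⟩ := lift_spec hθ hI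
  have h7 : (θ.val : ℤ) < (outer I).1 + t * n := by
    by_contra hc
    exact notMem_edges hθ hI t 0 ⟨by omega, by omega⟩
  have hs : s = t := by
    have hlt : (lift θ I).1 < (lift θ I).2 := by simp only [lift]; omega
    by_contra hne
    rcases lt_or_gt_of_ne hne with h | h
    · have : (s + 1) * (n : ℤ) ≤ t * n := mul_le_mul_of_nonneg_right h (by positivity)
      rw [add_mul] at this; omega
    · have : (t + 1) * (n : ℤ) ≤ s * n := mul_le_mul_of_nonneg_right h (by positivity)
      rw [add_mul] at this; omega
  rw [← hs]
  exact Prod.ext e1 e2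

/-- An interval of the family that contains the interval reserved for `I` covers `I`. -/
theorem covered_of_lift_subset (hθ : θ ∉ cov n (insert I L)) (h0 : ∀ I' ∈ insert I L, 1 ≤ I'.2)
    {J : ℤ × ℤ} (hJ : J ∈ fam F θ L) (h1 : J.1 ≤ (lift θ I).1) (h2 : (lift θ I).2 ≤ J.2) :
    Covered n L I := by
  have hI := h0 I (mem_insert_self _ _)
  obtain ⟨h3, h4, t, e1, e2⟩ := lift_spec hθ (mem_insert_self _ _)
  have hw : (lift θ I).2 = (lift θ I).1 + 9 * I.2 := rfl
  rcases mem_fam.1 hJ with h | h | ⟨_, _, h⟩ | ⟨I', hI', h⟩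
  · rw [h] at h2; simp only at h2; omega
  · rw [h] at h1; simp only at h1; omega
  · omega
  · obtain ⟨_, _, t', e1', e2'⟩ := lift_spec hθ (mem_insert_of_mem hI')
    rw [h] at h1 h2
    refine ⟨I', hI', t' - t, ?_, ?_⟩
    · rw [sub_mul]; simp only [outer] at *; omega
    · rw [sub_mul]; simp only [outer] at *; omega

theorem nearMono_shift {x y : ℤ} (t : ℤ) {a : Fin ℓ} :
    NearMono q (fun z => F (pt n z)) (x + t * n) (y + t * n) a ↔
      NearMono q (fun z => F (pt n z)) x y a := by
  have h : Icc (x + t * n) (y + t * n) = (Icc x y).image (fun z => z + t * n) := by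
    rw [Finset.image_add_right_Icc]
  unfold NearMono
  rw [h, filter_image, card_image_of_injective _ (add_left_injective _),
    card_image_of_injective _ (add_left_injective _)]
  simp only [pt_add_mul]

theorem card_filter_le_load (x y : ℤ) (h : y < x + n) (a : Fin ℓ) :
    ((Icc x y).filter fun z => F (pt n z) = a).card ≤ load F a := by
  rw [load, ← card_image_of_injOn ((pt_injOn h).mono (coe_subset.2 (filter_subset _ _)))]
  refine card_le_card fun i hi => ?_
  obtain ⟨z, hz, rfl⟩ := mem_image.1 hi
  exact mem_filter.2 ⟨mem_univ _, (mem_filter.1 hz).2⟩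

/-- The family of intervals on the path has the required properties. -/
theorem valid_fam (hq : 4 ≤ q) (hk : 1 ≤ k) (hD : D + 1 = 2 * k) (hF : Feasible k F)
    (hL : ∀ I ∈ L, 1 ≤ I.2) (hcl : IsClosedFam D q F u L) (hθ : θ ∉ cov n L) :
    (ringSetting q D F θ π).Valid (wAt θ u) (fam F θ L) := by
  have hn := n_pos (n := n)
  refine ⟨hq, by change 1 ≤ D; omega, ?_, mem_fam.2 (Or.inl rfl), mem_fam.2 (Or.inr (Or.inl rfl)),
    by change (θ.val : ℤ) < θ.val + n; omega, ?_, ?_, ?_, ?_, ?_, ?_⟩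
  · intro J hJ
    rcases mem_fam.1 hJ with h | h | ⟨_, _, h⟩ | ⟨I', hI', h⟩
    · rw [h]; simp
    · rw [h]; simp
    · omega
    · have := hL I' hI'
      rw [h]; simp only [lift]; omega
  · intro J hJ
    rcases mem_fam.1 hJ with h | h | ⟨h1, _, h⟩ | ⟨I', hI', h⟩
    · exact Or.inl h
    · exact Or.inr (Or.inl h)
    · right; right
      change (θ.val : ℤ) + 1 ≤ _ ∧ _ ≤ (θ.val : ℤ) + n
      omega
    · obtain ⟨h1, h2, _⟩ := lift_spec hθ hI'
      rw [h]
      exact Or.inr (Or.inr ⟨h1, h2⟩)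
  · change wAt θ u θ.val = 0
    unfold wAt; simp
  · change wAt θ u (θ.val + n) = 0
    unfold wAt; simp
  · intro e h1 h2 h3
    exact ⟨(e, e + 1), mem_fam.2 (Or.inr (Or.inr (Or.inl ⟨⟨h1, h2⟩, h3, rfl⟩))), le_rfl,
      lt_add_one e⟩
  · intro x y hx hxy hy hyD hheavy hmono
    change (θ.val : ℤ) + 1 ≤ x at hx
    change y ≤ (θ.val : ℤ) + n at hy
    change y - x ≤ (D : ℤ) at hyD
    have h3 := Int.emod_add_mul_ediv x n
    have h1 := Int.emod_nonneg x hn.ne'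
    have h2 := Int.emod_lt_of_pos x hn
    set s := x / (n : ℤ) with hs
    have hsat : Sat q F u (x % n, (y - x).toNat) := by
      refine ⟨fun e he he' => ?_, fun ⟨a, ha⟩ => hmono ⟨a, ?_⟩⟩
      · simp only at he he' ⊢
        have := hheavy (e + s * n) (by rw [mul_comm]; omega) (by rw [mul_comm]; omega)
        unfold wAt at this
        rw [if_pos (by rw [mul_comm]; omega), pt_add_mul] at this
        omega
      · rw [← nearMono_shift s] at ha
        have e1 : (x % n : ℤ) + s * n = x := by rw [mul_comm]; omega
        have e2 : (x % n : ℤ) + ((y - x).toNat : ℤ) + s * n = y := by rw [mul_comm]; omega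
        simp only [e1, e2] at ha
        exact ha
    obtain ⟨I₀, hI₀, t, h4, h5⟩ := hcl (x % n, (y - x).toNat)
      (mem_cands.2 ⟨⟨h1, h2⟩, by simp only; omega, by simp only; omega, by simp only; omega⟩) hsat
    simp only at h4 h5
    have hs' : s * (n : ℤ) = n * s := mul_comm _ _
    have e := lift_eq hθ hI₀ (hL I₀ hI₀) (t := t + s) (e := x) (by rw [add_mul]; omega)
      (by rw [add_mul]; omega) (by omega) (by omega)
    refine ⟨lift θ I₀, mem_fam.2 (Or.inr (Or.inr (Or.inr ⟨I₀, hI₀, rfl⟩))), ?_, ?_⟩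
    · rw [e]; simp only [add_mul]; omega
    · rw [e]; simp only [add_mul]; omega
  · rintro x hx hxB ⟨a, ha⟩
    change (θ.val : ℤ) + 1 ≤ x at hx
    change x + (D : ℤ) ≤ (θ.val : ℤ) + n at hxB
    unfold NearMono at ha
    change q * ((Icc x (x + (D : ℤ))).filter fun p => F (pt n p) ≠ a).card ≤
      (Icc x (x + (D : ℤ))).card at ha
    have h1 := card_filter_le_load (F := F) x (x + D) (by omega) a
    have h2 := hF a
    have h3 : ((Icc x (x + (D : ℤ))).filter fun p => F (pt n p) = a).card +
      ((Icc x (x + (D : ℤ))).filter fun p => F (pt n p) ≠ a).card =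
        (Icc x (x + (D : ℤ))).card := card_filter_add_card_filter_not _
    have h4 : (Icc x (x + (D : ℤ))).card = 2 * k := by rw [Int.card_Icc]; omega
    rw [h4] at ha h3
    have h5 : k ≤ ((Icc x (x + (D : ℤ))).filter fun p => F (pt n p) ≠ a).card := by omega
    have := Nat.mul_le_mul hq h5
    omega

/-- Every edge of the interval reserved for the arc has been requested very often, and the interval
is short. -/
def RDead (D : ℕ) (u : Fin n → ℕ) (I : Arc) : Prop :=
  9 * I.2 ≤ D ∧ ∀ e, (outer I).1 ≤ e → e < (outer I).2 → 9 * I.2 ≤ u (pt n e)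

theorem wAt_mono (h : u ≤ u') : wAt θ u ≤ wAt θ u' := fun e => by
  unfold wAt; split_ifs
  · exact h _
  · exact le_rfl

theorem wAt_lift (hθ : θ ∉ cov n L) (hI : I ∈ L) {e : ℤ} (h1 : (lift θ I).1 ≤ e)
    (h2 : e < (lift θ I).2) : wAt θ u e = u (pt n (e - (lift θ I).1 + (outer I).1)) := by
  obtain ⟨h3, h4, t, e1, e2⟩ := lift_spec hθ hI
  unfold wAt
  rw [if_pos (by omega)]
  congr 1
  rw [e1, pt_eq_iff]
  exact ⟨t, by ring⟩

theorem dead_lift_iff (hθ : θ ∉ cov n L) (hI : I ∈ L) :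
    (ringSetting q D F θ π).Dead (wAt θ u) (lift θ I) ↔ RDead D u I := by
  unfold Setting.Dead RDead
  rw [width_lift]
  refine and_congr Iff.rfl ⟨fun h e h1 h2 => ?_, fun h e h1 h2 => ?_⟩
  · have e0 : (lift θ I).2 = (lift θ I).1 + 9 * I.2 := rfl
    have h3 : (lift θ I).1 ≤ e - (outer I).1 + (lift θ I).1 := by omega
    have h4 : e - (outer I).1 + (lift θ I).1 < (lift θ I).2 := by
      rw [e0]; simp only [outer] at *; omega
    have := h _ h3 h4
    rw [wAt_lift hθ hI h3 h4] at this
    rwa [show e - (outer I).1 + (lift θ I).1 - (lift θ I).1 + (outer I).1 = e by ring] at this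
  · rw [wAt_lift hθ hI h1 h2]
    have e0 : (lift θ I).2 = (lift θ I).1 + 9 * I.2 := rfl
    exact h _ (by omega) (by rw [e0] at h2; simp only [outer] at *; omega)

theorem RDead.mono (h : u ≤ u') (hI : RDead D u I) : RDead D u' I :=
  ⟨hI.1, fun e h1 h2 => (hI.2 e h1 h2).trans (h _)⟩

/-- The intervals of the family that are maximal and not dead. -/
noncomputable def liveSet (q D : ℕ) (F : Placement n ℓ) (θ : Fin n) (π : Equiv.Perm (Fin n))
    (u : Fin n → ℕ) (L : Finset Arc) : Finset (ℤ × ℤ) :=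
  open Classical in
  (maxl (fam F θ L)).filter fun M => ¬ (ringSetting q D F θ π).Dead (wAt θ u) M

theorem mem_liveSet {M : ℤ × ℤ} : M ∈ liveSet q D F θ π u L ↔
    M ∈ maxl (fam F θ L) ∧ ¬ (ringSetting q D F θ π).Dead (wAt θ u) M := by
  classical
  unfold liveSet
  rw [mem_filter]

theorem live_liveSet (hV : (ringSetting q D F θ π).Valid (wAt θ u) (fam F θ L)) :
    (ringSetting q D F θ π).Live (wAt θ u) (fam F θ L) (liveSet q D F θ π u L) where
  toValid := hV
  sub := fun _ hM => (mem_liveSet.1 hM).1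
  dead := fun M hM h => by
    by_contra hc
    exact h (mem_liveSet.2 ⟨hM, hc⟩)

/-- Intervals of the family have width one, or they are reserved for arcs. -/
theorem sum_fam_le {𝓛 : Finset (ℤ × ℤ)} (h𝓛 : 𝓛 ⊆ fam F θ L) {f : ℤ × ℤ → ℕ}
    (hf : ∀ M : ℤ × ℤ, M.2 = M.1 + 1 → f M = 0) : ∑ M ∈ 𝓛, f M ≤ ∑ I ∈ L, f (lift θ I) := by
  calc ∑ M ∈ 𝓛, f M ≤ ∑ M ∈ L.image (lift θ), f M := by
        refine sum_le_sum_of_ne_zero fun M hM h0 => ?_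
        rcases mem_fam.1 (h𝓛 hM) with h | h | ⟨_, _, h⟩ | ⟨I, hI, h⟩
        · exact absurd (hf M (by rw [h])) h0
        · exact absurd (hf M (by rw [h])) h0
        · exact absurd (hf M h) h0
        · exact mem_image.2 ⟨I, hI, h.symm⟩
    _ ≤ ∑ I ∈ L, f (lift θ I) := sum_image_le_of_nonneg fun _ _ => Nat.zero_le _

/-- The colour changes that are caused by the creation of intervals. -/
theorem exists_live_of_addSteps (hq : 4 ≤ q) (hk : 1 ≤ k) (hD : D + 1 = 2 * k)
    (hF : Feasible k F) {𝓛 : Finset (ℤ × ℤ)}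
    (hL : (ringSetting q D F θ π).Live (wAt θ u) (fam F θ L) 𝓛)
    (h0 : ∀ I ∈ L, 1 ≤ I.2) (hcl : IsClosedFam D q F u L)
    (hsteps : Relation.ReflTransGen (AddStep D q F u') L L') (hθ : θ ∉ cov n L') :
    ∃ 𝓛', (ringSetting q D F θ π).Live (wAt θ u) (fam F θ L') 𝓛' ∧ (∀ I ∈ L', 1 ≤ I.2) ∧
      (∀ I ∈ L, lift θ I ∈ 𝓛' → lift θ I ∈ 𝓛) ∧
      ((Ioc (θ.val : ℤ) (θ.val + n)).filter fun p =>
        (ringSetting q D F θ π).col (wAt θ u) 𝓛 p ≠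
          (ringSetting q D F θ π).col (wAt θ u) 𝓛' p).card ≤ ∑ I ∈ L' \ L, 9 * I.2 := by
  induction hsteps with
  | refl => exact ⟨𝓛, hL, h0, fun _ _ h => h, by simp⟩
  | tail hs h ih =>
    rename_i L₁ L₂
    obtain ⟨I, hI, hsat, hcov, rfl⟩ := h
    obtain ⟨𝓛₁, h1, h2, h3, h4⟩ := ih fun h => hθ (cov_mono (subset_insert _ _) h)
    have hLL := subset_of_addSteps hs
    have hI1 : 1 ≤ I.2 := (mem_cands.1 hI).2.1
    have h2' : ∀ I' ∈ insert I L₁, 1 ≤ I'.2 := by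
      intro I' hI'
      rcases mem_insert.1 hI' with rfl | hI'
      · exact hI1
      · exact h2 I' hI'
    have hV : (ringSetting q D F θ π).Valid (wAt θ u) (fam F θ (insert I L₁)) :=
      valid_fam hq hk hD hF h2' (hcl.mono (hLL.trans (subset_insert _ _))) hθ
    have hImax : lift θ I ∈ maxl (fam F θ (insert I L₁)) := by
      refine mem_filter.2 ⟨mem_fam.2 (Or.inr (Or.inr (Or.inr ⟨I, mem_insert_self _ _, rfl⟩))),
        fun J hJ h5 h6 => ?_⟩
      rw [fam_insert] at hJ
      rcases mem_insert.1 hJ with h | h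
      · exact h
      · exact absurd (covered_of_lift_subset hθ h2' h h5 h6) hcov
    rw [fam_insert] at hV hImax
    refine ⟨addLive (fam F θ L₁) 𝓛₁ (lift θ I), ?_, h2', fun I' hI' hmem => ?_, ?_⟩
    · rw [fam_insert]; exact h1.addLive hV hImax
    · rcases mem_insert.1 hmem with h | h
      · have : lift θ I' ∈ fam F θ L₁ :=
          mem_fam.2 (Or.inr (Or.inr (Or.inr ⟨I', hLL hI', rfl⟩)))
        rw [h] at this
        exact absurd (covered_of_lift_subset hθ h2' this le_rfl le_rfl) hcov
      · exact h3 I' hI' (mem_filter.1 h).1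
    · have hIL : I ∉ L₁ := fun h => hcov (covered_self h)
      have e : insert I L₁ \ L = insert I (L₁ \ L) := by
        rw [insert_sdiff_of_notMem _ fun h => hIL (hLL h)]
      rw [e, sum_insert (fun h => hIL (mem_sdiff.1 h).1), add_comm (9 * I.2)]
      have hIoo : (Ioo (lift θ I).1 (lift θ I).2).card ≤ 9 * I.2 := by
        rw [Int.card_Ioo]; simp only [lift]; omega
      refine le_trans (card_le_card fun p hp => ?_)
        ((card_union_le _ _).trans (add_le_add h4 hIoo))
      obtain ⟨hp1, hp2⟩ := mem_filter.1 hp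
      rw [mem_union, mem_filter, mem_Ioo]
      by_contra hc
      rw [not_or, not_and_not_right] at hc
      have h5 := hc.1 hp1
      rw [mem_Ioc] at hp1
      refine hp2 (h5.trans (h1.col_addLive hV hImax hp1.1 hp1.2 ?_))
      omega

/-- The number of processes that change their colour when a request is served. -/
theorem card_col_step_le (hq : 4 ≤ q) (hk : 1 ≤ k) (hD : D + 1 = 2 * k) (hF : Feasible k F)
    (h0 : ∀ I ∈ L, 1 ≤ I.2) (hcl : IsClosedFam D q F u L) (hcl' : IsClosedFam D q F u' L')
    (hu : u ≤ u') (hsteps : Relation.ReflTransGen (AddStep D q F u') L L') (hθ : θ ∉ cov n L') :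
    ((Ioc (θ.val : ℤ) (θ.val + n)).filter fun p =>
        (ringSetting q D F θ π).col (wAt θ u) (liveSet q D F θ π u L) p ≠
          (ringSetting q D F θ π).col (wAt θ u') (liveSet q D F θ π u' L') p).card ≤
      ∑ I ∈ L' \ L, 9 * I.2 +
      ∑ I ∈ L', ((ringSetting q D F θ π).mvL (wAt θ u) (wAt θ u') (lift θ I) +
        (ringSetting q D F θ π).mvR (wAt θ u) (wAt θ u') (lift θ I)) +
      open Classical in
      ∑ I ∈ L', if RDead D u' I ∧ ¬ (I ∈ L ∧ RDead D u I) then 9 * I.2 else 0 := by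
  classical
  set S := ringSetting q D F θ π with hS
  set 𝓛 := liveSet q D F θ π u L with h𝓛
  have hLL := subset_of_addSteps hsteps
  have hθL : θ ∉ cov n L := fun h => hθ (cov_mono hLL h)
  have hlive : S.Live (wAt θ u) (fam F θ L) 𝓛 :=
    live_liveSet (valid_fam hq hk hD hF h0 hcl hθL)
  obtain ⟨𝓛₁, h1, h2, h3, h4⟩ := exists_live_of_addSteps hq hk hD hF hlive h0 hcl hsteps hθ
  have hw := wAt_mono (θ := θ) hu
  have hdead_mono : ∀ M, S.Dead (wAt θ u) M → S.Dead (wAt θ u') M := fun M hM =>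
    ⟨hM.1, fun e he he' => (hM.2 e he he').trans (hw e)⟩
  have hlive' : S.Live (wAt θ u') (fam F θ L') 𝓛₁ :=
    { toValid := valid_fam hq hk hD hF h2 hcl' hθ
      sub := h1.sub
      dead := fun M hM hM' => hdead_mono M (h1.dead M hM hM') }
  have hstep2 := h1.card_col_congr hlive' hw
  set T := 𝓛₁.filter fun M => S.Dead (wAt θ u') M with hT
  obtain ⟨h5, h6⟩ := hlive'.sdiff (T := T) (filter_subset _ _) fun M hM => (mem_filter.1 hM).2
  have hfinal : 𝓛₁ \ T = liveSet q D F θ π u' L' := by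
    ext M
    rw [mem_liveSet, mem_sdiff, hT, mem_filter]
    constructor
    · rintro ⟨h7, h8⟩
      exact ⟨h1.sub h7, fun h9 => h8 ⟨h7, h9⟩⟩
    · rintro ⟨h7, h8⟩
      refine ⟨?_, fun h9 => h8 h9.2⟩
      by_contra hc
      exact h8 (hlive'.dead M h7 hc)
  rw [hfinal] at h5 h6
  have h7 : ∑ M ∈ 𝓛₁, (S.mvL (wAt θ u) (wAt θ u') M + S.mvR (wAt θ u) (wAt θ u') M) ≤
      ∑ I ∈ L', (S.mvL (wAt θ u) (wAt θ u') (lift θ I) +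
        S.mvR (wAt θ u) (wAt θ u') (lift θ I)) := by
    refine sum_fam_le (F := F) (fun M hM => h1.mem hM)
      (f := fun M => S.mvL (wAt θ u) (wAt θ u') M + S.mvR (wAt θ u) (wAt θ u') M) fun M hM => ?_
    have hc : S.cap M ≤ 1 := by
      refine Setting.cap_le_width.trans ?_
      unfold width; omega
    have hlt : M.1 < M.2 := by omega
    have hXL : ∀ v, S.XL v M = M.1 := fun v => by
      have := Setting.XL_lt (S := S) (w := v) h1.one_le hlt
      have := Setting.le_XL (S := S) (w := v) (I := M)
      omega
    have hXR : ∀ v, S.XR v M = M.1 := fun v => by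
      have := Setting.lt_XR (S := S) (w := v) h1.one_le hlt
      have := Setting.XR_lt (S := S) (w := v) (I := M)
      omega
    simp [Setting.mvL, Setting.mvR, hXL, hXR]
  have h8 : ∑ M ∈ T, (width M - 1) ≤
      ∑ I ∈ L', if RDead D u' I ∧ ¬ (I ∈ L ∧ RDead D u I) then 9 * I.2 else 0 := by
    have h9 : ∑ M ∈ T, (width M - 1) = ∑ M ∈ 𝓛₁, if M ∈ T then width M - 1 else 0 := by
      rw [sum_ite_mem, inter_eq_right.2 (filter_subset _ _)]
    rw [h9]
    refine (sum_fam_le (F := F) (fun M hM => h1.mem hM)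
      (f := fun M => if M ∈ T then width M - 1 else 0) fun M hM => ?_).trans ?_
    · have : width M - 1 = 0 := by unfold width; omega
      rw [this, ite_self]
    · refine sum_le_sum fun I hI => ?_
      by_cases hIT : lift θ I ∈ T
      · obtain ⟨h10, h11⟩ := mem_filter.1 hIT
        rw [if_pos hIT, if_pos, width_lift]
        · exact Nat.sub_le _ _
        · rw [hS, dead_lift_iff hθ hI] at h11
          refine ⟨h11, fun ⟨h12, h13⟩ => ?_⟩
          have h14 := (mem_liveSet.1 (h3 I h12 h10)).2
          rw [dead_lift_iff hθ hI] at h14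
          exact h14 h13
      · rw [if_neg hIT]; exact Nat.zero_le _
  have hsub : ((Ioc (θ.val : ℤ) (θ.val + n)).filter fun p => S.col (wAt θ u) 𝓛 p ≠
      S.col (wAt θ u') (liveSet q D F θ π u' L') p) ⊆
      (((Ioc (θ.val : ℤ) (θ.val + n)).filter fun p => S.col (wAt θ u) 𝓛 p ≠
        S.col (wAt θ u) 𝓛₁ p) ∪
      ((Ioc (θ.val : ℤ) (θ.val + n)).filter fun p => S.col (wAt θ u) 𝓛₁ p ≠
        S.col (wAt θ u') 𝓛₁ p)) ∪
      ((Ioc (θ.val : ℤ) (θ.val + n)).filter fun p => S.col (wAt θ u') 𝓛₁ p ≠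
        S.col (wAt θ u') (liveSet q D F θ π u' L') p) := by
    intro p hp
    obtain ⟨hp1, hp2⟩ := mem_filter.1 hp
    rw [mem_union, mem_union, mem_filter, mem_filter, mem_filter]
    by_contra hc
    simp only [not_or, not_and_not_right] at hc
    exact hp2 (((hc.1.1 hp1).trans (hc.1.2 hp1)).trans (hc.2 hp1))
  refine (card_le_card hsub).trans ((card_union_le _ _).trans (add_le_add ((card_union_le _ _).trans
    (add_le_add h4 (hstep2.trans h7))) (h6.trans h8)))

end

/-! ### The expected cost of a marking game -/

/-- The cost of a hit of index `i` in a marking game: `1` if the player is hit, and `K m` more if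
she has to leave her position in phase `m`. -/
noncomputable def hitCost (b τ : ℕ → ℕ) (K : ℕ → ℝ) (u ρ : ℕ → ℕ) (i : ℕ) : ℝ :=
  open Classical in
  if GameOpen b τ u ∧ pick b τ u ρ = i then
    1 + (if u i + 1 = τ (phase b τ u) then K (phase b τ u) else 0) else 0

theorem hitCost_nonneg {b τ : ℕ → ℕ} {K : ℕ → ℝ} (hK : ∀ m, 0 ≤ K m) {u ρ : ℕ → ℕ} {i : ℕ} :
    0 ≤ hitCost b τ K u ρ i := by
  unfold hitCost
  have := hK (phase b τ u)
  split_ifs <;> linarith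

/-- The expected cost of a hit is bounded by the growth of the potential of all phases. The sets `s` and
`t` hold the phases that are accounted for before and after the hit; a phase can be opened later. -/
theorem sum_hitCost_le {n : ℕ} {b τ u : ℕ → ℕ} {g : ℕ → Fin n} {K : ℕ → ℝ} (hK : ∀ m, 0 ≤ K m)
    (hg : GameOpen b τ u → Set.InjOn g (Set.Iio (b (phase b τ u)))) {i : ℕ} {s t : Finset ℕ}
    (hst : s ⊆ t) (hs : GameOpen b τ u → phase b τ u ∈ s) :
    (∑ π : Equiv.Perm (Fin n), hitCost b τ K u (fun j => (π (g j)).val) i) ≤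
      n.factorial * (∑ m ∈ t, phasePot (b m) (τ m) (K m) (Function.update u i (u i + 1)) -
        ∑ m ∈ s, phasePot (b m) (τ m) (K m) u) := by
  have h1 : ∑ m ∈ s, phasePot (b m) (τ m) (K m) (Function.update u i (u i + 1)) ≤
      ∑ m ∈ t, phasePot (b m) (τ m) (K m) (Function.update u i (u i + 1)) :=
    sum_le_sum_of_subset_of_nonneg hst fun m _ _ => phasePot_nonneg (hK m) _
  have hmono : ∀ m, 0 ≤ phasePot (b m) (τ m) (K m) (Function.update u i (u i + 1)) -
      phasePot (b m) (τ m) (K m) u := fun m =>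
    sub_nonneg.2 (phasePot_mono (hK m) (le_update_succ u i))
  have h2 : 0 ≤ ∑ m ∈ s, (phasePot (b m) (τ m) (K m) (Function.update u i (u i + 1)) -
      phasePot (b m) (τ m) (K m) u) := sum_nonneg fun m _ => hmono m
  by_cases ho : GameOpen b τ u
  · have h3 := sum_perm_hit_le hK hg (i := i)
    have h4 := single_le_sum (f := fun m =>
      phasePot (b m) (τ m) (K m) (Function.update u i (u i + 1)) - phasePot (b m) (τ m) (K m) u)
      (fun m _ => hmono m) (hs ho)
    rw [sum_sub_distrib] at h4
    refine h3.trans (mul_le_mul_of_nonneg_left (h4.trans ?_) (by positivity))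
    linarith
  · have h5 : ∀ ρ : ℕ → ℕ, hitCost b τ K u ρ i = 0 := fun ρ => by
      unfold hitCost
      rw [if_neg fun h => ho h.1]
    simp only [h5, sum_const_zero]
    rw [sum_sub_distrib] at h2
    exact mul_nonneg (by positivity) (by linarith)

section
variable {n ℓ : ℕ} [NeZero n]

/-! ### Games on windows of the ring -/

/-- The numbers of requests to the edges `g 0, …, g (k - 1)`. -/
def winSeq (k : ℕ) (g : ℕ → Fin n) (u : Fin n → ℕ) (i : ℕ) : ℕ := if i < k then u (g i) else 0

/-- The cost of a request to the edge `r` in a marking game on the edges `g 0, …, g (k - 1)`. -/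
noncomputable def winHit (k : ℕ) (g : ℕ → Fin n) (b τ : ℕ → ℕ) (K : ℕ → ℝ)
    (π : Equiv.Perm (Fin n)) (u : Fin n → ℕ) (r : Fin n) : ℝ :=
  ∑ i ∈ range k, if g i = r then
    hitCost b τ K (winSeq k g u) (fun i => (π (g i)).val) i else 0

section
variable {k : ℕ} {g : ℕ → Fin n} {b τ : ℕ → ℕ} {K : ℕ → ℝ} {π : Equiv.Perm (Fin n)}
  {u u' : Fin n → ℕ} {r : Fin n}

theorem winSeq_mono (h : u ≤ u') : winSeq k g u ≤ winSeq k g u' := fun i => by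
  unfold winSeq; split_ifs
  · exact h _
  · exact le_rfl

theorem winHit_nonneg (hK : ∀ m, 0 ≤ K m) : 0 ≤ winHit k g b τ K π u r := by
  refine sum_nonneg fun i _ => ?_
  split_ifs
  · exact hitCost_nonneg hK
  · exact le_rfl

/-- If the request `r` is in the window, then its counter grows; otherwise nothing changes. -/
theorem winSeq_request (hg : Set.InjOn g (Set.Iio k))
    (hu : ∀ i, u' i = u i + if i = r then 1 else 0) :
    (∃ i < k, g i = r ∧
      winSeq k g u' = Function.update (winSeq k g u) i (winSeq k g u i + 1)) ∨
    ((∀ i < k, g i ≠ r) ∧ winSeq k g u' = winSeq k g u) := by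
  by_cases h : ∃ i < k, g i = r
  · obtain ⟨i, hi, hir⟩ := h
    refine Or.inl ⟨i, hi, hir, funext fun i' => ?_⟩
    by_cases hii : i' = i
    · subst hii
      rw [Function.update_self]
      unfold winSeq
      rw [if_pos hi, if_pos hi, hu, if_pos hir]
    · rw [Function.update_of_ne hii]
      unfold winSeq
      split_ifs with hi'
      · rw [hu, if_neg, add_zero]
        intro h
        exact hii (hg hi' hi (h.trans hir.symm))
      · rfl
  · push Not at h
    refine Or.inr ⟨h, funext fun i' => ?_⟩
    unfold winSeq
    split_ifs with hi'
    · rw [hu, if_neg (h i' hi'), add_zero]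
    · rfl

theorem winHit_eq (hg : Set.InjOn g (Set.Iio k)) {i : ℕ} (hi : i < k) (hir : g i = r) :
    winHit k g b τ K π u r = hitCost b τ K (winSeq k g u) (fun i => (π (g i)).val) i := by
  unfold winHit
  rw [sum_eq_single_of_mem i (mem_range.2 hi), if_pos hir]
  intro i' hi' hne
  rw [if_neg]
  intro h
  exact hne (hg (mem_range.1 hi') hi (h.trans hir.symm))

theorem sum_winHit_le (hK : ∀ m, 0 ≤ K m) (hg : Set.InjOn g (Set.Iio k)) (hb : ∀ m, b m ≤ k)
    (hu : ∀ i, u' i = u i + if i = r then 1 else 0) {s t : Finset ℕ} (hst : s ⊆ t)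
    (hs : GameOpen b τ (winSeq k g u) → phase b τ (winSeq k g u) ∈ s) :
    ∑ π : Equiv.Perm (Fin n), winHit k g b τ K π u r ≤
      n.factorial * (∑ m ∈ t, phasePot (b m) (τ m) (K m) (winSeq k g u') -
        ∑ m ∈ s, phasePot (b m) (τ m) (K m) (winSeq k g u)) := by
  rcases winSeq_request hg hu with ⟨i, hi, hir, hseq⟩ | ⟨h, hseq⟩
  · have h1 : ∀ π, winHit k g b τ K π u r = _ := fun π => winHit_eq hg hi hir
    simp only [h1]
    rw [hseq]
    exact sum_hitCost_le hK (fun _ => hg.mono (Set.Iio_subset_Iio (hb _))) hst hs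
  · have h1 : ∀ π, winHit k g b τ K π u r = 0 := fun π => by
      unfold winHit
      exact sum_eq_zero fun i hi => if_neg (h i (mem_range.1 hi))
    simp only [h1, sum_const_zero]
    rw [hseq]
    have := sum_le_sum_of_subset_of_nonneg hst
      fun m _ _ => phasePot_nonneg (b := b m) (τ := τ m) (hK m) (winSeq k g u)
    exact mul_nonneg (by positivity) (by linarith)

end

/-! ### The servers of guests -/

/-- The number of steps from process `i` back to the edge `x`. -/
def backDist (x i : Fin n) : ℤ := ((i.val : ℤ) - 1 - x.val) % n

/-- Zone cuts are ordered by their distance to process `i`, and then by their number. -/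
def cutKey (m : ℕ) (x : ℕ → Fin n) (i : Fin n) (j : ℕ) : ℤ := backDist (x j) i * m + j

/-- The zone of process `i`: the number of the first cut that is met on the way back. -/
noncomputable def owner (m : ℕ) (x : ℕ → Fin n) (i : Fin n) : ℕ :=
  open Classical in
  if h : ∃ j ∈ range m, ∀ j' ∈ range m, cutKey m x i j ≤ cutKey m x i j' then h.choose else 0

variable {m k : ℕ} {x x' : ℕ → Fin n} {i : Fin n}

theorem backDist_pt (y z : ℤ) : backDist (pt n y) (pt n z) = (z - 1 - y) % n := by
  unfold backDist
  rw [pt_val, pt_val]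
  have h1 := Int.emod_add_mul_ediv y n
  have h2 := Int.emod_add_mul_ediv z n
  refine Int.emod_eq_emod_iff_emod_sub_eq_zero.2 (Int.emod_eq_zero_of_dvd
    ⟨y / n - z / n, ?_⟩)
  rw [mul_sub]; omega

theorem backDist_nonneg (x i : Fin n) : 0 ≤ backDist x i :=
  Int.emod_nonneg _ (n_pos (n := n)).ne'

theorem backDist_lt (x i : Fin n) : backDist x i < n := Int.emod_lt_of_pos _ n_pos

theorem owner_spec (hm : 0 < m) : owner m x i < m ∧
    ∀ j < m, cutKey m x i (owner m x i) ≤ cutKey m x i j := by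
  have h : ∃ j ∈ range m, ∀ j' ∈ range m, cutKey m x i j ≤ cutKey m x i j' :=
    (range m).exists_min_image _ ⟨0, mem_range.2 hm⟩
  rw [owner, dif_pos h]
  have := h.choose_spec
  exact ⟨mem_range.1 this.1, fun j hj => this.2 j (mem_range.2 hj)⟩

theorem cutKey_injective {j j' : ℕ} (hj : j < m) (hj' : j' < m)
    (h : cutKey m x i j = cutKey m x i j') : j = j' := by
  unfold cutKey at h
  have h1 : (j : ℤ) = j' := by
    have e : ((backDist (x j) i * m + j) : ℤ) % m = (backDist (x j') i * m + j') % m := by rw [h]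
    rw [Int.mul_add_emod_self_right, Int.mul_add_emod_self_right,
      Int.emod_eq_of_lt (by positivity) (by exact_mod_cast hj),
      Int.emod_eq_of_lt (by positivity) (by exact_mod_cast hj')] at e
    exact e
  exact_mod_cast h1

theorem owner_eq {j : ℕ} (hj : j < m) (h : ∀ j' < m, cutKey m x i j ≤ cutKey m x i j') :
    owner m x i = j := by
  obtain ⟨h1, h2⟩ := owner_spec (x := x) (i := i) (by omega : 0 < m)
  exact cutKey_injective h1 hj (le_antisymm (h2 j hj) (h _ h1))

/-- If a process changes its zone, then the cut of its old or of its new zone has moved. -/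
theorem owner_ne (hm : 0 < m) (h : owner m x i ≠ owner m x' i) :
    ∃ j < m, x j ≠ x' j ∧ (owner m x i = j ∨ owner m x' i = j) := by
  obtain ⟨h1, h2⟩ := owner_spec (x := x) (i := i) hm
  obtain ⟨h1', h2'⟩ := owner_spec (x := x') (i := i) hm
  by_contra hc
  push Not at hc
  have e1 : x (owner m x i) = x' (owner m x i) := by
    by_contra hne
    exact (hc _ h1 hne).1 rfl
  have e2 : x (owner m x' i) = x' (owner m x' i) := by
    by_contra hne
    exact (hc _ h1' hne).2 rfl
  refine h (cutKey_injective (x := x) (i := i) h1 h1' (le_antisymm (h2 _ h1') ?_))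
  have := h2' _ h1
  unfold cutKey at this ⊢
  rwa [e1, e2]

/-- The zone changes only at zone cuts. -/
theorem owner_next (hm : 0 < m) (h : owner m x i ≠ owner m x (next i)) : ∃ j < m, x j = i := by
  by_contra hc
  push Not at hc
  apply h
  have hkey : ∀ j < m, cutKey m x (next i) j = cutKey m x i j + m := by
    intro j hj
    have hd : backDist (x j) (next i) = backDist (x j) i + 1 := by
      have e1 : backDist (x j) i = (((i.val : ℤ) - 1 - (x j).val) % n : ℤ) := rfl
      have e2 : backDist (x j) (next i) = ((i.val : ℤ) - (x j).val) % n := by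
        conv_lhs => rw [← pt_coe i, ← pt_coe (x j), next_pt, backDist_pt]
        congr 1; ring
      have hn := n_pos (n := n)
      have h1 := Int.emod_add_mul_ediv ((i.val : ℤ) - 1 - (x j).val) n
      have h2 := Int.emod_nonneg ((i.val : ℤ) - 1 - (x j).val) hn.ne'
      have h3 := Int.emod_lt_of_pos ((i.val : ℤ) - 1 - (x j).val) hn
      rw [e1, e2]
      have h4 : ((i.val : ℤ) - 1 - (x j).val) % n + 1 ≠ n := by
        intro h5
        refine hc j hj ?_
        rw [← pt_coe i, ← pt_coe (x j), pt_eq_iff]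
        refine ⟨-(((i.val : ℤ) - 1 - (x j).val) / n) - 1, ?_⟩
        rw [mul_sub, mul_neg]
        omega
      have h6 : (i.val : ℤ) - (x j).val = (((i.val : ℤ) - 1 - (x j).val) % n + 1) +
          n * (((i.val : ℤ) - 1 - (x j).val) / n) := by omega
      conv_lhs => rw [h6]
      rw [Int.add_mul_emod_self_left, Int.emod_eq_of_lt (by omega) (by omega)]
    unfold cutKey
    rw [hd]; ring
  obtain ⟨h1, h2⟩ := owner_spec (x := x) (i := i) hm
  refine (owner_eq h1 fun j hj => ?_).symm
  rw [hkey _ h1, hkey j hj]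
  have := h2 j hj
  omega

/-- If every zone cut is followed by another one at distance at most `R`, then the zones have at most
`R` processes. -/
theorem card_owner_le {j j' R δ : ℕ} (hj' : j' < m) (h1 : 1 ≤ δ) (h2 : δ ≤ R)
    (h : x j' = pt n ((x j).val + δ)) :
    ((univ : Finset (Fin n)).filter fun i => owner m x i = j).card ≤ R := by
  have hm : 0 < m := by omega
  have hlt : ∀ i, owner m x i = j → backDist (x j) i < δ := by
    intro i hi
    obtain ⟨h3, h4⟩ := owner_spec (x := x) (i := i) hm
    have h5 := h4 j' hj'
    rw [hi] at h5
    by_contra hc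
    rw [not_lt] at hc
    have hlt := backDist_lt (x j) i
    have e : backDist (x j') i = backDist (x j) i - δ := by
      rw [h, ← pt_coe i, backDist_pt, pt_coe]
      have e1 : backDist (x j) i = (((i.val : ℤ) - 1 - (x j).val) % n : ℤ) := rfl
      rw [e1] at hc hlt ⊢
      have h7 := Int.emod_add_mul_ediv ((i.val : ℤ) - 1 - (x j).val) n
      have h6 : (i.val : ℤ) - 1 - ((x j).val + δ) = (((i.val : ℤ) - 1 - (x j).val) % n - δ) +
          n * (((i.val : ℤ) - 1 - (x j).val) / n) := by omega
      rw [h6, Int.add_mul_emod_self_left, Int.emod_eq_of_lt (by omega) (by omega)]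
    unfold cutKey at h5
    rw [e] at h5
    have h8 : (m : ℤ) ≤ δ * m := by
      have : (1 : ℤ) * m ≤ δ * m := mul_le_mul_of_nonneg_right (by omega) (by positivity)
      omega
    rw [sub_mul] at h5
    have h9 : (j' : ℤ) < m := by exact_mod_cast hj'
    have h10 : (0 : ℤ) ≤ j := by positivity
    linarith
  calc _ ≤ (range δ).card := by
        refine card_le_card_of_injOn (fun i => (backDist (x j) i).toNat) ?_ ?_
        · intro i hi
          have := hlt i (mem_filter.1 (mem_coe.1 hi)).2
          have := backDist_nonneg (x j) i
          simp only [coe_range, Set.mem_Iio]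
          omega
        · intro a ha b hb hab
          have h3 := backDist_nonneg (x j) a
          have h4 := backDist_nonneg (x j) b
          have h5 : backDist (x j) a = backDist (x j) b := by
            simp only at hab; omega
          unfold backDist at h5
          have h6 := Int.emod_eq_emod_iff_emod_sub_eq_zero.1 h5
          rw [← pt_coe a, ← pt_coe b, pt_eq_iff]
          have := Int.dvd_of_emod_eq_zero h6
          rwa [show (a.val : ℤ) - 1 - (x j).val - ((b.val : ℤ) - 1 - (x j).val) =
            (a.val : ℤ) - b.val by ring] at this
    _ = δ := card_range δ
    _ ≤ R := h2

/-! ### The zone cuts -/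

/-- The number of zones. On short rings a single one suffices. -/
def numZones (n k : ℕ) : ℕ := if 2 * k < n then (n + k - 1) / k else 1

/-- The first edge of the window in which the cut of zone `j` moves. -/
def zoneStart (k : ℕ) (θ : Fin n) (j : ℕ) : ℤ := θ.val + j * k

/-- The edges of the window of zone `j`. -/
def zoneEdge (k : ℕ) (θ : Fin n) (j i : ℕ) : Fin n := pt n (zoneStart k θ j + i)

/-- The numbers of requests in the window of zone `j`. -/
def zoneSeq (k : ℕ) (θ : Fin n) (u : Fin n → ℕ) (j : ℕ) : ℕ → ℕ := winSeq k (zoneEdge k θ j) u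

/-- The position of the cut of zone `j` in its window: all `k` edges are marked at requests `k`,
`2 k`, `4 k`, .... -/
noncomputable def zonePick (k : ℕ) (θ : Fin n) (π : Equiv.Perm (Fin n)) (u : Fin n → ℕ) (j : ℕ) :
    ℕ :=
  pick (fun _ => k) (fun m => 2 ^ m * k) (zoneSeq k θ u j)
    fun i => (π (zoneEdge k θ j i)).val

/-- The cut of zone `j` is active as soon as its first edge, or the base edge, is covered. -/
def ZoneActive (k : ℕ) (θ : Fin n) (L : Finset Arc) (j : ℕ) : Prop :=
  θ ∈ cov n L ∨ pt n (zoneStart k θ j) ∈ cov n L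

/-- The cut edge of zone `j`. -/
noncomputable def zoneCut (k : ℕ) (θ : Fin n) (π : Equiv.Perm (Fin n)) (u : Fin n → ℕ)
    (L : Finset Arc) (j : ℕ) : Fin n :=
  open Classical in
  pt n (zoneStart k θ j + if ZoneActive k θ L j then zonePick k θ π u j else 0)

/-- The potential of the game in the window of zone `j`. -/
noncomputable def zonePot (k : ℕ) (θ : Fin n) (u : Fin n → ℕ) (j : ℕ) : ℝ :=
  ∑ m ∈ range (phase (fun _ => k) (fun m => 2 ^ m * k) (zoneSeq k θ u j) + 1),
    phasePot k (2 ^ m * k) (4 * k) (zoneSeq k θ u j)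

/-- The cost of a request in the window of zone `j`. -/
noncomputable def zoneHit (k : ℕ) (θ : Fin n) (π : Equiv.Perm (Fin n)) (u : Fin n → ℕ)
    (r : Fin n) (j : ℕ) : ℝ :=
  winHit k (zoneEdge k θ j) (fun _ => k) (fun m => 2 ^ m * k) (fun _ => 4 * k) π u r

variable {θ : Fin n} {π : Equiv.Perm (Fin n)} {u u' : Fin n → ℕ} {L L' : Finset Arc} {r : Fin n}
  {j : ℕ}

theorem zone_open (hk : 0 < k) (v : ℕ → ℕ) : GameOpen (fun _ => k) (fun m => 2 ^ m * k) v := by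
  refine ⟨v 0, 0, mem_unmarked.2 ⟨hk, ?_⟩⟩
  exact Nat.lt_two_pow_self.trans_le (Nat.le_mul_of_pos_right _ hk)

theorem zonePick_lt (hk : 0 < k) : zonePick k θ π u j < k :=
  (mem_unmarked.1 (pick_mem (zone_open hk _))).1

theorem numZones_pos (hk : 0 < k) : 0 < numZones n k := by
  unfold numZones
  split_ifs with h
  · exact Nat.div_pos (by omega) hk
  · exact Nat.one_pos

theorem numZones_bounds (hk : 0 < k) (hn : 2 * k < n) :
    n ≤ numZones n k * k ∧ numZones n k * k < n + k := by
  unfold numZones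
  rw [if_pos hn]
  have h1 := Nat.div_add_mod (n + k - 1) k
  have h2 := Nat.mod_lt (n + k - 1) hk
  rw [mul_comm] at h1
  omega

theorem exists_zoneCut_eq (hk : 0 < k) (j : ℕ) :
    ∃ b < k, zoneCut k θ π u L j = pt n (zoneStart k θ j + b) := by
  classical
  unfold zoneCut
  split_ifs
  · exact ⟨_, zonePick_lt hk, rfl⟩
  · exact ⟨0, hk, by simp⟩

/-- The zones are small: the cuts of consecutive zones are close to each other. -/
theorem card_zone_le (hk : 0 < k) (j : ℕ) :
    ((univ : Finset (Fin n)).filter fun i =>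
      owner (numZones n k) (zoneCut k θ π u L) i = j).card ≤ 2 * k := by
  by_cases hn : 2 * k < n
  swap
  · refine (card_le_univ _).trans ?_
    rw [Fintype.card_fin]; omega
  obtain ⟨hb1, hb2⟩ := numZones_bounds hk hn
  set x := zoneCut k θ π u L with hx
  set a : ℕ := (backDist θ (pt n ((x j).val + 1))).toNat with ha
  have ha' : (a : ℤ) = ((x j).val - θ.val) % n := by
    rw [ha, Int.toNat_of_nonneg (backDist_nonneg _ _)]
    conv_lhs => rw [← pt_coe θ, backDist_pt]
    congr 1; ring
  have ha1 : a < n := by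
    have := Int.emod_lt_of_pos (((x j).val : ℤ) - θ.val) (n_pos (n := n))
    omega
  have ha2 : ∃ t : ℤ, ((x j).val : ℤ) = θ.val + a + t * n := by
    have := Int.emod_add_mul_ediv (((x j).val : ℤ) - θ.val) n
    exact ⟨((x j).val - θ.val) / n, by rw [mul_comm]; omega⟩
  obtain ⟨t, ht⟩ := ha2
  have hd1 := Nat.div_add_mod a k
  have hd2 := Nat.mod_lt a hk
  rw [mul_comm] at hd1
  clear_value a
  generalize a / k = w at *
  generalize a % k = w' at *
  by_cases hlast : w + 1 < numZones n k
  · obtain ⟨b, hb, hcut⟩ := exists_zoneCut_eq (θ := θ) (π := π) (u := u) (L := L) hk (w + 1)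
    have h3 : (w + 1) * k = w * k + k := by ring
    refine (card_owner_le (j' := w + 1) (δ := (w + 1) * k + b - a) (R := 2 * k) hlast
      (by omega) (by omega) ?_)
    rw [hx, hcut, ht, pt_eq_iff]
    refine ⟨-t, ?_⟩
    unfold zoneStart
    have h4 : (((w + 1) * k + b - a : ℕ) : ℤ) = ((w + 1 : ℕ) : ℤ) * k + b - a := by
      rw [Nat.cast_sub (by omega)]; push_cast; ring
    rw [h4]; ring
  · obtain ⟨b, hb, hcut⟩ := exists_zoneCut_eq (θ := θ) (π := π) (u := u) (L := L) hk 0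
    have h3 : (numZones n k - 1) * k ≤ w * k := Nat.mul_le_mul_right _ (by omega)
    rw [Nat.sub_mul, one_mul] at h3
    refine (card_owner_le (j' := 0) (δ := n + b - a) (R := 2 * k) (numZones_pos hk)
      (by omega) (by omega) ?_)
    rw [hx, hcut, ht, pt_eq_iff]
    refine ⟨-t - 1, ?_⟩
    unfold zoneStart
    have h4 : ((n + b - a : ℕ) : ℤ) = (n : ℤ) + b - a := by
      rw [Nat.cast_sub (by omega)]; push_cast; ring
    rw [h4]; push_cast; ring

theorem numZones_le (hk : 0 < k) {F : Placement n ℓ} (hF : Feasible k F) : numZones n k ≤ ℓ := by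
  have h1 : n ≤ ℓ * k := by
    calc n = (univ : Finset (Fin n)).card := by rw [card_univ, Fintype.card_fin]
      _ = ∑ s : Fin ℓ, load F s := card_eq_sum_card_fiberwise fun _ _ => mem_coe.2 (mem_univ _)
      _ ≤ ∑ _s : Fin ℓ, k := sum_le_sum fun s _ => hF s
      _ = ℓ * k := by simp
  by_cases hn : 2 * k < n
  · obtain ⟨_, hb2⟩ := numZones_bounds hk hn
    by_contra hc
    have : (ℓ + 1) * k ≤ numZones n k * k := Nat.mul_le_mul_right _ (by omega)
    rw [add_mul] at this
    omega
  · unfold numZones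
    rw [if_neg hn]
    have : n ≠ 0 := NeZero.ne n
    by_contra hc
    have : ℓ = 0 := by omega
    subst this
    omega

/-! ### The cost of zone cuts -/

theorem zone_injOn (hn : k < n) :
    Set.InjOn (zoneEdge k θ j) (Set.Iio k) := by
  intro a ha b hb hab
  have ha : a < k := ha
  have hb : b < k := hb
  have := eq_of_pt_eq hab (by omega) (by omega)
  omega

theorem zonePot_nonneg : 0 ≤ zonePot k θ u j :=
  sum_nonneg fun _ _ => phasePot_nonneg (by positivity) _

theorem zoneHit_nonneg : 0 ≤ zoneHit k θ π u r j := winHit_nonneg fun _ => by positivity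

/-- The cost of an active zone cut: `1` if it is hit, and `4 k` if it moves. -/
theorem le_zoneHit (hk : 0 < k) (hn : k < n) (hu : ∀ i, u' i = u i + if i = r then 1 else 0) :
    ((if pt n (zoneStart k θ j + zonePick k θ π u j) = r then 1 else 0) +
      if zonePick k θ π u' j = zonePick k θ π u j then 0 else 4 * (k : ℝ)) ≤ zoneHit k θ π u r j := by
  classical
  have ho := zone_open hk (zoneSeq k θ u j)
  by_cases hmove : zonePick k θ π u' j = zonePick k θ π u j
  · rw [if_pos hmove, add_zero]
    split_ifs with h
    · rw [zoneHit, winHit_eq (zone_injOn hn) (zonePick_lt hk) h]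
      unfold hitCost
      rw [if_pos ⟨ho, rfl⟩]
      split_ifs
      · have : (0 : ℝ) ≤ 4 * k := by positivity
        linarith
      · linarith
    · exact zoneHit_nonneg
  · rcases winSeq_request (zone_injOn (θ := θ) (j := j) hn) hu with ⟨i, hi, hir, hseq⟩ | ⟨_, hseq⟩
    · have hmove' := hmove
      unfold zonePick at hmove'
      rw [zoneSeq, hseq] at hmove'
      obtain ⟨_, h1, h2⟩ := pick_update hmove'
      rw [zoneHit, winHit_eq (zone_injOn hn) hi hir]
      have hhit : hitCost (fun _ => k) (fun m => 2 ^ m * k) (fun _ => 4 * (k : ℝ))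
          (winSeq k (zoneEdge k θ j) u) (fun i => (π (zoneEdge k θ j i)).val) i = 1 + 4 * k := by
        unfold hitCost
        rw [if_pos ⟨ho, h1⟩, if_pos h2]
      rw [hhit, if_neg hmove]
      split_ifs <;> linarith
    · exact absurd (by unfold zonePick zoneSeq; rw [hseq]) hmove

theorem sum_zoneHit_le (hk : 0 < k) (hn : k < n)
    (hu : ∀ i, u' i = u i + if i = r then 1 else 0) :
    ∑ π : Equiv.Perm (Fin n), zoneHit k θ π u r j ≤
      n.factorial * (zonePot k θ u' j - zonePot k θ u j) := by
  have hle : u ≤ u' := fun i => by rw [hu]; exact Nat.le_add_right _ _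
  have h2 := phase_mono (winSeq_mono (k := k) (g := zoneEdge k θ j) hle) (zone_open hk _)
  exact sum_winHit_le (fun _ => by positivity) (zone_injOn hn) (fun _ => le_rfl) hu
    (range_mono (Nat.succ_le_succ h2)) (fun _ => mem_range.2 (Nat.lt_succ_self _))

/-- The potential of a zone is bounded by the least number of requests to an edge of its window. -/
theorem zonePot_le (hk : 0 < k) {μ : ℕ} (hμ : ∃ i < k, u (pt n (zoneStart k θ j + i)) ≤ μ) :
    zonePot k θ u j ≤ 6 * (k + 2 * μ) * harmonic k := by
  set v := zoneSeq k θ u j with hv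
  set M := phase (fun _ => k) (fun m => 2 ^ m * k) v with hM
  have h1 : (2 : ℝ) ^ M * k ≤ k + 2 * μ := by
    rcases Nat.eq_zero_or_pos M with h0 | h0
    · rw [h0]; simp
    · have h2 := phase_min (b := fun _ => k) (τ := fun m => 2 ^ m * k) (u := v) (m := M - 1)
        (by omega)
      obtain ⟨i, hi, hiμ⟩ := hμ
      have h3 : 2 ^ (M - 1) * k ≤ μ := by
        by_contra hc
        have : i ∈ unmarked k (2 ^ (M - 1) * k) v := by
          refine mem_unmarked.2 ⟨hi, ?_⟩
          rw [hv, zoneSeq, winSeq, if_pos hi]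
          exact (lt_of_le_of_lt hiμ (not_le.1 hc))
        rw [h2] at this
        exact notMem_empty _ this
      have h4 : 2 ^ M * k = 2 * (2 ^ (M - 1) * k) := by
        conv_lhs => rw [← Nat.sub_add_cancel h0, pow_succ]
        ring
      have h5 : 2 ^ M * k ≤ k + 2 * μ := by omega
      exact_mod_cast h5
  have h2 : ∀ N : ℕ, ∑ m ∈ range (N + 1), ((2 : ℝ) ^ m + 4) ≤ 6 * 2 ^ N := by
    intro N
    induction N with
    | zero => norm_num
    | succ N ih =>
      rw [sum_range_succ, pow_succ]
      have : (1 : ℝ) ≤ 2 ^ N := one_le_pow₀ (by norm_num)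
      linarith
  calc zonePot k θ u j ≤ ∑ m ∈ range (M + 1), (((2 ^ m * k : ℕ) : ℝ) + 4 * k) * harmonic k :=
        sum_le_sum fun m _ => phasePot_le (by positivity) _
    _ = (∑ m ∈ range (M + 1), ((2 : ℝ) ^ m + 4)) * k * harmonic k := by
        rw [sum_mul, sum_mul]
        refine sum_congr rfl fun m _ => ?_
        push_cast; ring
    _ ≤ 6 * 2 ^ M * k * harmonic k := by
        have := harmonic_nonneg k
        gcongr
        exact h2 M
    _ ≤ 6 * (k + 2 * μ) * harmonic k := by
        have := harmonic_nonneg k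
        have : 6 * 2 ^ M * (k : ℝ) ≤ 6 * (k + 2 * μ) := by linarith
        gcongr

end

/-! ### The games of an arc -/

section
variable {b τ u v ρ ρ' : ℕ → ℕ} {Λ : ℕ}

theorem unmarked_congr (hb : ∀ m, b m ≤ Λ) (h : ∀ i < Λ, u i = v i) (m : ℕ) :
    unmarked (b m) (τ m) u = unmarked (b m) (τ m) v :=
  filter_congr fun i hi => by rw [h i ((mem_range.1 hi).trans_le (hb m))]

theorem gameOpen_congr (hb : ∀ m, b m ≤ Λ) (h : ∀ i < Λ, u i = v i) :
    GameOpen b τ u ↔ GameOpen b τ v := by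
  unfold GameOpen
  simp only [unmarked_congr hb h]

theorem phase_congr (hb : ∀ m, b m ≤ Λ) (h : ∀ i < Λ, u i = v i) :
    phase b τ u = phase b τ v := by
  by_cases ho : GameOpen b τ v
  · refine phase_eq ?_ fun m' hm' => ?_
    · rw [unmarked_congr hb h]; exact phase_spec ho
    · rw [unmarked_congr hb h]; exact phase_min hm'
  · rw [phase, phase, dif_neg ho, dif_neg (mt (gameOpen_congr hb h).1 ho)]

theorem firstMin_congr {S : Finset ℕ} (h : ∀ i ∈ S, ρ i = ρ' i) : firstMin S ρ = firstMin S ρ' := by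
  have : ∀ i, (i ∈ S ∧ ∀ j ∈ S, ρ i ≤ ρ j) ↔ (i ∈ S ∧ ∀ j ∈ S, ρ' i ≤ ρ' j) := fun i =>
    and_congr_right fun hi => forall₂_congr fun j hj => by rw [h i hi, h j hj]
  unfold firstMin
  simp only [this]

/-- A game played on the first `Λ` indices depends only on the counters and priorities of these. -/
theorem pick_congr (hb : ∀ m, b m ≤ Λ) (h : ∀ i < Λ, u i = v i) (hρ : ∀ i < Λ, ρ i = ρ' i) :
    pick b τ u ρ = pick b τ v ρ' := by
  unfold pick
  rw [phase_congr hb h, unmarked_congr hb h]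
  exact firstMin_congr fun i hi => hρ i ((mem_unmarked.1 hi).1.trans_le (hb _))

end

section
variable {n ℓ : ℕ} [NeZero n]

/-- The counters of the edges `g 0, …, g (k - 1)` are those of an open growing game. -/
def GrowOpen (q Λ k : ℕ) (g : ℕ → Fin n) (u : Fin n → ℕ) : Prop :=
  GameOpen (rng q Λ) (rng q Λ) (winSeq k g u)

/-- The position of the player in the growing game on the edges `g 0, …, g (Λ - 1)`. -/
noncomputable def growPick (q Λ k : ℕ) (g : ℕ → Fin n) (π : Equiv.Perm (Fin n)) (u : Fin n → ℕ) :
    ℕ := gpick q Λ (winSeq k g u) fun i => (π (g i)).val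

/-- The cost of a request in a growing game. A move in phase `m` costs three times the range of
the phase. -/
noncomputable def growHit (q Λ k : ℕ) (g : ℕ → Fin n) (π : Equiv.Perm (Fin n)) (u : Fin n → ℕ)
    (r : Fin n) : ℝ :=
  winHit k g (rng q Λ) (rng q Λ) (fun m => 3 * rng q Λ m) π u r

/-- The potential of a growing game. -/
noncomputable def growPot (q Λ k : ℕ) (g : ℕ → Fin n) (u : Fin n → ℕ) : ℝ :=
  ∑ m ∈ (range Λ).filter (fun m => len q m < Λ),
    phasePot (rng q Λ m) (rng q Λ m) (3 * rng q Λ m) (winSeq k g u)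

section
variable {q Λ k : ℕ} {g : ℕ → Fin n} {π : Equiv.Perm (Fin n)} {u u' : Fin n → ℕ} {r : Fin n}

theorem growPot_nonneg : 0 ≤ growPot q Λ k g u :=
  sum_nonneg fun _ _ => phasePot_nonneg (by positivity) _

theorem growHit_nonneg : 0 ≤ growHit q Λ k g π u r := winHit_nonneg fun _ => by positivity

theorem growPot_mono (h : u ≤ u') : growPot q Λ k g u ≤ growPot q Λ k g u' :=
  sum_le_sum fun _ _ => phasePot_mono (by positivity) (winSeq_mono h)

theorem growPot_le (hq : 0 < q) : growPot q Λ k g u ≤ 16 * q * Λ * harmonic Λ := by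
  have h := sum_rng_le (q := q) (Λ := Λ) hq
  have hh := harmonic_nonneg Λ
  calc growPot q Λ k g u
      ≤ ∑ m ∈ (range Λ).filter (fun m => len q m < Λ), 4 * (rng q Λ m : ℝ) * harmonic Λ := by
        refine sum_le_sum fun m _ => (phasePot_le (by positivity) _).trans ?_
        have h1 := harmonic_mono (rng_le q Λ m)
        have h2 : (rng q Λ m : ℝ) + 3 * rng q Λ m = 4 * rng q Λ m := by ring
        rw [h2]
        gcongr
    _ = 4 * ((∑ m ∈ (range Λ).filter (fun m => len q m < Λ), rng q Λ m : ℕ) : ℝ) * harmonic Λ := by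
        rw [Nat.cast_sum, mul_sum, sum_mul]
    _ ≤ 4 * ((4 * q * Λ : ℕ) : ℝ) * harmonic Λ := by gcongr
    _ = _ := by push_cast; ring

theorem sum_growHit_le (hg : Set.InjOn g (Set.Iio k)) (hΛ : Λ ≤ k)
    (hu : ∀ i, u' i = u i + if i = r then 1 else 0) :
    ∑ π : Equiv.Perm (Fin n), growHit q Λ k g π u r ≤
      n.factorial * (growPot q Λ k g u' - growPot q Λ k g u) :=
  sum_winHit_le (fun _ => by positivity) hg (fun m => (rng_le q Λ m).trans hΛ) hu Subset.rfl
    phase_mem_filter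

theorem growPick_lt (h : 0 < Λ) : growPick q Λ k g π u < Λ := gpick_lt h

/-- The cost of a growing game: `1` if the player of an open game is hit, and the larger one of
the two positions if the player moves. -/
theorem le_growHit (hg : Set.InjOn g (Set.Iio k)) (hΛ : Λ ≤ k) (h0 : 0 < Λ)
    (hu : ∀ i, u' i = u i + if i = r then 1 else 0) :
    (open Classical in
      (if GrowOpen q Λ k g u ∧ g (growPick q Λ k g π u) = r then 1 else 0) +
      if growPick q Λ k g π u = growPick q Λ k g π u' then 0 else
        ((max (growPick q Λ k g π u) (growPick q Λ k g π u') : ℕ) : ℝ)) ≤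
      growHit q Λ k g π u r := by
  classical
  have hlt : growPick q Λ k g π u < k := (growPick_lt h0).trans_le hΛ
  rcases winSeq_request hg hu with ⟨i, hi, hir, hseq⟩ | ⟨hne, hseq⟩
  · have hhit : growHit q Λ k g π u r = hitCost (rng q Λ) (rng q Λ) (fun m => 3 * rng q Λ m)
        (winSeq k g u) (fun i => (π (g i)).val) i := winHit_eq hg hi hir
    by_cases hmove : growPick q Λ k g π u = growPick q Λ k g π u'
    · rw [if_pos hmove, add_zero]
      split_ifs with h
      · have hgi : growPick q Λ k g π u = i := hg hlt hi (h.2.trans hir.symm)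
        rw [hhit]
        unfold hitCost
        rw [if_pos ⟨h.1, hgi⟩]
        have : (0 : ℝ) ≤ 3 * rng q Λ (phase (rng q Λ) (rng q Λ) (winSeq k g u)) := by positivity
        split_ifs <;> linarith
      · exact growHit_nonneg
    · have hmove' : gpick q Λ (Function.update (winSeq k g u) i (winSeq k g u i + 1))
          (fun i => (π (g i)).val) ≠ gpick q Λ (winSeq k g u) fun i => (π (g i)).val := by
        rw [← hseq]; exact fun h => hmove h.symm
      obtain ⟨ho, h1, h2⟩ := pick_update hmove'
      have h3 := gpick_update_le hmove'
      have h4 := gpick_lt_rng (ρ := fun i => (π (g i)).val) ho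
      rw [← hseq] at h3
      have hval : growHit q Λ k g π u r =
          1 + 3 * rng q Λ (phase (rng q Λ) (rng q Λ) (winSeq k g u)) := by
        rw [hhit]
        unfold hitCost
        rw [if_pos ⟨ho, h1⟩, if_pos h2]
      rw [if_neg hmove, hval]
      have h5 : max (growPick q Λ k g π u) (growPick q Λ k g π u') ≤
          3 * rng q Λ (phase (rng q Λ) (rng q Λ) (winSeq k g u)) :=
        max_le (by unfold growPick; omega) h3
      have h6 : ((max (growPick q Λ k g π u) (growPick q Λ k g π u') : ℕ) : ℝ) ≤
          3 * rng q Λ (phase (rng q Λ) (rng q Λ) (winSeq k g u)) := by exact_mod_cast h5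
      split_ifs <;> linarith
  · have hmove : growPick q Λ k g π u = growPick q Λ k g π u' := by
      unfold growPick; rw [hseq]
    rw [if_pos hmove, if_neg fun h => hne _ hlt h.2, add_zero]
    exact growHit_nonneg

end

/-- The edges of the interval reserved for the arc, from the left end on. -/
def leftEdge (n : ℕ) [NeZero n] (I : Arc) (i : ℕ) : Fin n := pt n ((outer I).1 + i)

/-- The edges of the interval reserved for the arc, from the right end on. -/
def rightEdge (n : ℕ) [NeZero n] (I : Arc) (i : ℕ) : Fin n := pt n ((outer I).2 - 1 - i)

/-- The cost of a request in the two games of an arc. -/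
noncomputable def arcHit (q D : ℕ) (I : Arc) (π : Equiv.Perm (Fin n)) (u : Fin n → ℕ)
    (r : Fin n) : ℝ :=
  growHit q (min (9 * I.2) D) (9 * I.2) (leftEdge n I) π u r +
    growHit q (min (9 * I.2) D) (9 * I.2) (rightEdge n I) π u r

/-- The potential of the two games of an arc. -/
noncomputable def arcPot (q D : ℕ) (I : Arc) (u : Fin n → ℕ) : ℝ :=
  growPot q (min (9 * I.2) D) (9 * I.2) (leftEdge n I) u +
    growPot q (min (9 * I.2) D) (9 * I.2) (rightEdge n I) u

variable {q D k : ℕ} {F : Placement n ℓ} {θ : Fin n} {π : Equiv.Perm (Fin n)} {u u' : Fin n → ℕ}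
  {L L' : Finset Arc} {I : Arc} {r : Fin n}

theorem arcPot_nonneg : 0 ≤ arcPot q D I u := add_nonneg growPot_nonneg growPot_nonneg

theorem arcPot_mono (h : u ≤ u') : arcPot q D I u ≤ arcPot q D I u' :=
  add_le_add (growPot_mono h) (growPot_mono h)

theorem arcPot_le (hq : 0 < q) : arcPot q D I u ≤ 288 * q * I.2 * harmonic D := by
  have h1 := growPot_le (Λ := min (9 * I.2) D) (k := 9 * I.2) (g := leftEdge n I) (u := u) hq
  have h2 := growPot_le (Λ := min (9 * I.2) D) (k := 9 * I.2) (g := rightEdge n I) (u := u) hq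
  have h3 : (16 * q * (min (9 * I.2) D : ℕ) * harmonic (min (9 * I.2) D) : ℝ) ≤
      16 * q * (9 * I.2 : ℕ) * harmonic D := by
    have := harmonic_nonneg (min (9 * I.2) D)
    have h4 : ((min (9 * I.2) D : ℕ) : ℝ) ≤ (9 * I.2 : ℕ) := by exact_mod_cast min_le_left _ _
    have h5 := harmonic_mono (min_le_right (9 * I.2) D)
    gcongr
  unfold arcPot
  have h6 : (16 * q * (9 * I.2 : ℕ) * harmonic D : ℝ) = 144 * q * I.2 * harmonic D := by
    push_cast; ring
  linarith

/-- A reserved interval that is shorter than the ring does not meet itself. -/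
theorem leftEdge_injOn (h : 9 * I.2 < n) : Set.InjOn (leftEdge n I) (Set.Iio (9 * I.2)) := by
  intro a ha b hb hab
  have ha : a < 9 * I.2 := ha
  have hb : b < 9 * I.2 := hb
  have := eq_of_pt_eq hab (by omega) (by omega)
  omega

theorem rightEdge_injOn (h : 9 * I.2 < n) : Set.InjOn (rightEdge n I) (Set.Iio (9 * I.2)) := by
  intro a ha b hb hab
  have ha : a < 9 * I.2 := ha
  have hb : b < 9 * I.2 := hb
  have := eq_of_pt_eq hab (by omega) (by omega)
  omega

theorem sum_arcHit_le (h : 9 * I.2 < n) (hu : ∀ i, u' i = u i + if i = r then 1 else 0) :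
    ∑ π : Equiv.Perm (Fin n), arcHit q D I π u r ≤
      n.factorial * (arcPot q D I u' - arcPot q D I u) := by
  unfold arcHit arcPot
  rw [sum_add_distrib]
  have h1 := sum_growHit_le (q := q) (Λ := min (9 * I.2) D) (leftEdge_injOn h) (min_le_left _ _) hu
  have h2 := sum_growHit_le (q := q) (Λ := min (9 * I.2) D) (rightEdge_injOn h) (min_le_left _ _) hu
  calc _ ≤ _ := add_le_add h1 h2
    _ = _ := by ring

theorem length_lt (hθ : θ ∉ cov n L) (hI : I ∈ L) : 9 * I.2 < n := by
  obtain ⟨h1, h2, _⟩ := lift_spec hθ hI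
  have : (lift θ I).2 = (lift θ I).1 + 9 * I.2 := rfl
  omega

theorem cap_lift : (ringSetting q D F θ π).cap (lift θ I) = min (9 * I.2) D := by
  unfold Setting.cap
  rw [width_lift]
  rfl

theorem fromLeft_lift (hθ : θ ∉ cov n L) (hI : I ∈ L) {i : ℕ} (hi : i < 9 * I.2) :
    fromLeft (wAt θ u) (lift θ I) i = winSeq (9 * I.2) (leftEdge n I) u i := by
  have e0 : (lift θ I).2 = (lift θ I).1 + 9 * I.2 := rfl
  unfold fromLeft winSeq leftEdge
  rw [if_pos hi, wAt_lift hθ hI (by omega) (by omega)]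
  congr 2; ring

theorem fromRight_lift (hθ : θ ∉ cov n L) (hI : I ∈ L) {i : ℕ} (hi : i < 9 * I.2) :
    fromRight (wAt θ u) (lift θ I) i = winSeq (9 * I.2) (rightEdge n I) u i := by
  have e0 : (lift θ I).2 = (lift θ I).1 + 9 * I.2 := rfl
  unfold fromRight winSeq rightEdge
  rw [if_pos hi, wAt_lift hθ hI (by omega) (by omega), e0]
  congr 2
  simp only [outer]; ring

theorem pt_lift_fst_add (hθ : θ ∉ cov n L) (hI : I ∈ L) (i : ℕ) :
    pt n ((lift θ I).1 + i) = leftEdge n I i := by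
  obtain ⟨_, _, t, e1, _⟩ := lift_spec hθ hI
  rw [leftEdge, e1, pt_eq_iff]
  exact ⟨t, by ring⟩

theorem pt_lift_snd_sub (hθ : θ ∉ cov n L) (hI : I ∈ L) (i : ℕ) :
    pt n ((lift θ I).2 - 1 - i) = rightEdge n I i := by
  obtain ⟨_, _, t, _, e2⟩ := lift_spec hθ hI
  rw [rightEdge, e2, pt_eq_iff]
  exact ⟨t, by ring⟩

theorem openL_lift_iff (hθ : θ ∉ cov n L) (hI : I ∈ L) :
    (ringSetting q D F θ π).OpenL (wAt θ u) (lift θ I) ↔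
      GrowOpen q (min (9 * I.2) D) (9 * I.2) (leftEdge n I) u := by
  unfold Setting.OpenL GrowOpen
  rw [cap_lift]
  exact gameOpen_congr (rng_le _ _) fun i hi =>
    fromLeft_lift hθ hI (hi.trans_le (min_le_left _ _))

theorem openR_lift_iff (hθ : θ ∉ cov n L) (hI : I ∈ L) :
    (ringSetting q D F θ π).OpenR (wAt θ u) (lift θ I) ↔
      GrowOpen q (min (9 * I.2) D) (9 * I.2) (rightEdge n I) u := by
  unfold Setting.OpenR GrowOpen
  rw [cap_lift]
  exact gameOpen_congr (rng_le _ _) fun i hi =>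
    fromRight_lift hθ hI (hi.trans_le (min_le_left _ _))

theorem XL_lift (hθ : θ ∉ cov n L) (hI : I ∈ L) :
    (ringSetting q D F θ π).XL (wAt θ u) (lift θ I) =
      (lift θ I).1 + growPick q (min (9 * I.2) D) (9 * I.2) (leftEdge n I) π u := by
  unfold Setting.XL growPick gpick
  rw [cap_lift]
  congr 2
  exact pick_congr (rng_le _ _) (fun i hi => fromLeft_lift hθ hI (hi.trans_le (min_le_left _ _)))
    fun i _ => by
      change (π (pt n ((lift θ I).1 + i))).val = _
      rw [pt_lift_fst_add hθ hI]

theorem XR_lift (hθ : θ ∉ cov n L) (hI : I ∈ L) :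
    (ringSetting q D F θ π).XR (wAt θ u) (lift θ I) =
      (lift θ I).2 - 1 - growPick q (min (9 * I.2) D) (9 * I.2) (rightEdge n I) π u := by
  unfold Setting.XR growPick gpick
  rw [cap_lift]
  congr 2
  exact pick_congr (rng_le _ _) (fun i hi => fromRight_lift hθ hI (hi.trans_le (min_le_left _ _)))
    fun i _ => by
      change (π (pt n ((lift θ I).2 - 1 - i))).val = _
      rw [pt_lift_snd_sub hθ hI]

/-- The request `r` hits one of the two cuts of the arc while its game is open. -/
def ArcCut (q D : ℕ) (F : Placement n ℓ) (θ : Fin n) (π : Equiv.Perm (Fin n)) (u : Fin n → ℕ)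
    (r : Fin n) (I : Arc) : Prop :=
  ((ringSetting q D F θ π).OpenL (wAt θ u) (lift θ I) ∧
    pt n ((ringSetting q D F θ π).XL (wAt θ u) (lift θ I)) = r) ∨
  ((ringSetting q D F θ π).OpenR (wAt θ u) (lift θ I) ∧
    pt n ((ringSetting q D F θ π).XR (wAt θ u) (lift θ I)) = r)

/-- The cost of the two games of an arc bounds the cost that its cuts cause. -/
theorem le_arcHit (hD : 0 < D) (hθ : θ ∉ cov n L) (hI : I ∈ L) (h0 : 1 ≤ I.2)
    (hu : ∀ i, u' i = u i + if i = r then 1 else 0) :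
    (open Classical in (if ArcCut q D F θ π u r I then 1 else 0) +
      (((ringSetting q D F θ π).mvL (wAt θ u) (wAt θ u') (lift θ I) +
        (ringSetting q D F θ π).mvR (wAt θ u) (wAt θ u') (lift θ I) : ℕ) : ℝ)) ≤
      arcHit q D I π u r := by
  classical
  have hn := length_lt hθ hI
  have hΛ : 0 < min (9 * I.2) D := by omega
  have h1 := le_growHit (q := q) (π := π) (leftEdge_injOn hn) (min_le_left (9 * I.2) D) hΛ hu
  have h2 := le_growHit (q := q) (π := π) (rightEdge_injOn hn) (min_le_left (9 * I.2) D) hΛ hu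
  have e1 : (ringSetting q D F θ π).mvL (wAt θ u) (wAt θ u') (lift θ I) =
      if growPick q (min (9 * I.2) D) (9 * I.2) (leftEdge n I) π u =
        growPick q (min (9 * I.2) D) (9 * I.2) (leftEdge n I) π u' then 0 else
        max (growPick q (min (9 * I.2) D) (9 * I.2) (leftEdge n I) π u)
          (growPick q (min (9 * I.2) D) (9 * I.2) (leftEdge n I) π u') := by
    unfold Setting.mvL
    rw [XL_lift hθ hI, XL_lift hθ hI]
    refine ite_congr (by simp) (fun _ => rfl) fun _ => by omega
  have e2 : (ringSetting q D F θ π).mvR (wAt θ u) (wAt θ u') (lift θ I) =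
      if growPick q (min (9 * I.2) D) (9 * I.2) (rightEdge n I) π u =
        growPick q (min (9 * I.2) D) (9 * I.2) (rightEdge n I) π u' then 0 else
        max (growPick q (min (9 * I.2) D) (9 * I.2) (rightEdge n I) π u)
          (growPick q (min (9 * I.2) D) (9 * I.2) (rightEdge n I) π u') := by
    unfold Setting.mvR
    rw [XR_lift hθ hI, XR_lift hθ hI]
    refine ite_congr (by simp) (fun _ => rfl) fun _ => by omega
  have e3 : (if ArcCut q D F θ π u r I then 1 else 0 : ℝ) ≤
      (if GrowOpen q (min (9 * I.2) D) (9 * I.2) (leftEdge n I) u ∧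
        leftEdge n I (growPick q (min (9 * I.2) D) (9 * I.2) (leftEdge n I) π u) = r
        then 1 else 0) +
      (if GrowOpen q (min (9 * I.2) D) (9 * I.2) (rightEdge n I) u ∧
        rightEdge n I (growPick q (min (9 * I.2) D) (9 * I.2) (rightEdge n I) π u) = r
        then 1 else 0) := by
    unfold ArcCut
    rw [openL_lift_iff hθ hI, openR_lift_iff hθ hI, XL_lift hθ hI, XR_lift hθ hI,
      pt_lift_fst_add hθ hI, pt_lift_snd_sub hθ hI]
    split_ifs with h3 h4 h5 h5 h4 <;> norm_num
    exact absurd h3 (not_or.2 ⟨h4, h5⟩)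
  rw [e1, e2]
  unfold arcHit
  push_cast at h1 h2 ⊢
  linarith

end

section
variable {n ℓ : ℕ} [NeZero n]

/-! ### The placement on the ring -/

/-- The point of the path behind the edge `θ` that represents the process `i`. -/
def procLift (θ i : Fin n) : ℤ := θ.val + 1 + ((i.val : ℤ) - (θ.val + 1)) % n

/-- The server of process `i`, if it is a guest: the server with the number of its zone. -/
noncomputable def guest (k : ℕ) (F : Placement n ℓ) (θ : Fin n) (π : Equiv.Perm (Fin n))
    (u : Fin n → ℕ) (L : Finset Arc) (i : Fin n) : Fin ℓ :=
  if h : owner (numZones n k) (zoneCut k θ π u L) i < ℓ then ⟨_, h⟩ else F i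

/-- The colour of a process on the path behind the edge `θ`. -/
noncomputable def ringCol (q D : ℕ) (F : Placement n ℓ) (θ : Fin n) (π : Equiv.Perm (Fin n))
    (u : Fin n → ℕ) (L : Finset Arc) (i : Fin n) : Option (Fin ℓ) :=
  (ringSetting q D F θ π).col (wAt θ u) (liveSet q D F θ π u L) (procLift θ i)

/-- The placement after the requests `u`, where `L` is the current family of arcs. As soon as the
base edge `θ` is covered by an arc, all processes are guests. -/
noncomputable def place (q D k : ℕ) (F : Placement n ℓ) (θ : Fin n) (π : Equiv.Perm (Fin n))
    (u : Fin n → ℕ) (L : Finset Arc) : Placement n ℓ := fun i =>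
  open Classical in
  if θ ∈ cov n L then guest k F θ π u L i
  else (ringCol q D F θ π u L i).getD (guest k F θ π u L i)

variable {q D k : ℕ} {F : Placement n ℓ} {θ : Fin n} {π : Equiv.Perm (Fin n)} {u u' : Fin n → ℕ}
  {L L' : Finset Arc} {I : Arc} {r i : Fin n}

theorem procLift_mem : procLift θ i ∈ Ioc (θ.val : ℤ) (θ.val + n) := by
  have h1 := Int.emod_nonneg ((i.val : ℤ) - (θ.val + 1)) (n_pos (n := n)).ne'
  have h2 := Int.emod_lt_of_pos ((i.val : ℤ) - (θ.val + 1)) (n_pos (n := n))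
  rw [mem_Ioc]
  unfold procLift
  omega

theorem pt_procLift : pt n (procLift θ i) = i := by
  conv_rhs => rw [← pt_coe i]
  rw [pt_eq_iff]
  have := Int.emod_add_mul_ediv ((i.val : ℤ) - (θ.val + 1)) n
  refine ⟨-(((i.val : ℤ) - (θ.val + 1)) / n), ?_⟩
  unfold procLift
  rw [mul_neg]; omega

theorem procLift_pt {p : ℤ} (hp : p ∈ Ioc (θ.val : ℤ) (θ.val + n)) : procLift θ (pt n p) = p := by
  have h := procLift_mem (θ := θ) (i := pt n p)
  rw [mem_Ioc] at h hp
  exact eq_of_pt_eq pt_procLift (by omega) (by omega)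

theorem procLift_injective : Function.Injective (procLift θ) := fun i j h => by
  rw [← pt_procLift (θ := θ) (i := i), h, pt_procLift]

theorem owner_lt (hk : 0 < k) (hF : Feasible k F) (x : ℕ → Fin n) :
    owner (numZones n k) x i < ℓ :=
  (owner_spec (numZones_pos hk)).1.trans_le (numZones_le hk hF)

theorem guest_val (hk : 0 < k) (hF : Feasible k F) :
    (guest k F θ π u L i).val = owner (numZones n k) (zoneCut k θ π u L) i := by
  unfold guest
  rw [dif_pos (owner_lt hk hF _)]

theorem place_of_mem (hθ : θ ∈ cov n L) : place q D k F θ π u L i = guest k F θ π u L i := by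
  classical
  unfold place; rw [if_pos hθ]

theorem place_of_notMem (hθ : θ ∉ cov n L) :
    place q D k F θ π u L i = (ringCol q D F θ π u L i).getD (guest k F θ π u L i) := by
  classical
  unfold place; rw [if_neg hθ]

/-- Before the first request, the placement is the initial one. -/
theorem place_init (hq : 4 ≤ q) (hk : 1 ≤ k) (hD : D + 1 = 2 * k) (hF : Feasible k F) :
    place q D k F θ π (fun _ => 0) ∅ = F := by
  funext i
  have hθ : θ ∉ cov n ∅ := by simp [cov]
  have hw : ∀ e, wAt θ (fun _ : Fin n => 0) e = 0 := fun e => by unfold wAt; split_ifs <;> rfl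
  have h𝒥 : ∀ J ∈ fam F θ (∅ : Finset Arc), J.2 = J.1 + 1 := by
    intro J hJ
    rcases mem_fam.1 hJ with h | h | ⟨_, _, h⟩ | ⟨I, hI, _⟩
    · rw [h]
    · rw [h]
    · exact h
    · exact absurd hI (notMem_empty I)
  have hcl : IsClosedFam D q F (fun _ => 0) ∅ := (skel_invariant (D := D) (q := q) (F := F) []).2.2
  have hV := valid_fam (π := π) (L := ∅) hq hk hD hF (by simp) hcl hθ
  have hlive := live_liveSet hV
  have e : liveSet q D F θ π (fun _ => 0) ∅ = maxl (fam F θ ∅) := by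
    ext M
    rw [mem_liveSet]
    refine and_iff_left_of_imp fun hM hd => ?_
    have h1 := h𝒥 M (mem_of_mem_maxl hM)
    have h2 := hd.2 M.1 le_rfl (by omega)
    rw [hw] at h2
    unfold width at h2
    omega
  rw [e] at hlive
  have hp := procLift_mem (θ := θ) (i := i)
  rw [mem_Ioc] at hp
  have := hlive.col_init hw h𝒥 hp.1 hp.2
  rw [place_of_notMem hθ, ringCol, e, this, Option.getD_some]
  change F (pt n (procLift θ i)) = _
  rw [pt_procLift]

/-- The load of a server: at most `2 k` guests, at most `k` processes that it held at the start, and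
at most `2 k / c` others. -/
theorem load_place_le {c : ℕ} (hc : q = 2 * c + 1) (hq : 4 ≤ q) (hk : 1 ≤ k) (hD : D + 1 = 2 * k)
    (hF : Feasible k F) (h0 : ∀ I ∈ L, 1 ≤ I.2) (hcl : IsClosedFam D q F u L) (s : Fin ℓ) :
    c * load (place q D k F θ π u L) s ≤ c * (3 * k) + 2 * k := by
  classical
  set X := (univ : Finset (Fin n)).filter fun i =>
    owner (numZones n k) (zoneCut k θ π u L) i = s.val with hX
  set Y := (univ : Finset (Fin n)).filter fun i => F i = s with hY
  set Z := (univ : Finset (Fin n)).filter fun i =>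
    θ ∉ cov n L ∧ ringCol q D F θ π u L i = some s ∧ F i ≠ s with hZ
  have hXc : X.card ≤ 2 * k := card_zone_le hk _
  have hYc : Y.card ≤ k := hF s
  have hsub : ((univ : Finset (Fin n)).filter fun i => place q D k F θ π u L i = s) ⊆ X ∪ Y ∪ Z := by
    intro i hi
    have hi := (mem_filter.1 hi).2
    simp only [mem_union, hX, hY, hZ, mem_filter, mem_univ, true_and]
    by_cases hθ : θ ∈ cov n L
    · rw [place_of_mem hθ] at hi
      rw [← guest_val hk hF, hi]
      exact Or.inl (Or.inl rfl)
    · rw [place_of_notMem hθ] at hi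
      cases hcol : ringCol q D F θ π u L i with
      | none =>
        rw [hcol, Option.getD_none] at hi
        rw [← guest_val hk hF, hi]
        exact Or.inl (Or.inl rfl)
      | some a =>
        rw [hcol, Option.getD_some] at hi
        subst hi
        by_cases hFi : F i = a
        · exact Or.inl (Or.inr hFi)
        · exact Or.inr ⟨hθ, rfl, hFi⟩
  have hZc : c * Z.card ≤ 2 * k := by
    by_cases hθ : θ ∈ cov n L
    · have : Z = ∅ := by
        rw [hZ]; exact filter_false_of_mem fun i _ h => h.1 hθ
      rw [this]; simp
    have hlive := live_liveSet (valid_fam (π := π) hq hk hD hF h0 hcl hθ)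
    have h1 := hlive.card_new_le hc s
    have h2 : Z.card ≤ ((Ioc (θ.val : ℤ) (θ.val + n)).filter fun p =>
        (ringSetting q D F θ π).col (wAt θ u) (liveSet q D F θ π u L) p = some s ∧
          F (pt n p) ≠ s).card := by
      rw [← card_image_of_injective Z (procLift_injective (θ := θ))]
      refine card_le_card fun p hp => ?_
      obtain ⟨i, hi, rfl⟩ := mem_image.1 hp
      rw [mem_filter, pt_procLift]
      exact ⟨procLift_mem, (mem_filter.1 hi).2.2⟩
    have h3 : ((Ioc (θ.val : ℤ) (θ.val + n)).filter fun p => F (pt n p) = s).card ≤ k := by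
      have h4 := card_filter_le_load (F := F) ((θ.val : ℤ) + 1) (θ.val + n) (by omega) s
      exact (h4.trans' (card_le_card (filter_subset_filter _ fun p hp => by
        rw [mem_Ioc] at hp; rw [mem_Icc]; omega))).trans (hF s)
    calc c * Z.card ≤ _ := Nat.mul_le_mul_left c h2
      _ ≤ 2 * ((Ioc (θ.val : ℤ) (θ.val + n)).filter fun p => F (pt n p) = s).card := h1
      _ ≤ 2 * k := Nat.mul_le_mul_left 2 h3
  have hload : load (place q D k F θ π u L) s ≤ 3 * k + Z.card := by
    have h1 := card_le_card hsub
    have h2 := card_union_le (X ∪ Y) Z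
    have h3 := card_union_le X Y
    unfold load
    omega
  calc _ ≤ c * (3 * k + Z.card) := Nat.mul_le_mul_left c hload
    _ = c * (3 * k) + c * Z.card := mul_add _ _ _
    _ ≤ _ := Nat.add_le_add_left hZc _

/-! ### The communication cost -/

theorem ne_of_commCost_ne_zero (h : commCost F r ≠ 0) : F r ≠ F (next r) := by
  unfold commCost at h
  intro h'
  rw [if_pos h'] at h
  exact h rfl

/-- Guests in different zones communicate across an active zone cut. -/
theorem exists_zoneCut_of_guest_ne (hk : 0 < k) (hF : Feasible k F)
    (hr : θ ∈ cov n L ∨ r ∈ cov n L) (h : guest k F θ π u L r ≠ guest k F θ π u L (next r)) :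
    2 * k < n ∧ ∃ j < numZones n k, ZoneActive k θ L j ∧ zoneCut k θ π u L j = r := by
  have hne : owner (numZones n k) (zoneCut k θ π u L) r ≠
      owner (numZones n k) (zoneCut k θ π u L) (next r) := by
    rw [← guest_val hk hF, ← guest_val hk hF]
    exact fun h' => h (Fin.ext h')
  have hm := numZones_pos (n := n) hk
  refine ⟨?_, ?_⟩
  · by_contra hc
    have h1 : numZones n k = 1 := by unfold numZones; rw [if_neg hc]
    have h2 := (owner_spec (x := zoneCut k θ π u L) (i := r) hm).1
    have h3 := (owner_spec (x := zoneCut k θ π u L) (i := next r) hm).1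
    omega
  · obtain ⟨j, hj, hjr⟩ := owner_next hm hne
    refine ⟨j, hj, ?_, hjr⟩
    by_contra hact
    rcases hr with hr | hr
    · exact hact (Or.inl hr)
    · refine hact (Or.inr ?_)
      rw [← hjr] at hr
      unfold zoneCut at hr
      rw [if_neg hact] at hr
      simpa using hr

theorem not_nearMono_pair (hq : 4 ≤ q) {G : ℤ → Fin ℓ} {x : ℤ} (h : G x ≠ G (x + 1)) :
    ¬ ∃ a, NearMono q G x (x + 1) a := by
  rintro ⟨a, ha⟩
  unfold NearMono at ha
  have h1 : (Icc x (x + 1)).card = 2 := by rw [Int.card_Icc]; omega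
  have h2 : 1 ≤ ((Icc x (x + 1)).filter fun y => G y ≠ a).card := by
    rw [Nat.one_le_iff_ne_zero, Finset.card_ne_zero]
    by_cases hx : G x = a
    · exact ⟨x + 1, mem_filter.2 ⟨mem_Icc.2 ⟨by omega, le_rfl⟩, fun h' => h (hx.trans h'.symm)⟩⟩
    · exact ⟨x, mem_filter.2 ⟨mem_Icc.2 ⟨le_rfl, by omega⟩, hx⟩⟩
  rw [h1] at ha
  have := Nat.mul_le_mul hq h2
  omega

/-- A request that is not local hits an active zone cut or an open cut of an arc, or it creates an
arc. -/
theorem commCost_place (hq : 4 ≤ q) (hk : 1 ≤ k) (hD : D + 1 = 2 * k) (hF : Feasible k F)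
    (h0 : ∀ I ∈ L, 1 ≤ I.2) (hcl : IsClosedFam D q F u L) (hcl' : IsClosedFam D q F u' L)
    (hu : ∀ i, u' i = u i + if i = r then 1 else 0) (hθ : θ ∉ cov n L)
    (h : commCost (place q D k F θ π u L) r ≠ 0) :
    (2 * k < n ∧ ∃ j < numZones n k, ZoneActive k θ L j ∧ zoneCut k θ π u L j = r) ∨
      ∃ I ∈ L, ArcCut q D F θ π u r I := by
  have hn := n_pos (n := n)
  have hne := ne_of_commCost_ne_zero h
  rw [place_of_notMem hθ, place_of_notMem hθ] at hne
  have hur : 1 ≤ u' r := by rw [hu, if_pos rfl]; omega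
  have hlive := live_liveSet (valid_fam (π := π) hq hk hD hF h0 hcl hθ)
  have hV' := valid_fam (π := π) hq hk hD hF h0 hcl' hθ
  by_cases hrθ : r = θ
  · exfalso
    subst hrθ
    have e1 : ringCol q D F r π u L r = some (F r) := by
      have e : procLift r r = r.val + n := by
        have := procLift_pt (θ := r) (p := r.val + n) (mem_Ioc.2 ⟨by omega, le_rfl⟩)
        rwa [pt_add_n, pt_coe] at this
      unfold ringCol
      rw [e]
      refine hlive.col_right.trans ?_
      change some (F (pt n (r.val + n))) = _
      rw [pt_add_n, pt_coe]
    have e2 : ringCol q D F r π u L (next r) = some (F (next r)) := by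
      have e : procLift r (next r) = r.val + 1 := by
        have := procLift_pt (θ := r) (p := r.val + 1) (mem_Ioc.2 ⟨by omega, by omega⟩)
        rwa [← next_pt, pt_coe] at this
      unfold ringCol
      rw [e]
      refine hlive.col_left.trans ?_
      change some (F (pt n (r.val + 1))) = _
      rw [← next_pt, pt_coe]
    rw [e1, e2, Option.getD_some, Option.getD_some] at hne
    have hn1 : n ≠ 1 := by
      rintro rfl
      exact hne (by rw [Subsingleton.elim (next r) r])
    have hmono : ¬ ∃ a, NearMono q (fun x => F (pt n x)) (r.val : ℤ) (r.val + 1) a := by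
      refine not_nearMono_pair hq ?_
      rw [← next_pt, pt_coe]
      exact hne
    obtain ⟨I₀, hI₀, t, h4, h5⟩ := hcl' ((r.val : ℤ), 1)
      (mem_cands.2 ⟨⟨by simp, by simp⟩, by simp only; omega, by simp only; omega,
        by simp only; omega⟩)
      ⟨fun e h1 h2 => by
        simp only at h1 h2 ⊢
        rw [show e = (r.val : ℤ) by push_cast at h2; omega, pt_coe]
        exact hur, by exact_mod_cast hmono⟩
    simp only at h4 h5
    refine hθ (mem_cov.2 ⟨I₀, hI₀, r.val + (-t) * n, ?_, ?_, ?_⟩)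
    · rw [neg_mul]; omega
    · rw [neg_mul]; omega
    · rw [pt_add_mul, pt_coe]
  · have hp := procLift_mem (θ := θ) (i := r)
    set p := procLift θ r with hpdef
    have hptp : pt n p = r := pt_procLift
    rw [mem_Ioc] at hp
    have hpB : p < θ.val + n := by
      refine lt_of_le_of_ne hp.2 fun h' => hrθ ?_
      rw [← hptp, h', pt_add_n, pt_coe]
    have hnext : procLift θ (next r) = p + 1 := by
      rw [← hptp, next_pt]
      exact procLift_pt (mem_Ioc.2 ⟨by omega, by omega⟩)
    by_cases hcol : ringCol q D F θ π u L r = ringCol q D F θ π u L (next r)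
    · left
      cases hcr : ringCol q D F θ π u L r with
      | some a =>
        rw [← hcol, hcr, Option.getD_some, Option.getD_some] at hne
        exact absurd rfl hne
      | none =>
        rw [← hcol, hcr, Option.getD_none, Option.getD_none] at hne
        obtain ⟨J, hJ, h1, h2⟩ := hlive.exists_of_col_eq_none hp.1 hp.2 hcr
        refine exists_zoneCut_of_guest_ne hk hF (Or.inr ?_) hne
        rcases mem_fam.1 (hlive.mem hJ) with h | h | ⟨_, _, h⟩ | ⟨I, hI, h⟩
        · rw [h] at h1 h2; simp only at h1 h2; omega
        · rw [h] at h1 h2; simp only at h1 h2; omega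
        · omega
        · obtain ⟨_, _, t, e1, e2⟩ := lift_spec hθ hI
          rw [h] at h1 h2
          refine mem_cov.2 ⟨I, hI, p + (-t) * n, ?_, ?_, ?_⟩
          · rw [neg_mul]; omega
          · rw [neg_mul]; omega
          · rw [pt_add_mul, hptp]
    · right
      unfold ringCol at hcol
      rw [hnext] at hcol
      obtain ⟨M, hM, hcut⟩ := hlive.exists_open_cut (fun M hM => (mem_liveSet.1 hM).2) hp.1 hpB hcol
      -- the cut of an interval of width one is an initial colour change; the request saturates it, and
      -- the arc that covers it then contradicts the maximality of the interval
      have hsmall : M.2 ≠ M.1 + 1 := by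
        intro hM1
        have hcap : (ringSetting q D F θ π).cap M ≤ 1 := by
          refine Setting.cap_le_width.trans ?_
          unfold width; omega
        have hlt : M.1 < M.2 := by omega
        have hpM : p = M.1 := by
          rcases hcut with ⟨_, h1⟩ | ⟨_, h1⟩
          · have := Setting.XL_lt (S := ringSetting q D F θ π) (w := wAt θ u) hlive.one_le hlt
            have := Setting.le_XL (S := ringSetting q D F θ π) (w := wAt θ u) (I := M)
            omega
          · have := Setting.lt_XR (S := ringSetting q D F θ π) (w := wAt θ u) hlive.one_le hlt
            have := Setting.XR_lt (S := ringSetting q D F θ π) (w := wAt θ u) (I := M)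
            omega
        have hFne : F (pt n p) ≠ F (pt n (p + 1)) := by
          rcases mem_fam.1 (hlive.mem hM) with h | h | ⟨_, h, _⟩ | ⟨I, hI, h⟩
          · rw [h] at hpM; simp only at hpM; omega
          · rw [h] at hpM; simp only at hpM; omega
          · rw [hpM]; exact h
          · have := h0 I hI
            rw [h] at hM1
            have : (lift θ I).2 = (lift θ I).1 + 9 * I.2 := rfl
            omega
        obtain ⟨J, hJ, h1, h2⟩ := hV'.sat p (p + 1) (by change (θ.val : ℤ) + 1 ≤ p; omega)
          (by omega) (by change p + 1 ≤ (θ.val : ℤ) + n; omega) (by change p + 1 - p ≤ (D : ℤ); omega)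
          (fun e h1 h2 => by
            have : e = p := by omega
            subst this
            unfold wAt
            rw [if_pos ⟨hp.1, hpB⟩, hptp]
            omega)
          (not_nearMono_pair (G := fun x => F (pt n x)) hq hFne)
        have := (mem_filter.1 (hlive.sub hM)).2 J hJ (by omega) (by omega)
        rw [this] at h1
        omega
      rcases mem_fam.1 (hlive.mem hM) with h | h | ⟨_, _, h⟩ | ⟨I, hI, h⟩
      · exact absurd (by rw [h]) hsmall
      · exact absurd (by rw [h]) hsmall
      · exact absurd h hsmall
      · refine ⟨I, hI, ?_⟩
        rw [h] at hcut
        rcases hcut with ⟨h1, h2⟩ | ⟨h1, h2⟩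
        · exact Or.inl ⟨h1, by rw [← h2, hptp]⟩
        · exact Or.inr ⟨h1, by rw [← h2, hptp]⟩

end

section
variable {n ℓ : ℕ} [NeZero n]

/-! ### The cost of a step -/

/-- A bound for the cost that the cut of zone `j` causes in a step: the cost of its game once it is
active, and the cost of a move when it becomes active. -/
noncomputable def zoneStep (k : ℕ) (θ : Fin n) (π : Equiv.Perm (Fin n)) (u : Fin n → ℕ)
    (L L' : Finset Arc) (r : Fin n) (j : ℕ) : ℝ :=
  open Classical in
  if ZoneActive k θ L j then zoneHit k θ π u r j
  else if ZoneActive k θ L' j then 4 * (k : ℝ) else 0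

/-- A bound for the cost of all zone cuts in a step. If there is only one zone, then there are no
cuts. -/
noncomputable def zonesStep (k : ℕ) (θ : Fin n) (π : Equiv.Perm (Fin n)) (u : Fin n → ℕ)
    (L L' : Finset Arc) (r : Fin n) : ℝ :=
  if 2 * k < n then ∑ j ∈ range (numZones n k), zoneStep k θ π u L L' r j else 0

/-- A bound for the cost of all arcs in a step: for new arcs, for the games, and for arcs that
die. -/
noncomputable def arcsStep (q D : ℕ) (π : Equiv.Perm (Fin n)) (u u' : Fin n → ℕ)
    (L L' : Finset Arc) (r : Fin n) : ℝ :=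
  open Classical in
  ∑ I ∈ L' \ L, (9 * (I.2 : ℝ) + 1) +
    ∑ I ∈ L', (arcHit q D I π u r +
      if RDead D u' I ∧ ¬ (I ∈ L ∧ RDead D u I) then 9 * (I.2 : ℝ) else 0)

variable {q D k : ℕ} {F : Placement n ℓ} {θ : Fin n} {π : Equiv.Perm (Fin n)} {u u' : Fin n → ℕ}
  {L L' : Finset Arc} {I : Arc} {r i : Fin n} {j : ℕ}

theorem ZoneActive.mono (h : L ⊆ L') (hj : ZoneActive k θ L j) : ZoneActive k θ L' j :=
  hj.imp (fun h' => cov_mono h h') fun h' => cov_mono h h'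

theorem zoneStep_nonneg : 0 ≤ zoneStep k θ π u L L' r j := by
  unfold zoneStep
  split_ifs
  · exact zoneHit_nonneg
  · positivity
  · exact le_rfl

theorem zonesStep_nonneg : 0 ≤ zonesStep k θ π u L L' r := by
  unfold zonesStep
  split_ifs
  · exact sum_nonneg fun _ _ => zoneStep_nonneg
  · exact le_rfl

/-- The cost of a zone cut in a step: `1` if it is active and hit, and `4 k` if it moves. -/
theorem le_zoneStep (hk : 0 < k) (hn : k < n) (hL : L ⊆ L')
    (hu : ∀ i, u' i = u i + if i = r then 1 else 0) :
    (open Classical in (if ZoneActive k θ L j ∧ zoneCut k θ π u L j = r then 1 else 0) +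
      if zoneCut k θ π u L j ≠ zoneCut k θ π u' L' j then 4 * (k : ℝ) else 0) ≤
      zoneStep k θ π u L L' r j := by
  classical
  unfold zoneStep
  by_cases h1 : ZoneActive k θ L j
  · rw [if_pos h1]
    refine le_trans ?_ (le_zoneHit hk hn hu)
    have e1 : zoneCut k θ π u L j = pt n (zoneStart k θ j + zonePick k θ π u j) := by
      unfold zoneCut; rw [if_pos h1]
    have e2 : zoneCut k θ π u' L' j = pt n (zoneStart k θ j + zonePick k θ π u' j) := by
      unfold zoneCut; rw [if_pos (h1.mono hL)]
    rw [← e1]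
    refine add_le_add ?_ ?_
    · split_ifs with h2 h3 h3
      · exact le_rfl
      · exact absurd h2.2 h3
      · exact zero_le_one
      · exact le_rfl
    · split_ifs with h2 h3 h3
      · exact absurd (by rw [e1, e2, h3]) h2
      · exact le_rfl
      · exact le_rfl
      · positivity
  · rw [if_neg h1, if_neg fun h => h1 h.1, zero_add]
    split_ifs with h2 h3 h3
    · exact le_rfl
    · refine absurd ?_ h2
      unfold zoneCut
      rw [if_neg h1, if_neg h3]
    · positivity
    · exact le_rfl

/-- A guest changes its server only if the cut of its old or new zone moves, and both zones have at most
`2 k` processes. -/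
theorem card_guest_step_le (hk : 0 < k) (hF : Feasible k F) :
    (((univ : Finset (Fin n)).filter fun i =>
      guest k F θ π u L i ≠ guest k F θ π u' L' i).card : ℝ) ≤
      open Classical in
      if 2 * k < n then ∑ j ∈ range (numZones n k),
        if zoneCut k θ π u L j ≠ zoneCut k θ π u' L' j then 4 * (k : ℝ) else 0
      else 0 := by
  classical
  have hm := numZones_pos (n := n) hk
  have hne : ∀ i, guest k F θ π u L i ≠ guest k F θ π u' L' i →
      owner (numZones n k) (zoneCut k θ π u L) i ≠
        owner (numZones n k) (zoneCut k θ π u' L') i := by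
    intro i hi h
    rw [← guest_val hk hF, ← guest_val hk hF] at h
    exact hi (Fin.ext h)
  split_ifs with hn
  · have hsub : ((univ : Finset (Fin n)).filter fun i =>
        guest k F θ π u L i ≠ guest k F θ π u' L' i) ⊆
        (range (numZones n k)).biUnion fun j =>
          if zoneCut k θ π u L j ≠ zoneCut k θ π u' L' j then
            (univ.filter fun i => owner (numZones n k) (zoneCut k θ π u L) i = j) ∪
            (univ.filter fun i => owner (numZones n k) (zoneCut k θ π u' L') i = j) else ∅ := by
      intro i hi
      obtain ⟨j, hj, h1, h2⟩ := owner_ne hm (hne i (mem_filter.1 hi).2)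
      refine mem_biUnion.2 ⟨j, mem_range.2 hj, ?_⟩
      rw [if_pos h1, mem_union, mem_filter, mem_filter]
      exact h2.imp (fun h => ⟨mem_univ _, h⟩) fun h => ⟨mem_univ _, h⟩
    have h1 : ((univ : Finset (Fin n)).filter fun i =>
        guest k F θ π u L i ≠ guest k F θ π u' L' i).card ≤
        ∑ j ∈ range (numZones n k),
          if zoneCut k θ π u L j ≠ zoneCut k θ π u' L' j then 4 * k else 0 := by
      refine (card_le_card hsub).trans (card_biUnion_le.trans (sum_le_sum fun j _ => ?_))
      split_ifs
      · refine (card_union_le _ _).trans ?_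
        have h2 := card_zone_le (n := n) (θ := θ) (π := π) (u := u) (L := L) hk j
        have h3 := card_zone_le (n := n) (θ := θ) (π := π) (u := u') (L := L') hk j
        omega
      · exact card_empty.le
    calc _ ≤ ((∑ j ∈ range (numZones n k),
          if zoneCut k θ π u L j ≠ zoneCut k θ π u' L' j then 4 * k else 0 : ℕ) : ℝ) := by
          exact_mod_cast h1
      _ = _ := by push_cast; rfl
  · have h1 : numZones n k = 1 := by unfold numZones; rw [if_neg hn]
    rw [filter_false_of_mem, card_empty, Nat.cast_zero]
    intro i _ hi
    have h2 := (owner_spec (x := zoneCut k θ π u L) (i := i) hm).1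
    have h3 := (owner_spec (x := zoneCut k θ π u' L') (i := i) hm).1
    have := hne i hi
    omega

/-- The cost of zone cuts in a step: communication across active cuts, and migration of guests. -/
theorem guest_step_le (hk : 0 < k) (hF : Feasible k F) (hL : L ⊆ L')
    (hu : ∀ i, u' i = u i + if i = r then 1 else 0) :
    (open Classical in
      if 2 * k < n ∧ ∃ j < numZones n k, ZoneActive k θ L j ∧ zoneCut k θ π u L j = r
        then 1 else 0) +
      (((univ : Finset (Fin n)).filter fun i =>
        guest k F θ π u L i ≠ guest k F θ π u' L' i).card : ℝ) ≤ zonesStep k θ π u L L' r := by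
  classical
  have h1 := card_guest_step_le (n := n) (θ := θ) (π := π) (u := u) (u' := u') (L := L) (L' := L')
    hk hF
  unfold zonesStep
  by_cases hn : 2 * k < n
  · rw [if_pos hn] at h1 ⊢
    have h2 : (if 2 * k < n ∧ ∃ j < numZones n k, ZoneActive k θ L j ∧ zoneCut k θ π u L j = r
        then 1 else 0 : ℝ) ≤ ∑ j ∈ range (numZones n k),
        if ZoneActive k θ L j ∧ zoneCut k θ π u L j = r then 1 else 0 := by
      split_ifs with h
      · obtain ⟨_, j, hj, hact⟩ := h
        have := single_le_sum (f := fun j =>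
          (if ZoneActive k θ L j ∧ zoneCut k θ π u L j = r then 1 else 0 : ℝ))
          (fun j _ => by split_ifs <;> norm_num) (mem_range.2 hj)
        simp only [if_pos hact] at this
        exact this
      · exact sum_nonneg fun j _ => by split_ifs <;> norm_num
    refine (add_le_add h2 h1).trans ?_
    rw [← sum_add_distrib]
    exact sum_le_sum fun j _ => le_zoneStep hk (by omega) hL hu
  · rw [if_neg hn] at h1 ⊢
    rw [if_neg fun h => hn h.1]
    linarith

theorem commCost_le_one (c : Placement n ℓ) (r : Fin n) : commCost c r ≤ 1 := by
  unfold commCost; split_ifs <;> omega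

/-- If the base edge stays uncovered, then processes migrate only if their colours change or the
guests are rearranged. -/
theorem migrationCost_place_le (hθ : θ ∉ cov n L) (hθ' : θ ∉ cov n L') :
    migrationCost (place q D k F θ π u L) (place q D k F θ π u' L') ≤
      ((Ioc (θ.val : ℤ) (θ.val + n)).filter fun p =>
        (ringSetting q D F θ π).col (wAt θ u) (liveSet q D F θ π u L) p ≠
          (ringSetting q D F θ π).col (wAt θ u') (liveSet q D F θ π u' L') p).card +
      ((univ : Finset (Fin n)).filter fun i =>
        guest k F θ π u L i ≠ guest k F θ π u' L' i).card := by
  set X := (univ : Finset (Fin n)).filter fun i =>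
    ringCol q D F θ π u L i ≠ ringCol q D F θ π u' L' i with hX
  have hsub : ((univ : Finset (Fin n)).filter fun i =>
      place q D k F θ π u L i ≠ place q D k F θ π u' L' i) ⊆
      X ∪ (univ.filter fun i => guest k F θ π u L i ≠ guest k F θ π u' L' i) := by
    intro i hi
    have hi := (mem_filter.1 hi).2
    rw [place_of_notMem hθ, place_of_notMem hθ'] at hi
    rw [mem_union, hX, mem_filter, mem_filter]
    by_contra hc
    simp only [mem_univ, true_and, not_or, not_not] at hc
    exact hi (by rw [hc.1, hc.2])
  refine (card_le_card hsub).trans ((card_union_le _ _).trans (Nat.add_le_add_right ?_ _))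
  rw [← card_image_of_injective X (procLift_injective (θ := θ))]
  refine card_le_card fun p hp => ?_
  obtain ⟨i, hi, rfl⟩ := mem_image.1 hp
  exact mem_filter.2 ⟨procLift_mem, (mem_filter.1 hi).2⟩

/-- The cost of serving a request and of the migration that follows. -/
theorem cost_step_le (hq : 4 ≤ q) (hk : 1 ≤ k) (hD : D + 1 = 2 * k) (hF : Feasible k F)
    (h0 : ∀ I ∈ L', 1 ≤ I.2) (hcl : IsClosedFam D q F u L) (hcl' : IsClosedFam D q F u' L')
    (hu : ∀ i, u' i = u i + if i = r then 1 else 0)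
    (hsteps : Relation.ReflTransGen (AddStep D q F u') L L') :
    ((commCost (place q D k F θ π u L) r +
      migrationCost (place q D k F θ π u L) (place q D k F θ π u' L') : ℕ) : ℝ) ≤
      zonesStep k θ π u L L' r +
      open Classical in
      if θ ∈ cov n L' then (if θ ∈ cov n L then 0 else (n : ℝ) + 1)
      else arcsStep q D π u u' L L' r := by
  classical
  have hLL := subset_of_addSteps hsteps
  have h0L : ∀ I ∈ L, 1 ≤ I.2 := fun I hI => h0 I (hLL hI)
  have huu : u ≤ u' := fun i => by rw [hu]; exact Nat.le_add_right _ _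
  have hguest := guest_step_le (θ := θ) (π := π) hk hF hLL hu
  have hcomm := commCost_le_one (place q D k F θ π u L) r
  have hz : 0 ≤ zonesStep k θ π u L L' r := zonesStep_nonneg
  push_cast
  by_cases hθ' : θ ∈ cov n L'
  · rw [if_pos hθ']
    by_cases hθ : θ ∈ cov n L
    · rw [if_pos hθ, add_zero]
      refine le_trans (add_le_add ?_ ?_) hguest
      · split_ifs with h
        · exact_mod_cast hcomm
        · have : commCost (place q D k F θ π u L) r = 0 := by
            by_contra hc
            have hne := ne_of_commCost_ne_zero hc
            rw [place_of_mem hθ, place_of_mem hθ] at hne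
            exact h (exists_zoneCut_of_guest_ne hk hF (Or.inl hθ) hne)
          rw [this, Nat.cast_zero]
      · unfold migrationCost
        simp only [place_of_mem hθ, place_of_mem hθ']
        exact le_rfl
    · rw [if_neg hθ]
      have h1 : migrationCost (place q D k F θ π u L) (place q D k F θ π u' L') ≤ n :=
        (card_le_univ _).trans_eq (Fintype.card_fin n)
      have h2 : (commCost (place q D k F θ π u L) r : ℝ) ≤ 1 := by exact_mod_cast hcomm
      have h3 : (migrationCost (place q D k F θ π u L) (place q D k F θ π u' L') : ℝ) ≤ n := by
        exact_mod_cast h1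
      linarith
  · rw [if_neg hθ']
    have hθ : θ ∉ cov n L := fun h => hθ' (cov_mono hLL h)
    have hmig : (migrationCost (place q D k F θ π u L) (place q D k F θ π u' L') : ℝ) ≤ _ :=
      Nat.cast_le.2 (migrationCost_place_le (k := k) hθ hθ')
    have hcol := Nat.cast_le (α := ℝ) |>.2
      (card_col_step_le (π := π) hq hk hD hF h0L hcl hcl' huu hsteps hθ')
    have hcomm' : (commCost (place q D k F θ π u L) r : ℝ) ≤
        (if 2 * k < n ∧ ∃ j < numZones n k, ZoneActive k θ L j ∧ zoneCut k θ π u L j = r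
          then 1 else 0) +
        (∑ I ∈ L', (if ArcCut q D F θ π u r I then 1 else 0) + ∑ I ∈ L' \ L, 1) := by
      have hs1 : (0 : ℝ) ≤ ∑ I ∈ L', (if ArcCut q D F θ π u r I then 1 else 0) :=
        sum_nonneg fun I _ => by split_ifs <;> norm_num
      have hs2 : (0 : ℝ) ≤ ∑ I ∈ L' \ L, 1 := sum_nonneg fun I _ => by norm_num
      have hs3 : (0 : ℝ) ≤ (if 2 * k < n ∧ ∃ j < numZones n k, ZoneActive k θ L j ∧
          zoneCut k θ π u L j = r then 1 else 0) := by split_ifs <;> norm_num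
      have hc1 : (commCost (place q D k F θ π u L) r : ℝ) ≤ 1 := by exact_mod_cast hcomm
      rcases (L' \ L).eq_empty_or_nonempty with hE | ⟨I, hI⟩
      · have hEq : L' = L := Subset.antisymm (sdiff_eq_empty_iff_subset.1 hE) hLL
        by_cases hc : commCost (place q D k F θ π u L) r = 0
        · rw [hc, Nat.cast_zero]
          linarith
        · rcases commCost_place hq hk hD hF h0L hcl (hEq ▸ hcl') hu hθ hc with h | ⟨I, hI, h⟩
          · rw [if_pos h]; linarith
          · have := single_le_sum (f := fun I => (if ArcCut q D F θ π u r I then 1 else 0 : ℝ))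
              (fun I _ => by split_ifs <;> norm_num) (hLL hI)
            simp only [if_pos h] at this
            linarith
      · have := single_le_sum (f := fun _ : Arc => (1 : ℝ)) (fun _ _ => zero_le_one) hI
        linarith
    have harc : ∑ I ∈ L', ((if ArcCut q D F θ π u r I then 1 else 0) +
        (((ringSetting q D F θ π).mvL (wAt θ u) (wAt θ u') (lift θ I) +
          (ringSetting q D F θ π).mvR (wAt θ u) (wAt θ u') (lift θ I) : ℕ) : ℝ)) ≤
        ∑ I ∈ L', arcHit q D I π u r :=
      sum_le_sum fun I hI => le_arcHit (by omega) hθ' hI (h0 I hI) hu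
    rw [sum_add_distrib] at harc
    unfold arcsStep
    rw [sum_add_distrib, sum_add_distrib]
    push_cast at hmig hcol harc
    linarith

end

section
variable {n ℓ : ℕ} [NeZero n]

/-! ### The potential -/

/-- The potential of the zone cuts. -/
noncomputable def zonesPot (k : ℕ) (θ : Fin n) (u : Fin n → ℕ) (L : Finset Arc) : ℝ :=
  open Classical in
  if 2 * k < n then ∑ j ∈ range (numZones n k),
    if ZoneActive k θ L j then 4 * (k : ℝ) + zonePot k θ u j else 0
  else 0

/-- The potential of the arcs. -/
noncomputable def arcsPot (q D : ℕ) (u : Fin n → ℕ) (L : Finset Arc) : ℝ :=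
  open Classical in
  ∑ I ∈ L, (arcPot q D I u + (9 * (I.2 : ℝ) + 1) + if RDead D u I then 9 * (I.2 : ℝ) else 0)

/-- The growth of the potential pays for the expected cost of the algorithm with base edge `θ`. -/
noncomputable def potential (q D k : ℕ) (θ : Fin n) (u : Fin n → ℕ) (L : Finset Arc) : ℝ :=
  open Classical in
  zonesPot k θ u L + arcsPot q D u L + if θ ∈ cov n L then (n : ℝ) + 1 else 0

variable {q D k : ℕ} {F : Placement n ℓ} {θ : Fin n} {u u' : Fin n → ℕ}
  {L L' : Finset Arc} {I : Arc} {r i : Fin n} {j : ℕ}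

theorem zonesPot_nonneg : 0 ≤ zonesPot k θ u L := by
  unfold zonesPot
  split_ifs
  · refine sum_nonneg fun j _ => ?_
    have := zonePot_nonneg (k := k) (θ := θ) (u := u) (j := j)
    split_ifs <;> positivity
  · exact le_rfl

theorem arcsPot_nonneg : 0 ≤ arcsPot q D u L := by
  refine sum_nonneg fun I _ => ?_
  have := arcPot_nonneg (q := q) (D := D) (I := I) (u := u)
  split_ifs <;> positivity

theorem potential_nonneg : 0 ≤ potential q D k θ u L := by
  have h1 := zonesPot_nonneg (k := k) (θ := θ) (u := u) (L := L)
  have h2 := arcsPot_nonneg (q := q) (D := D) (u := u) (L := L)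
  unfold potential
  split_ifs <;> positivity

/-- Averaged over the priorities, a zone cut is paid for by its potential, which includes `4 k` for its
activation. -/
theorem sum_zoneStep_le (hk : 0 < k) (hn : k < n) (hL : L ⊆ L')
    (hu : ∀ i, u' i = u i + if i = r then 1 else 0) :
    ∑ π : Equiv.Perm (Fin n), zoneStep k θ π u L L' r j ≤
      n.factorial * (open Classical in
        (if ZoneActive k θ L' j then 4 * (k : ℝ) + zonePot k θ u' j else 0) -
        if ZoneActive k θ L j then 4 * (k : ℝ) + zonePot k θ u j else 0) := by
  classical
  unfold zoneStep
  by_cases h1 : ZoneActive k θ L j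
  · simp only [if_pos h1, if_pos (h1.mono hL)]
    refine (sum_zoneHit_le hk hn hu).trans_eq ?_
    ring
  · simp only [if_neg h1]
    by_cases h2 : ZoneActive k θ L' j
    · simp only [if_pos h2]
      rw [sum_const, card_univ, Fintype.card_perm, Fintype.card_fin, nsmul_eq_mul, sub_zero]
      have := zonePot_nonneg (k := k) (θ := θ) (u := u') (j := j)
      gcongr
      linarith
    · simp [if_neg h2]

theorem sum_zonesStep_le (hk : 0 < k) (hL : L ⊆ L')
    (hu : ∀ i, u' i = u i + if i = r then 1 else 0) :
    ∑ π : Equiv.Perm (Fin n), zonesStep k θ π u L L' r ≤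
      n.factorial * (zonesPot k θ u' L' - zonesPot k θ u L) := by
  unfold zonesStep zonesPot
  split_ifs with hn
  · rw [sum_comm, ← sum_sub_distrib, mul_sum]
    exact sum_le_sum fun j _ => sum_zoneStep_le hk (by omega) hL hu
  · simp

/-- The potential of the arcs grows by the costs of new arcs, of arcs that die, and of the games. -/
theorem arcsPot_sub (hL : L ⊆ L') (huu : u ≤ u') :
    (open Classical in ∑ I ∈ L' \ L, (9 * (I.2 : ℝ) + 1) +
      ∑ I ∈ L', ((arcPot q D I u' - arcPot q D I u) +
        if RDead D u' I ∧ ¬ (I ∈ L ∧ RDead D u I) then 9 * (I.2 : ℝ) else 0)) ≤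
      arcsPot q D u' L' - arcsPot q D u L := by
  classical
  unfold arcsPot
  rw [← sum_sdiff hL, ← sum_sdiff (f := fun I => arcPot q D I u' + (9 * (I.2 : ℝ) + 1) +
    if RDead D u' I then 9 * (I.2 : ℝ) else 0) hL, ← add_assoc, ← sum_add_distrib, add_sub_assoc,
    ← sum_sub_distrib]
  refine add_le_add (sum_le_sum fun I hI => ?_) (sum_le_sum fun I hI => ?_)
  · have h1 := arcPot_nonneg (q := q) (D := D) (I := I) (u := u)
    have h2 : I ∉ L := (mem_sdiff.1 hI).2
    simp only [h2, false_and, not_false_eq_true, and_true]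
    linarith
  · have h3 : RDead D u I → RDead D u' I := fun h => h.mono huu
    by_cases h1 : RDead D u I
    · simp only [hI, h1, h3 h1, and_self, not_true_eq_false, and_false, if_false, if_true]
      linarith
    · simp only [hI, h1, and_false, not_false_eq_true, and_true, if_false]
      linarith

/-- Averaged over the priorities, the cost of a step is bounded by the growth of the potential. -/
theorem sum_step_le (hk : 0 < k) (hL : L ⊆ L')
    (hu : ∀ i, u' i = u i + if i = r then 1 else 0) :
    ∑ π : Equiv.Perm (Fin n), (zonesStep k θ π u L L' r +
      open Classical in
      if θ ∈ cov n L' then (if θ ∈ cov n L then 0 else (n : ℝ) + 1)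
      else arcsStep q D π u u' L L' r) ≤
      n.factorial * (potential q D k θ u' L' - potential q D k θ u L) := by
  classical
  have huu : u ≤ u' := fun i => by rw [hu]; exact Nat.le_add_right _ _
  have h1 := sum_zonesStep_le (θ := θ) hk hL hu
  have h2 := arcsPot_sub (q := q) (D := D) hL huu
  have hfac : (0 : ℝ) ≤ n.factorial := by positivity
  have hmono : 0 ≤ arcsPot q D u' L' - arcsPot q D u L := by
    refine le_trans (add_nonneg (sum_nonneg fun I _ => by positivity)
      (sum_nonneg fun I _ => add_nonneg (sub_nonneg.2 (arcPot_mono huu)) ?_)) h2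
    split_ifs <;> positivity
  have hconst : ∀ x : ℝ, ∑ _π : Equiv.Perm (Fin n), x = n.factorial * x := fun x => by
    rw [sum_const, card_univ, Fintype.card_perm, Fintype.card_fin, nsmul_eq_mul]
  rw [sum_add_distrib]
  unfold potential
  have hsplit : ∀ a b c a' b' c' : ℝ, (n.factorial : ℝ) * (a' + b' + c' - (a + b + c)) =
      n.factorial * (a' - a) + (n.factorial * (b' - b) + n.factorial * (c' - c)) := by
    intros; ring
  rw [hsplit]
  refine add_le_add h1 ?_
  by_cases hθ' : θ ∈ cov n L'
  · simp only [if_pos hθ']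
    by_cases hθ : θ ∈ cov n L
    · simp only [if_pos hθ, sum_const_zero, sub_self, mul_zero, add_zero]
      positivity
    · simp only [if_neg hθ, sub_zero]
      rw [hconst]
      have := mul_nonneg hfac hmono
      linarith
  · have hθ : θ ∉ cov n L := fun h => hθ' (cov_mono hL h)
    simp only [if_neg hθ', if_neg hθ, sub_zero, mul_zero, add_zero]
    refine le_trans ?_ (mul_le_mul_of_nonneg_left h2 hfac)
    unfold arcsStep
    rw [sum_add_distrib, hconst, mul_add, sum_comm, mul_sum L']
    refine add_le_add le_rfl (sum_le_sum fun I hI => ?_)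
    rw [sum_add_distrib, hconst, mul_add]
    exact add_le_add (sum_arcHit_le (length_lt hθ' hI) hu) le_rfl

/-! ### The online strategy -/

/-- The online strategy with base edge `θ` and priorities `π`. -/
noncomputable def strategy (q D k : ℕ) (F : Placement n ℓ) (θ : Fin n)
    (π : Equiv.Perm (Fin n)) : OnlineStrategy n ℓ := fun σ =>
  place q D k F θ π (fun i => σ.count i) (skel D q F σ)

theorem onlineCost_append {n ℓ : ℕ} (S : OnlineStrategy n ℓ) (σ : List (Request n))
    (r : Request n) :
    onlineCost S (σ ++ [r]) =
      onlineCost S σ + (commCost (S σ) r + migrationCost (S σ) (S (σ ++ [r]))) := by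
  unfold onlineCost
  have hlen : (σ ++ [r]).length = σ.length + 1 := by simp
  rw [← Equiv.sum_comp (finCongr hlen.symm), Fin.sum_univ_castSucc]
  congr 1
  · refine sum_congr rfl fun t _ => ?_
    have h1 := t.isLt
    have e1 : (σ ++ [r]).take t.val = σ.take t.val :=
      List.take_append_of_le_length (by omega)
    have e2 : (σ ++ [r]).take (t.val + 1) = σ.take (t.val + 1) :=
      List.take_append_of_le_length (by omega)
    simp [e1, e2, List.getElem_append_left]
  · have e : (σ ++ [r]).take (σ.length + 1) = σ ++ [r] := List.take_of_length_le (by simp)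
    simp [e]

/-- The expected cost of the strategy with base edge `θ` is bounded by the potential. -/
theorem sum_onlineCost_le (hq : 4 ≤ q) (hk : 1 ≤ k) (hD : D + 1 = 2 * k) (hF : Feasible k F)
    (θ : Fin n) (σ : List (Request n)) :
    ∑ π : Equiv.Perm (Fin n), (onlineCost (strategy q D k F θ π) σ : ℝ) ≤
      n.factorial * potential q D k θ (fun i => σ.count i) (skel D q F σ) := by
  induction σ using List.reverseRecOn with
  | nil =>
    simp only [onlineCost, List.length_nil, univ_eq_empty, sum_empty, Nat.cast_zero, sum_const_zero]
    exact mul_nonneg (by positivity) potential_nonneg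
  | append_singleton σ r ih =>
    obtain ⟨hsteps, _⟩ := skel_step D q F σ r
    have hinv := skel_invariant (D := D) (q := q) (F := F) σ
    have hinv' := skel_invariant (D := D) (q := q) (F := F) (σ ++ [r])
    have hu : ∀ i, (σ ++ [r]).count i = σ.count i + if i = r then 1 else 0 := by
      intro i
      rw [List.count_append, List.count_singleton]
      congr 1
      by_cases h : i = r
      · simp [h]
      · simp [h, Ne.symm h]
    have h1 := sum_step_le (q := q) (D := D) (θ := θ) hk (subset_of_addSteps hsteps) hu
    have h2 : ∀ π : Equiv.Perm (Fin n), _ := fun π => cost_step_le (θ := θ) (π := π) hq hk hD hF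
      (fun I hI => (mem_cands.1 (hinv'.1 I hI).1).2.1) hinv.2.2 hinv'.2.2 hu hsteps
    have h3 := (sum_le_sum fun π _ => h2 π).trans h1
    have h4 : ∀ π : Equiv.Perm (Fin n), (onlineCost (strategy q D k F θ π) (σ ++ [r]) : ℝ) =
        onlineCost (strategy q D k F θ π) σ +
        ((commCost (strategy q D k F θ π σ) r + migrationCost (strategy q D k F θ π σ)
          (strategy q D k F θ π (σ ++ [r])) : ℕ) : ℝ) := fun π => by
      rw [onlineCost_append, Nat.cast_add]
    rw [sum_congr rfl fun π _ => h4 π, sum_add_distrib]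
    unfold strategy at ih ⊢
    linarith

/-! ### The average of the potential -/

/-- The first edge of a window and the edge `θ` are both uniformly random. -/
theorem card_zoneActive_le (L : Finset Arc) (j : ℕ) :
    (open Classical in
      ((univ : Finset (Fin n)).filter fun θ => ZoneActive k θ L j).card) ≤ 2 * (cov n L).card := by
  classical
  have hinj : Function.Injective fun θ : Fin n => pt n (zoneStart k θ j) := fun a b hab => by
    have h1 := a.isLt
    have h2 := b.isLt
    unfold zoneStart at hab
    have := eq_of_pt_eq hab (by omega) (by omega)
    exact Fin.ext (by omega)
  have hsub : ((univ : Finset (Fin n)).filter fun θ => ZoneActive k θ L j) ⊆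
      cov n L ∪ univ.filter fun θ => pt n (zoneStart k θ j) ∈ cov n L := by
    intro θ hθ
    rw [mem_union, mem_filter]
    exact (mem_filter.1 hθ).2.imp id fun h => ⟨mem_univ _, h⟩
  have h1 : ((univ : Finset (Fin n)).filter fun θ => pt n (zoneStart k θ j) ∈ cov n L).card ≤
      (cov n L).card := by
    rw [← card_image_of_injective _ hinj]
    refine card_le_card fun x hx => ?_
    obtain ⟨θ, hθ, rfl⟩ := mem_image.1 hx
    exact (mem_filter.1 hθ).2
  have := (card_le_card hsub).trans (card_union_le _ _)
  omega

theorem sum_pt_le (f : Fin n → ℕ) (x : ℤ) : ∑ i ∈ range n, f (pt n (x + i)) ≤ ∑ e, f e := by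
  have hinj : Set.InjOn (fun i : ℕ => pt n (x + i)) (range n : Finset ℕ) := by
    intro a ha b hb hab
    rw [mem_coe, mem_range] at ha hb
    have := eq_of_pt_eq hab (by omega) (by omega)
    omega
  rw [← sum_image (f := f) hinj]
  exact sum_le_sum_of_subset (subset_univ _)

/-- The windows of the zones cover every edge at most twice. -/
theorem sum_windows_le (hk : 0 < k) (hn : 2 * k < n) (f : Fin n → ℕ) (θ : Fin n) :
    ∑ j ∈ range (numZones n k), ∑ i ∈ range k, f (pt n (zoneStart k θ j + i)) ≤ 2 * ∑ e, f e := by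
  have h1 : ∀ m : ℕ, ∑ j ∈ range m, ∑ i ∈ range k, f (pt n (zoneStart k θ j + i)) =
      ∑ x ∈ range (m * k), f (pt n (θ.val + x)) := by
    intro m
    induction m with
    | zero => simp
    | succ m ih =>
      rw [sum_range_succ, ih, add_mul, one_mul, sum_range_add]
      congr 1
      refine sum_congr rfl fun i _ => ?_
      unfold zoneStart
      push_cast
      rw [add_assoc]
  rw [h1]
  have h2 := (numZones_bounds hk hn).2
  calc _ ≤ ∑ x ∈ range (n + n), f (pt n (θ.val + x)) :=
        sum_le_sum_of_subset (range_mono (by omega))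
    _ = ∑ x ∈ range n, f (pt n (θ.val + x)) + ∑ x ∈ range n, f (pt n (θ.val + n + x)) := by
        rw [sum_range_add]
        congr 1
        refine sum_congr rfl fun x _ => ?_
        push_cast
        rw [add_assoc]
    _ ≤ ∑ e, f e + ∑ e, f e := add_le_add (sum_pt_le f _) (sum_pt_le f _)
    _ = _ := by ring

theorem one_le_harmonic {m : ℕ} (h : 1 ≤ m) : (1 : ℝ) ≤ harmonic m := by
  have := harmonic_mono h
  simpa using this

/-- The zone cuts cost little on average: the windows are activated by the arcs, and in every window
the static algorithm has a cut. -/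
theorem sum_zonesPot_le (hk : 1 ≤ k) (hkD : k ≤ D) {c : Placement n ℓ} (hc : Feasible k c)
    (u : Fin n → ℕ) (L : Finset Arc) :
    ∑ θ : Fin n, zonesPot k θ u L ≤
      n * (40 * harmonic D * (cov n L).card + 24 * harmonic D * (∑ e, u e * commCost c e : ℕ)) := by
  classical
  have hH := one_le_harmonic hk
  have hHD := harmonic_mono hkD
  set H : ℝ := ((harmonic D : ℚ) : ℝ) with hHdef
  unfold zonesPot
  split_ifs with hn
  swap
  · rw [sum_const_zero]
    have : (0 : ℝ) ≤ H := by linarith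
    positivity
  set f : Fin n → ℕ := fun e => u e * commCost c e with hf
  have hterm : ∀ θ j, (if ZoneActive k θ L j then 4 * (k : ℝ) + zonePot k θ u j else 0) ≤
      (if ZoneActive k θ L j then 10 * k * H else 0) +
        12 * H * (∑ i ∈ range k, f (pt n (zoneStart k θ j + i)) : ℕ) := by
    intro θ j
    obtain ⟨i, hi, hcut⟩ := exists_cut_of_feasible hc (by omega : k < n) (zoneStart k θ j)
    have h1 : u (pt n (zoneStart k θ j + i)) ≤ ∑ i ∈ range k, f (pt n (zoneStart k θ j + i)) := by
      have := single_le_sum (f := fun i : ℕ => f (pt n (zoneStart k θ j + i)))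
        (fun _ _ => Nat.zero_le _) (mem_range.2 hi)
      refine le_trans (le_of_eq ?_) this
      simp only [hf, commCost]
      rw [next_pt, if_neg hcut, mul_one]
    have h2 := zonePot_le (k := k) (θ := θ) (j := j) (by omega) ⟨i, hi, h1⟩
    set μ := ∑ i ∈ range k, f (pt n (zoneStart k θ j + i)) with hμ
    have h3 : 6 * (k + 2 * (μ : ℝ)) * harmonic k ≤ 6 * (k + 2 * (μ : ℝ)) * H := by gcongr
    have h4 : (k : ℝ) ≤ k * H := le_mul_of_one_le_right (by positivity) (by linarith)
    split_ifs
    · nlinarith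
    · have : (0 : ℝ) ≤ H := by linarith
      positivity
  have hH0 : (0 : ℝ) ≤ H := by linarith
  calc _ ≤ ∑ θ : Fin n, ∑ j ∈ range (numZones n k),
        ((if ZoneActive k θ L j then 10 * k * H else 0) +
          12 * H * (∑ i ∈ range k, f (pt n (zoneStart k θ j + i)) : ℕ)) :=
        sum_le_sum fun θ _ => sum_le_sum fun j _ => hterm θ j
    _ = (∑ j ∈ range (numZones n k), ∑ θ : Fin n, if ZoneActive k θ L j then 10 * k * H else 0) +
        ∑ θ : Fin n, 12 * H * ((∑ j ∈ range (numZones n k),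
          ∑ i ∈ range k, f (pt n (zoneStart k θ j + i)) : ℕ) : ℝ) := by
        rw [sum_comm (s := range (numZones n k)), ← sum_add_distrib]
        refine sum_congr rfl fun θ _ => ?_
        rw [sum_add_distrib, Nat.cast_sum, mul_sum]
    _ ≤ (∑ _j ∈ range (numZones n k), 2 * (cov n L).card * (10 * k * H)) +
        ∑ _θ : Fin n, 12 * H * ((2 * ∑ e, f e : ℕ) : ℝ) := by
        refine add_le_add (sum_le_sum fun j _ => ?_) (sum_le_sum fun θ _ => ?_)
        · rw [← sum_filter, sum_const, nsmul_eq_mul]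
          have : (((univ : Finset (Fin n)).filter fun θ => ZoneActive k θ L j).card : ℝ) ≤
              2 * (cov n L).card := by exact_mod_cast card_zoneActive_le L j
          gcongr
        · have : ((∑ j ∈ range (numZones n k),
              ∑ i ∈ range k, f (pt n (zoneStart k θ j + i)) : ℕ) : ℝ) ≤ (2 * ∑ e, f e : ℕ) :=
            Nat.cast_le.2 (sum_windows_le (by omega) hn f θ)
          gcongr
    _ = ((numZones n k * k : ℕ) : ℝ) * (20 * H * (cov n L).card) +
        n * (24 * H * (∑ e, f e : ℕ)) := by
        rw [sum_const, sum_const, card_range, card_univ, Fintype.card_fin, nsmul_eq_mul,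
          nsmul_eq_mul]
        push_cast; ring
    _ ≤ ((2 * n : ℕ) : ℝ) * (20 * H * (cov n L).card) + n * (24 * H * (∑ e, f e : ℕ)) := by
        have h1 := (numZones_bounds (by omega : 0 < k) hn).2
        have h2 : numZones n k * k ≤ 2 * n := by omega
        gcongr
    _ = _ := by push_cast; ring

theorem arcsPot_le (hq : 1 ≤ q) (hD : 1 ≤ D) (h0 : ∀ I ∈ L, 1 ≤ I.2) :
    arcsPot q D u L ≤ 307 * q * harmonic D * (∑ I ∈ L, I.2 : ℕ) := by
  have hH := one_le_harmonic hD
  unfold arcsPot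
  rw [Nat.cast_sum, mul_sum]
  refine sum_le_sum fun I hI => ?_
  have h1 := arcPot_le (D := D) (I := I) (u := u) hq
  have h2 : (1 : ℝ) ≤ I.2 := by exact_mod_cast h0 I hI
  have h3 : (1 : ℝ) ≤ q := by exact_mod_cast hq
  have h4 : (1 : ℝ) ≤ q * harmonic D := one_le_mul_of_one_le_of_one_le h3 hH
  have h5 : (I.2 : ℝ) ≤ q * harmonic D * I.2 := le_mul_of_one_le_left (by linarith) h4
  have h6 : (288 * q * I.2 * harmonic D : ℝ) = 288 * (q * harmonic D * I.2) := by ring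
  have h7 : (307 * q * harmonic D * I.2 : ℝ) = 307 * (q * harmonic D * I.2) := by ring
  rw [h7]
  rw [h6] at h1
  split_ifs <;> linarith

/-- The potential, averaged over the base edge, is bounded by the cost of any static algorithm. -/
theorem sum_potential_le (hq : 1 ≤ q) (hk : 1 ≤ k) (hD : D + 1 = 2 * k) {c : Placement n ℓ}
    (hc : Feasible k c) (σ : List (Request n)) :
    ∑ θ : Fin n, potential q D k θ (fun i => σ.count i) (skel D q F σ) ≤
      n * (709 * (q : ℝ) ^ 2 * harmonic D * (Nat.log 2 D + 1 : ℕ) * staticCost F c σ) := by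
  classical
  have hinv := skel_invariant (D := D) (q := q) (F := F) σ
  have h0 : ∀ I ∈ skel D q F σ, 1 ≤ I.2 := fun I hI => (mem_cands.1 (hinv.1 I hI).1).2.1
  have hT := sum_skel_le (D := D) (init := F) hq c σ
  have hcov := card_cov_le (n := n) (skel D q F σ)
  have hzones := sum_zonesPot_le hk (by omega : k ≤ D) hc (fun i => σ.count i) (skel D q F σ)
  have harcs := arcsPot_le (u := fun i : Fin n => σ.count i) hq (by omega : 1 ≤ D) h0
  have hH := one_le_harmonic (by omega : 1 ≤ D)
  have hst : ∑ e, σ.count e * commCost c e ≤ staticCost F c σ := by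
    rw [staticCost_eq]
    exact sum_le_sum fun e _ => Nat.le_add_left _ _
  set T := ∑ I ∈ skel D q F σ, I.2 with hTdef
  set O := staticCost F c σ with hO
  set H : ℝ := ((harmonic D : ℚ) : ℝ) with hHdef
  set a := Nat.log 2 D + 1 with ha
  have hn : (1 : ℝ) ≤ n := by exact_mod_cast Nat.pos_of_ne_zero (NeZero.ne n)
  have hqR : (1 : ℝ) ≤ q := by exact_mod_cast hq
  have haR : (1 : ℝ) ≤ a := by exact_mod_cast Nat.le_add_left 1 _
  have hTR : (T : ℝ) ≤ q * a * O := by exact_mod_cast hT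
  have hcovR : ((cov n (skel D q F σ)).card : ℝ) ≤ 9 * T := by exact_mod_cast hcov
  have hstR : ((∑ e, σ.count e * commCost c e : ℕ) : ℝ) ≤ O := by exact_mod_cast hst
  have hT0 : (0 : ℝ) ≤ T := by positivity
  have hO0 : (0 : ℝ) ≤ O := by positivity
  have hcards : ∑ θ : Fin n, (if θ ∈ cov n (skel D q F σ) then (n : ℝ) + 1 else 0) ≤
      n * (18 * T) := by
    rw [← sum_filter, sum_const, nsmul_eq_mul, filter_mem_eq_inter, univ_inter]
    calc _ ≤ (9 * T : ℝ) * (n + n) := by gcongr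
      _ = _ := by ring
  unfold potential
  rw [sum_add_distrib, sum_add_distrib, sum_const, card_univ, Fintype.card_fin, nsmul_eq_mul]
  have hqH : (1 : ℝ) ≤ q * H := one_le_mul_of_one_le_of_one_le hqR hH
  have e1 : 40 * H * ((cov n (skel D q F σ)).card : ℝ) ≤ 360 * (q * H * T) := by
    have h1 : 40 * H * ((cov n (skel D q F σ)).card : ℝ) ≤ 40 * H * (9 * T) := by gcongr
    have h2 : H * T ≤ q * (H * T) := le_mul_of_one_le_left (by positivity) hqR
    linarith
  have e2 : 24 * H * ((∑ e, σ.count e * commCost c e : ℕ) : ℝ) ≤ 24 * ((q : ℝ) ^ 2 * H * a * O) := by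
    have h1 : H * ((∑ e, σ.count e * commCost c e : ℕ) : ℝ) ≤ H * O := by gcongr
    have h2 : (1 : ℝ) ≤ (q : ℝ) ^ 2 * a := one_le_mul_of_one_le_of_one_le (one_le_pow₀ hqR) haR
    have h3 : H * O ≤ ((q : ℝ) ^ 2 * a) * (H * O) := le_mul_of_one_le_left (by positivity) h2
    linarith
  have e3 : (18 : ℝ) * T ≤ 18 * (q * H * T) := by
    have := le_mul_of_one_le_left hT0 hqH
    linarith
  have e4 : (q * H * T : ℝ) ≤ (q : ℝ) ^ 2 * H * a * O := by
    have : (q * H * T : ℝ) ≤ q * H * (q * a * O) := by gcongr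
    linarith
  have e5 : arcsPot q D (fun i => σ.count i) (skel D q F σ) ≤ 307 * (q * H * T) := by linarith
  have e6 : n * (arcsPot q D (fun i => σ.count i) (skel D q F σ)) ≤ (n : ℝ) * (307 * (q * H * T)) := by
    gcongr
  have e7 : (n : ℝ) * (40 * H * ((cov n (skel D q F σ)).card : ℝ) +
      24 * H * ((∑ e, σ.count e * commCost c e : ℕ) : ℝ)) ≤
      n * (360 * (q * H * T) + 24 * ((q : ℝ) ^ 2 * H * a * O)) := by gcongr
  have e8 : (n : ℝ) * (18 * T) ≤ n * (18 * (q * H * T)) := by gcongr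
  calc _ ≤ (n : ℝ) * (360 * (q * H * T) + 24 * ((q : ℝ) ^ 2 * H * a * O)) +
        n * (307 * (q * H * T)) + n * (18 * (q * H * T)) :=
        add_le_add (add_le_add (hzones.trans e7) e6) (hcards.trans e8)
    _ = n * (685 * (q * H * T) + 24 * ((q : ℝ) ^ 2 * H * a * O)) := by ring
    _ ≤ n * (685 * ((q : ℝ) ^ 2 * H * a * O) + 24 * ((q : ℝ) ^ 2 * H * a * O)) := by gcongr
    _ = _ := by ring

end

/-! ### The randomized algorithm -/

/-- The randomized algorithm that plays one of finitely many strategies, chosen uniformly. -/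
noncomputable def uniformAlgorithm {n ℓ : ℕ} {init : Placement n ℓ} (Ω : Type) [Fintype Ω]
    [Nonempty Ω] (S : Ω → OnlineStrategy n ℓ) (hS : ∀ ω, S ω [] = init) :
    RandomizedOnlineAlgorithm init :=
  letI : MeasurableSpace Ω := ⊤
  { Ω := Ω
    mΩ := ⊤
    μ := (PMF.uniformOfFintype Ω).toMeasure
    isProb := inferInstance
    strategy := S
    measurable_strategy := fun _ => measurable_from_top
    strategy_nil := hS }

theorem expectedCost_uniformAlgorithm {n ℓ : ℕ} {init : Placement n ℓ} (Ω : Type) [Fintype Ω]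
    [Nonempty Ω] (S : Ω → OnlineStrategy n ℓ) (hS : ∀ ω, S ω [] = init) (σ : List (Request n)) :
    (uniformAlgorithm Ω S hS).expectedCost σ =
      (Fintype.card Ω : ℝ)⁻¹ * ∑ ω, (onlineCost (S ω) σ : ℝ) := by
  let _ : MeasurableSpace Ω := ⊤
  have : MeasurableSingletonClass Ω := ⟨fun _ => trivial⟩
  unfold RandomizedOnlineAlgorithm.expectedCost
  change ∫ ω, (onlineCost (S ω) σ : ℝ) ∂(PMF.uniformOfFintype Ω).toMeasure = _
  rw [PMF.integral_eq_sum, mul_sum]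
  refine sum_congr rfl fun ω _ => ?_
  simp [PMF.uniformOfFintype_apply]

/-- Without processes there is nothing to pay. -/
theorem exists_algorithm_of_isEmpty {n ℓ k : ℕ} [IsEmpty (Fin n)] {init : Placement n ℓ}
    (hF : Feasible k init) {α : ℝ} (hα : 1 ≤ α) :
    ∃ A : RandomizedOnlineAlgorithm init, A.UsesAugmentation α k ∧
      ∀ σ : List (Request n), A.expectedCost σ = 0 := by
  refine ⟨uniformAlgorithm Unit (fun _ _ => init) fun _ => rfl, fun ω h s => ?_, fun σ => ?_⟩
  · have h1 : (load init s : ℝ) ≤ k := by exact_mod_cast hF s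
    exact h1.trans (le_mul_of_one_le_left (by positivity) hα)
  · have h1 : σ = [] := List.eq_nil_iff_forall_not_mem.2 fun i => (IsEmpty.false i).elim
    subst h1
    rw [expectedCost_uniformAlgorithm]
    simp [onlineCost]

/-- With the precision `q = 2 c + 1`, the algorithm has resource augmentation `3 + 2 / c`. -/
theorem exists_algorithm {n ℓ k c : ℕ} [NeZero n] (hk : 1 ≤ k) (hc : 2 ≤ c)
    {init : Placement n ℓ} (hF : Feasible k init) :
    ∃ A : RandomizedOnlineAlgorithm init, A.UsesAugmentation (3 + 2 / c) k ∧
      ∀ σ : List (Request n), A.expectedCost σ ≤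
        709 * (2 * c + 1 : ℝ) ^ 2 * harmonic (2 * k - 1) * (Nat.log 2 (2 * k - 1) + 1 : ℕ) *
          staticOpt k init σ := by
  have hD : 2 * k - 1 + 1 = 2 * k := by omega
  have hq : 4 ≤ 2 * c + 1 := by omega
  have hn : (0 : ℝ) < n := by exact_mod_cast Nat.pos_of_ne_zero (NeZero.ne n)
  have hfac : (0 : ℝ) < n.factorial := by positivity
  set D := 2 * k - 1 with hDdef
  refine ⟨uniformAlgorithm (Fin n × Equiv.Perm (Fin n))
    (fun ω => strategy (2 * c + 1) D k init ω.1 ω.2)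
    (fun ω => ?_), fun ω σ s => ?_, fun σ => ?_⟩
  · unfold strategy
    simp only [List.count_nil, skel_nil]
    exact place_init hq hk hD hF
  · have hinv := skel_invariant (D := D) (q := 2 * c + 1) (F := init) σ
    have h1 := load_place_le (θ := ω.1) (π := ω.2) rfl hq hk hD hF
      (fun I hI => (mem_cands.1 (hinv.1 I hI).1).2.1) hinv.2.2 s
    have h2 : (c : ℝ) * load (strategy (2 * c + 1) D k init ω.1 ω.2 σ) s ≤ c * (3 * k) + 2 * k := by
      exact_mod_cast h1
    have hc0 : (0 : ℝ) < c := by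
      have : (2 : ℝ) ≤ c := by exact_mod_cast hc
      linarith
    change (load (strategy (2 * c + 1) D k init ω.1 ω.2 σ) s : ℝ) ≤ _
    refine le_of_mul_le_mul_left (h2.trans_eq ?_) hc0
    field_simp
  · obtain ⟨d, hd, hopt⟩ := exists_staticCost_eq_staticOpt hF σ
    have h1 := sum_potential_le (q := 2 * c + 1) (F := init) (by omega) hk hD hd σ
    rw [hopt] at h1
    rw [expectedCost_uniformAlgorithm, Fintype.card_prod, Fintype.card_fin, Fintype.card_perm,
      Fintype.card_fin, Fintype.sum_prod_type]
    have h2 : ∑ θ : Fin n, ∑ π : Equiv.Perm (Fin n),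
        (onlineCost (strategy (2 * c + 1) D k init θ π) σ : ℝ) ≤
        n.factorial * ∑ θ : Fin n, potential (2 * c + 1) D k θ (fun i => σ.count i)
          (skel D (2 * c + 1) init σ) := by
      rw [mul_sum]
      exact sum_le_sum fun θ _ => sum_onlineCost_le hq hk hD hF θ σ
    have h3 := h2.trans (mul_le_mul_of_nonneg_left h1 hfac.le)
    rw [Nat.cast_mul, inv_mul_le_iff₀ (mul_pos hn hfac)]
    refine h3.trans_eq ?_
    push_cast
    ring

theorem harmonic_le_log {k : ℕ} (hk : 2 ≤ k) : (harmonic (2 * k - 1) : ℝ) ≤ 4 * Real.log k := by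
  have h1 : (0 : ℝ) < k := by exact_mod_cast (by omega : 0 < k)
  have h2 : Real.log 2 ≤ Real.log k := Real.log_le_log (by norm_num) (by exact_mod_cast hk)
  have h3 := harmonic_mono (by omega : 2 * k - 1 ≤ 2 * k)
  have h4 := harmonic_le_one_add_log (2 * k)
  have h5 : Real.log ((2 * k : ℕ) : ℝ) = Real.log 2 + Real.log k := by
    rw [Nat.cast_mul, Nat.cast_ofNat, Real.log_mul (by norm_num) h1.ne']
  have h6 := Real.log_two_gt_d9
  rw [h5] at h4
  linarith

theorem natLog_add_one_le_log {k : ℕ} (hk : 2 ≤ k) :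
    ((Nat.log 2 (2 * k - 1) + 1 : ℕ) : ℝ) ≤ 5 * Real.log k := by
  have h1 : (0 : ℝ) < k := by exact_mod_cast (by omega : 0 < k)
  have h2 : Real.log 2 ≤ Real.log k := Real.log_le_log (by norm_num) (by exact_mod_cast hk)
  have h3 : 2 ^ Nat.log 2 (2 * k - 1) ≤ 2 * k :=
    (Nat.pow_log_le_self 2 (by omega)).trans (by omega)
  have h4 : (Nat.log 2 (2 * k - 1) : ℝ) * Real.log 2 ≤ Real.log 2 + Real.log k := by
    rw [← Real.log_pow, ← Real.log_mul (by norm_num) h1.ne']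
    exact Real.log_le_log (by positivity) (by exact_mod_cast h3)
  have h6 := Real.log_two_gt_d9
  have h7 : (0 : ℝ) ≤ Nat.log 2 (2 * k - 1) := by positivity
  push_cast
  nlinarith

end RingPartitioning

theorem theorem2 :
    ∃ C : ℝ, 0 < C ∧
      ∀ (n ℓ k : ℕ), 2 ≤ k → ∀ ε : ℝ, 0 < ε →
        ∀ init : RingPartitioning.Placement n ℓ, RingPartitioning.Feasible k init →
          ∃ A : RingPartitioning.RandomizedOnlineAlgorithm init,
            A.UsesAugmentation (3 + ε) k ∧
            ∀ σ : List (RingPartitioning.Request n),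
              A.expectedCost σ ≤
                C * (1 / (min ε 1) ^ 2) * (Real.log k) ^ 2 *
                  (RingPartitioning.staticOpt k init σ : ℝ) := by
  refine ⟨709 * 49 * 20, by norm_num, fun n ℓ k hk ε hε init hF => ?_⟩
  have hδ : 0 < min ε 1 := lt_min hε one_pos
  have hlog : 0 ≤ Real.log k := Real.log_natCast_nonneg k
  rcases Nat.eq_zero_or_pos n with rfl | hn
  · obtain ⟨A, h1, h2⟩ := RingPartitioning.exists_algorithm_of_isEmpty hF
      (by linarith : (1 : ℝ) ≤ 3 + ε)
    refine ⟨A, h1, fun σ => ?_⟩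
    rw [h2]
    positivity
  have : NeZero n := ⟨hn.ne'⟩
  set δ := min ε 1 with hδdef
  have hδ1 : δ ≤ 1 := min_le_right _ _
  set c := ⌈2 / δ⌉₊ with hcdef
  have h2δ : 2 ≤ 2 / δ := by rw [le_div_iff₀ hδ]; linarith
  have hc1 : 2 / δ ≤ c := Nat.le_ceil _
  have hc2 : (c : ℝ) < 2 / δ + 1 := Nat.ceil_lt_add_one (by positivity)
  have hc : 2 ≤ c := by exact_mod_cast h2δ.trans hc1
  have hc0 : (0 : ℝ) < c := by linarith
  obtain ⟨A, h1, h2⟩ := RingPartitioning.exists_algorithm (by omega : 1 ≤ k) hc hF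
  refine ⟨A, fun ω h s => (h1 ω h s).trans ?_, fun σ => (h2 σ).trans ?_⟩
  · have h3 : 2 / (c : ℝ) ≤ δ := by
      rw [div_le_iff₀ hc0]
      rw [div_le_iff₀ hδ] at hc1
      linarith
    have h4 : δ ≤ ε := min_le_left _ _
    gcongr
    exact h3.trans h4
  · have h3 : (2 * c + 1 : ℝ) ≤ 7 / δ := by
      have h4 : 1 ≤ 1 / δ := by rw [le_div_iff₀ hδ]; linarith
      have h5 : 7 / δ = 2 * (2 / δ) + 3 * (1 / δ) := by ring
      linarith
    have h4 := RingPartitioning.harmonic_le_log hk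
    have h5 := RingPartitioning.natLog_add_one_le_log hk
    have h6 := RingPartitioning.harmonic_nonneg (2 * k - 1)
    calc _ ≤ 709 * (7 / δ) ^ 2 * (4 * Real.log k) * (5 * Real.log k) *
          (RingPartitioning.staticOpt k init σ : ℝ) := by gcongr
      _ = _ := by ring
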